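/- Let $a,b\ge 1$ be integers and, for $1\le c\le a-1$, let the wall $W$ be the two-step substrate with period $a$ whose integer heights are $\bar h_i=0$ for $0\le i\le c-1$ and $\bar h_i=b$ for $c\le i\le a-1$ (continued $a$-periodically). For a box of length $N$, a configuration is a sequence of integer heights $h_0,\dots,h_N$ with $h_i\ge\bar h_i$ for all $i$, $h_0=\bar h_0$, $h_N=\bar h_N$; $\Gamma$ denotes its polygonal line, consisting of the horizontal unit segments at height $h_i$ between $i$ and $i+1$ ($0\le i\le N-1$) and the vertical segments at the sites $i$ between the heights $h_{i-1}$ and $h_i$ ($1\le i\le N$), and $W$ denotes also the polygonal line of $\bar h_0,\dots,\bar h_N$. With $|\cdot|$ denoting length, and real constants $J_{AB},J_{AW},J_{BW}$, put $$H_N(\Gamma,W)=J_{AB}\,|\Gamma\setminus(\Gamma\cap W)|+J_{AW}\,|\Gamma\cap W|+J_{BW}\,|W\setminus(\Gamma\cap W)| .$$ For $\beta>0$ let $$\tau_{AW}=\lim_{N\to\infty,\ a\mid N}-\frac1{\beta N}\log\sum_\Gamma e^{-\beta H_N(\Gamma,W)},\qquad \tau_{BW}=r\,J_{BW},\qquad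 r=1+\frac1a\sum_{i=1}^a|\bar h_i-\bar h_{i-1}|,$$ and write $\Delta\tau(r,c)=\tau_{AW}-\tau_{BW}$. Theorem. Assume that $J=J_{AB}>0$ and $J'=J_{AW}-J_{BW}>0$ satisfy $J-(2b+1)J'=2(b+1)K_1>0$, and let $\beta>0$. For every $1\le c\le a-1$ the roughness is $r=1+2b/a$, independently of $c$, the sums over $\Gamma$ converge, and the limit defining $\tau_{AW}$ exists. Put $$M=\min\{(b+1)J',\ 2(b+1)K_1,\ |J'-(b+1)K_1|\},$$ and let $c_0=(a+5)/2$ if $a$ is odd, while if $a$ is even, $c_0=a/2+2$ when $J'<(b+1)K_1$ and $c_0=a/2+3$ when $J'>(b+1)K_1$. Then, for every integer $c$ such that $\beta M>(b+1)\bigl(1.9\,(a+c)+0.56\bigr)$ (which forces $J'\ne(b+1)K_1$): a) if $2\le c\le a-1$, then $\Delta\tau(r,1)<\Delta\tau(r,c)$; b) if $1\le c\le c_0-1$ and $c\le a-2$, then $\Delta\tau(r,c)<\Delta\tau(r,c+1)$; c) if $c_0\le c\le a-2$, then $\Delta\tau(r,c)>\Delta\tau(r,c+1)$. -/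

import Mathlib

namespace SOSWetting

/-- Unit lattice bonds in the plane: `horiz i y` is the segment from `(i, y)` to `(i + 1, y)`,
and `vert i y` is the segment from `(i, y)` to `(i, y + 1)`. -/
inductive Bond where
  | horiz (i : ℕ) (y : ℤ) : Bond
  | vert (i : ℕ) (y : ℤ) : Bond
  deriving DecidableEq

/-- The polygonal line of the height configuration `h 0, …, h N`, as a set of unit bonds:
for `0 ≤ i ≤ N - 1` the horizontal bond at height `h i` between `i` and `i + 1`, and for
`1 ≤ i ≤ N` the vertical bonds at site `i` between the heights `h (i - 1)` and `h i`.
The length of (a part of) the line is the number of its bonds. -/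
noncomputable def interface {N : ℕ} (h : Fin (N + 1) → ℤ) : Finset Bond :=
  (Finset.univ.image fun i : Fin N => Bond.horiz i (h i.castSucc)) ∪
    Finset.univ.biUnion fun i : Fin N =>
      (Finset.Ico (min (h i.castSucc) (h i.succ)) (max (h i.castSucc) (h i.succ))).image
        fun y => Bond.vert (i + 1) y

/-- The energy
`J_AB |Γ \ (Γ ∩ W)| + J_AW |Γ ∩ W| + J_BW |W \ (Γ ∩ W)|` of the interface `Γ` over the wall `W`. -/
noncomputable def energy (JAB JAW JBW : ℝ) (Γ W : Finset Bond) : ℝ :=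
  JAB * ((Γ \ (Γ ∩ W)).card : ℝ) + JAW * ((Γ ∩ W).card : ℝ) + JBW * ((W \ (Γ ∩ W)).card : ℝ)

/-- The restriction of a wall, given by its heights, to the box of length `N`. -/
def restrict (w : ℕ → ℤ) (N : ℕ) : Fin (N + 1) → ℤ := fun i => w i

/-- The height configurations in the box of length `N` that stay above the wall `w` and are pinned
to it at both ends. -/
def Config (w : ℕ → ℤ) (N : ℕ) : Type :=
  {h : Fin (N + 1) → ℤ // h 0 = w 0 ∧ h (Fin.last N) = w N ∧ ∀ i : Fin (N + 1), w i ≤ h i}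

/-- The Boltzmann weight `exp (-β H_N(Γ, W))`. -/
noncomputable def weight (β JAB JAW JBW : ℝ) (w : ℕ → ℤ) (N : ℕ) (h : Config w N) : ℝ :=
  Real.exp (-β * energy JAB JAW JBW (interface h.1) (interface (restrict w N)))

/-- The partition function: the sum of the Boltzmann weights over all configurations. -/
noncomputable def partition (β JAB JAW JBW : ℝ) (w : ℕ → ℤ) (N : ℕ) : ℝ :=
  ∑' h : Config w N, weight β JAB JAW JBW w N h

/-- The finite-volume wall tension `-(1 / (β N)) log Z_N` in the box of length `N = p a`. -/
noncomputable def finiteTension (β JAB JAW JBW : ℝ) (a : ℕ) (w : ℕ → ℤ) (p : ℕ) : ℝ :=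
  -(1 / (β * ((p * a : ℕ) : ℝ))) * Real.log (partition β JAB JAW JBW w (p * a))

/-- The wall tension `τ_AW`, the limit over boxes whose length is a multiple of the period `a`. -/
noncomputable def tauAW (β JAB JAW JBW : ℝ) (a : ℕ) (w : ℕ → ℤ) : ℝ :=
  Filter.limUnder Filter.atTop (finiteTension β JAB JAW JBW a w)

/-- The roughness `r = 1 + (∑_{i=1}^a |w_i - w_{i-1}|) / a` of a wall of period `a`. -/
noncomputable def roughness (a : ℕ) (w : ℕ → ℤ) : ℝ :=
  1 + (∑ i ∈ Finset.Icc 1 a, |(w i : ℝ) - (w (i - 1) : ℝ)|) / (a : ℝ)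

/-- The wall tension `τ_BW = r J_BW`. -/
noncomputable def tauBW (JBW : ℝ) (a : ℕ) (w : ℕ → ℤ) : ℝ := roughness a w * JBW

/-- The two-step wall of period `a`: height `0` on the sites `0, …, c - 1`, and height `b` on the
sites `c, …, a - 1`. -/
def stepWall (a b c : ℕ) : ℕ → ℤ := fun i => if i % a < c then 0 else (b : ℤ)

/-- The difference of wall tensions `Δτ = τ_AW - τ_BW` for the two-step wall. -/
noncomputable def deltaTau (β JAB JAW JBW : ℝ) (a b c : ℕ) : ℝ :=
  tauAW β JAB JAW JBW a (stepWall a b c) - tauBW JBW a (stepWall a b c)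

/-- `M = min {(b + 1) J', 2 (b + 1) K₁, |J' - (b + 1) K₁|}`. -/
noncomputable def gap (b : ℕ) (J' K₁ : ℝ) : ℝ :=
  min (((b : ℝ) + 1) * J') (min (2 * ((b : ℝ) + 1) * K₁) |J' - ((b : ℝ) + 1) * K₁|)

/-- The condition `β M > (b + 1) (1.9 (a + c) + 0.56)`: the temperature is low enough. -/
def LowTemp (β : ℝ) (a b c : ℕ) (J' K₁ : ℝ) : Prop :=
  ((b : ℝ) + 1) * (1.9 * ((a : ℝ) + (c : ℝ)) + 0.56) < β * gap b J' K₁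

/-- The turning point `c₀`: it is `(a + 5) / 2` for odd `a`; for even `a` it is `a / 2 + 2` if
`J' < (b + 1) K₁` and `a / 2 + 3` if `J' > (b + 1) K₁`. (In case of equality `LowTemp` fails.) -/
noncomputable def turningPoint (a b : ℕ) (J' K₁ : ℝ) : ℕ :=
  if Odd a then (a + 5) / 2
  else if J' < ((b : ℝ) + 1) * K₁ then a / 2 + 2
  else a / 2 + 3

end SOSWetting

/-!
The interface is a path of nonnegative heights above the wall, and its energy is a sum over columns
(`weight_eq_prod`). Let `s = exp (-β J)`, `u = exp (-β J')` and `p ^ 2 = s / u`. After division by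
the weight of the path that follows the wall, the partition function of `n` periods becomes a matrix
element `⟪e₀, T ^ n e₀⟫` on `ℓ²(ℕ)`, where `T = A ^ (c - 1) Y A ^ (a - c + 1) Y†` is the transfer
operator of one period (`hasSum_weight`, `operatorProd_wallOperator`). Here `A` is the transfer
operator of a flat wall, with the kernel `s ^ |x - y|` weighted by a factor `p` at each end above
height `0`, and `Y` corrects it at a step of the wall. The matrix elements are supermultiplicative,
so they have a growth rate `L` (`exists_hasRate`), and `Δτ` is a constant that does not depend on `c`
minus `L / (β a)` (`exists_rate_deltaTau`). It remains to compare growth rates for different `c`.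

The exponential kernel is `(1 - s ^ 2) Q† Q`, where `Q = (1 - s S)⁻¹` is the resolvent of the shift
`S`. Hence `A` is positive, it has an explicit bound state `φ`, of an eigenvalue `Λ ≥ 1` close to
`1`, and on the orthogonal complement of `φ` its form lies between `p ^ 2 (1 - s) / (1 + s)` and
`p ^ 2 (1 + s) / (1 - s)` (`flatTransfer_spectralGap`). Split by `φ` and its complement, the rate
`exp L` consists of the term `Λ ^ a ⟪φ, Y φ⟫ ^ 2`, which is the same for all `c`, and of two excess
terms. In the well excess, of the order `P ^ (c - 1) * P u ^ (-2 b)` with `P = p ^ 2`, the interface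
runs above the well instead of following its walls; in the plateau excess, of the order
`P ^ (a - c + 1) * P s ^ 2`, it is detached over the plateau. The upper bound
(`SpectralGap.inner_coupled_le`) holds up to an error `P ^ a u ^ (-2 b)`, and Rayleigh quotients
with the test vector `φ` give a lower bound with either one of the excess terms
(`SpectralGap.le_moment_one`). Both pass from quadratic forms to growth rates because the moments of
a product of two positive operators are log-convex (`moment_sq_le`).

At low temperature the larger excess decides the comparison (`SmallWeights.rate_lt`). For `c = 1` the
well excess beats everything. As `c` grows by `1`, the well excess is multiplied and the plateau
excess divided by `P`; the turning point is where the exponents of the well excess at `c` and of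
the plateau excess at `c + 1` cross (`exponent_lt_turningPoint`, `exponent_turningPoint_le`).
-/

namespace SOSWetting
open ContinuousLinearMap InnerProductSpace Filter
open scoped InnerProductSpace Topology

/-! ### Positive operators and their moments -/

theorem sq_inner_le_of_isPositive {H : Type*} [NormedAddCommGroup H] [InnerProductSpace ℝ H]
    {T : H →L[ℝ] H} (hT : T.IsPositive) (x y : H) :
    ⟪x, T y⟫_ℝ ^ 2 ≤ ⟪x, T x⟫_ℝ * ⟪y, T y⟫_ℝ := by
  have h := LinearMap.BilinForm.apply_mul_apply_le_of_forall_zero_le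
    ((innerₗ H).compl₂ (T : H →ₗ[ℝ] H))
    (fun x => by simpa using hT.inner_nonneg_right x) x y
  have h2 : ⟪y, T x⟫_ℝ = ⟪x, T y⟫_ℝ := by
    rw [← hT.inner_left_eq_inner_right, real_inner_comm]
  simp at h
  rw [h2] at h
  nlinarith

theorem isPositive_sandwich {H : Type*} [NormedAddCommGroup H] [InnerProductSpace ℝ H]
    [CompleteSpace H] {S T : H →L[ℝ] H} (hS : S.IsPositive) (hT : T.IsPositive) :
    (S * T * S).IsPositive := by
  have := hT.adjoint_conj S
  rwa [hS.isSelfAdjoint.adjoint_eq] at this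

theorem isPositive_pow {H : Type*} [NormedAddCommGroup H] [InnerProductSpace ℝ H]
    [CompleteSpace H] {T : H →L[ℝ] H} (hT : T.IsPositive) (n : ℕ) : (T ^ n).IsPositive := by
  induction n using Nat.twoStepInduction with
  | zero => simp
  | one => simpa using hT
  | more n ih _ =>
    have : T ^ (n + 2) = T * T ^ n * T := by rw [pow_succ, pow_succ']
    rw [this]; exact isPositive_sandwich hT ih

/-- The moments `⟪f, K (M K)^k f⟫` of the operator `M K`, which is symmetric for the semi-inner
product of the positive operator `K`. -/
noncomputable def moment {H : Type*} [NormedAddCommGroup H] [InnerProductSpace ℝ H]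
    (M K : H →L[ℝ] H) (f : H) (k : ℕ) : ℝ := ⟪f, K (((M * K) ^ k) f)⟫_ℝ

theorem moment_add {H : Type*} [NormedAddCommGroup H] [InnerProductSpace ℝ H]
    {M K : H →L[ℝ] H} (hM : M.IsPositive) (hK : K.IsPositive) (f : H) (i j : ℕ) :
    moment M K f (i + j) = ⟪((M * K) ^ i) f, K (((M * K) ^ j) f)⟫_ℝ := by
  induction i generalizing j with
  | zero => simp [moment]
  | succ i ih =>
    have e : i + 1 + j = i + (j + 1) := by ring
    rw [e, ih, pow_succ' _ i, pow_succ' _ j]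
    change ⟪_, K (M (K _))⟫_ℝ = ⟪M (K _), K _⟫_ℝ
    rw [hM.inner_left_eq_inner_right, hK.inner_left_eq_inner_right]
    rfl

theorem moment_nonneg {H : Type*} [NormedAddCommGroup H] [InnerProductSpace ℝ H]
    {M K : H →L[ℝ] H} (hM : M.IsPositive) (hK : K.IsPositive) (f : H) (k : ℕ) :
    0 ≤ moment M K f k := by
  obtain ⟨j, rfl | rfl⟩ := k.even_or_odd'
  · rw [two_mul, moment_add hM hK]
    exact hK.inner_nonneg_right _
  · rw [show 2 * j + 1 = j + (j + 1) by ring, moment_add hM hK, pow_succ' _ j]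
    change 0 ≤ ⟪_, K (M (K _))⟫_ℝ
    rw [← hK.inner_left_eq_inner_right]
    exact hM.inner_nonneg_right _

/-- Log-convexity of the moments: alternately the Cauchy-Schwarz inequality for the forms of `K` and
of `M`. -/
theorem moment_sq_le {H : Type*} [NormedAddCommGroup H] [InnerProductSpace ℝ H]
    {M K : H →L[ℝ] H} (hM : M.IsPositive) (hK : K.IsPositive) (f : H) (k : ℕ) :
    moment M K f (k + 1) ^ 2 ≤ moment M K f k * moment M K f (k + 2) := by
  obtain ⟨j, rfl | rfl⟩ := k.even_or_odd'
  · rw [show 2 * j + 1 = j + (j + 1) by ring, show 2 * j = j + j by ring,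
      show j + j + 2 = (j + 1) + (j + 1) by ring, moment_add hM hK, moment_add hM hK,
      moment_add hM hK]
    exact sq_inner_le_of_isPositive hK _ _
  · have key : ∀ i l, moment M K f (i + (l + 1)) =
        ⟪K (((M * K) ^ i) f), M (K (((M * K) ^ l) f))⟫_ℝ := fun i l => by
      rw [moment_add hM hK, pow_succ' _ l, hK.inner_left_eq_inner_right]
      rfl
    rw [show 2 * j + 1 + 1 = j + (j + 1 + 1) by ring, show 2 * j + 1 = j + (j + 1) by ring,
      show j + (j + 1) + 2 = (j + 1) + (j + 1 + 1) by ring, key, key, key]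
    exact sq_inner_le_of_isPositive hM _ _

theorem moment_succ_le {H : Type*} [NormedAddCommGroup H] [InnerProductSpace ℝ H]
    {M K : H →L[ℝ] H} (hM : M.IsPositive) (hK : K.IsPositive) {ρ : ℝ} (hρ : 0 ≤ ρ)
    (h : ∀ f, ⟪f, K (M (K f))⟫_ℝ ≤ ρ * ⟪f, K f⟫_ℝ) (f : H) (k : ℕ) :
    moment M K f (k + 1) ≤ ρ * moment M K f k := by
  have even : ∀ j, moment M K f (j + j + 1) ≤ ρ * moment M K f (j + j) := fun j => by
    rw [add_assoc, moment_add hM hK, moment_add hM hK, pow_succ' _ j]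
    exact h _
  obtain ⟨j, rfl | rfl⟩ := k.even_or_odd'
  · rw [two_mul]; exact even j
  · have h1 := moment_sq_le hM hK f (2 * j + 1)
    have h2 := even (j + 1)
    rw [show j + 1 + (j + 1) = 2 * j + 1 + 1 by ring] at h2
    have n1 := moment_nonneg hM hK f (2 * j + 1)
    have n2 := moment_nonneg hM hK f (2 * j + 1 + 1)
    rcases n2.eq_or_lt with h0 | h0
    · rw [← h0]; positivity
    · have h3 := mul_le_mul_of_nonneg_left h2 n1
      refine le_of_mul_le_mul_right ?_ h0
      nlinarith

theorem moment_le {H : Type*} [NormedAddCommGroup H] [InnerProductSpace ℝ H]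
    {M K : H →L[ℝ] H} (hM : M.IsPositive) (hK : K.IsPositive) {ρ : ℝ} (hρ : 0 ≤ ρ)
    (h : ∀ f, ⟪f, K (M (K f))⟫_ℝ ≤ ρ * ⟪f, K f⟫_ℝ) (f : H) (k : ℕ) :
    moment M K f k ≤ ρ ^ k * moment M K f 0 := by
  induction k with
  | zero => simp
  | succ k ih =>
    calc _ ≤ _ := moment_succ_le hM hK hρ h f k
      _ ≤ ρ * (ρ ^ k * moment M K f 0) := by gcongr
      _ = _ := by ring

/-- By log-convexity the ratios of successive moments increase, so that one Rayleigh quotient bounds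
all moments from below. -/
theorem le_moment {H : Type*} [NormedAddCommGroup H] [InnerProductSpace ℝ H]
    {M K : H →L[ℝ] H} (hM : M.IsPositive) (hK : K.IsPositive) (f : H)
    {σ : ℝ} (hσ : 0 < σ) (h0 : 0 < moment M K f 0) (h1 : σ * moment M K f 0 ≤ moment M K f 1)
    (k : ℕ) : σ ^ k * moment M K f 0 ≤ moment M K f k := by
  have key : ∀ k, 0 < moment M K f k ∧ σ * moment M K f k ≤ moment M K f (k + 1) := by
    intro k
    induction k with
    | zero => exact ⟨h0, h1⟩
    | succ k ih =>
      have hpos : 0 < moment M K f (k + 1) := lt_of_lt_of_le (mul_pos hσ ih.1) ih.2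
      refine ⟨hpos, ?_⟩
      have h2 := moment_sq_le hM hK f k
      refine le_of_mul_le_mul_left ?_ ih.1
      nlinarith [mul_le_mul_of_nonneg_right ih.2 hpos.le]
  induction k with
  | zero => simp
  | succ k ih =>
    calc _ = σ * (σ ^ k * moment M K f 0) := by ring
      _ ≤ σ * moment M K f k := by gcongr
      _ ≤ _ := (key k).2

/-! ### Operators with an isolated simple eigenvalue -/

/-- A positive operator `T` with the unit eigenvector `φ` of eigenvalue `μ`, whose quadratic form
lies between `lo` and `hi` on the orthogonal complement of `φ`. -/
structure SpectralGap {H : Type*} [NormedAddCommGroup H] [InnerProductSpace ℝ H]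
    (T : H →L[ℝ] H) (φ : H) (μ lo hi : ℝ) : Prop where
  pos : T.IsPositive
  norm_eq : ‖φ‖ = 1
  apply_eq : T φ = μ • φ
  eigenvalue_nonneg : 0 ≤ μ
  lo_nonneg : 0 ≤ lo
  hi_nonneg : 0 ≤ hi
  le_inner : ∀ f, ⟪φ, f⟫_ℝ = 0 → lo * ‖f‖ ^ 2 ≤ ⟪f, T f⟫_ℝ
  inner_le : ∀ f, ⟪φ, f⟫_ℝ = 0 → ⟪f, T f⟫_ℝ ≤ hi * ‖f‖ ^ 2

/-- The component of `f` orthogonal to the unit vector `φ`. -/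
noncomputable def perp {H : Type*} [NormedAddCommGroup H] [InnerProductSpace ℝ H] (φ f : H) : H :=
  f - ⟪φ, f⟫_ℝ • φ

namespace SpectralGap

variable {H : Type*} [NormedAddCommGroup H] [InnerProductSpace ℝ H]
  {T : H →L[ℝ] H} {φ : H} {μ lo hi : ℝ}

theorem inner_self (h : SpectralGap T φ μ lo hi) : ⟪φ, φ⟫_ℝ = 1 := by
  rw [real_inner_self_eq_norm_sq, h.norm_eq]; norm_num

theorem inner_perp (h : SpectralGap T φ μ lo hi) (f : H) : ⟪φ, perp φ f⟫_ℝ = 0 := by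
  rw [perp, inner_sub_right, inner_smul_right, h.inner_self]; ring

theorem inner_apply (h : SpectralGap T φ μ lo hi) (f : H) : ⟪φ, T f⟫_ℝ = μ * ⟪φ, f⟫_ℝ := by
  rw [← h.pos.inner_left_eq_inner_right, h.apply_eq, real_inner_smul_left]

theorem norm_apply_sq_le (h : SpectralGap T φ μ lo hi) {f : H} (hf : ⟪φ, f⟫_ℝ = 0) :
    ‖T f‖ ^ 2 ≤ hi * ⟪f, T f⟫_ℝ := by
  have hf' : ⟪φ, T f⟫_ℝ = 0 := by rw [h.inner_apply, hf, mul_zero]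
  have h1 := sq_inner_le_of_isPositive h.pos f (T f)
  rw [← h.pos.inner_left_eq_inner_right, real_inner_self_eq_norm_sq] at h1
  have h2 := h.inner_le _ hf'
  have h3 := h.pos.inner_nonneg_right f
  rcases (sq_nonneg ‖T f‖).eq_or_lt with h0 | h0
  · rw [← h0]; exact mul_nonneg h.hi_nonneg h3
  · refine le_of_mul_le_mul_right ?_ h0
    nlinarith [mul_le_mul_of_nonneg_left h2 h3]

theorem norm_apply_sq_le' (h : SpectralGap T φ μ lo hi) {f : H} (hf : ⟪φ, f⟫_ℝ = 0) :
    ‖T f‖ ^ 2 ≤ hi ^ 2 * ‖f‖ ^ 2 := by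
  nlinarith [h.norm_apply_sq_le hf, mul_le_mul_of_nonneg_left (h.inner_le f hf) h.hi_nonneg]

theorem le_norm_apply_sq (h : SpectralGap T φ μ lo hi) {f : H} (hf : ⟪φ, f⟫_ℝ = 0) :
    lo ^ 2 * ‖f‖ ^ 2 ≤ ‖T f‖ ^ 2 := by
  have h1 := (h.le_inner f hf).trans (real_inner_le_norm _ _)
  rcases (norm_nonneg f).eq_or_lt with h0 | h0
  · rw [← h0]; simp
  · have h2 : lo * ‖f‖ ≤ ‖T f‖ := by
      refine le_of_mul_le_mul_right ?_ h0
      nlinarith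
    rw [← mul_pow]
    exact pow_le_pow_left₀ (mul_nonneg h.lo_nonneg h0.le) h2 2

theorem pow [CompleteSpace H] (h : SpectralGap T φ μ lo hi) (n : ℕ) :
    SpectralGap (T ^ n) φ (μ ^ n) (lo ^ n) (hi ^ n) := by
  induction n using Nat.twoStepInduction with
  | zero =>
    exact ⟨by simp, h.norm_eq, by simp, by simp, by simp, by simp,
      fun f _ => by simp, fun f _ => by simp⟩
  | one => simpa using h
  | more n ih _ =>
    have e : ∀ f, (T ^ (n + 2)) f = T ((T ^ n) (T f)) := fun f => by
      rw [pow_succ, pow_succ']; rfl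
    have e2 : ∀ f, ⟪f, (T ^ (n + 2)) f⟫_ℝ = ⟪T f, (T ^ n) (T f)⟫_ℝ := fun f => by
      rw [e, h.pos.inner_left_eq_inner_right]
    have perp' : ∀ f, ⟪φ, f⟫_ℝ = 0 → ⟪φ, T f⟫_ℝ = 0 := fun f hf => by
      rw [h.inner_apply, hf, mul_zero]
    refine ⟨isPositive_pow h.pos _, h.norm_eq, ?_, pow_nonneg h.eigenvalue_nonneg _,
      pow_nonneg h.lo_nonneg _, pow_nonneg h.hi_nonneg _, fun f hf => ?_, fun f hf => ?_⟩
    · rw [e, h.apply_eq, map_smul, ih.apply_eq, smul_smul, map_smul, h.apply_eq, smul_smul]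
      ring_nf
    · rw [e2]
      refine le_trans ?_ (ih.le_inner _ (perp' f hf))
      rw [pow_add, mul_assoc]
      exact mul_le_mul_of_nonneg_left (h.le_norm_apply_sq hf) ih.lo_nonneg
    · rw [e2]
      refine (ih.inner_le _ (perp' f hf)).trans ?_
      rw [pow_add, mul_assoc]
      exact mul_le_mul_of_nonneg_left (h.norm_apply_sq_le' hf) ih.hi_nonneg

theorem apply_eq_add (h : SpectralGap T φ μ lo hi) (f : H) :
    T f = (⟪φ, f⟫_ℝ * μ) • φ + T (perp φ f) := by
  rw [perp, map_sub, map_smul, h.apply_eq, smul_smul]; abel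

theorem inner_apply_self (h : SpectralGap T φ μ lo hi) (f : H) :
    ⟪f, T f⟫_ℝ = μ * ⟪φ, f⟫_ℝ ^ 2 + ⟪perp φ f, T (perp φ f)⟫_ℝ := by
  have e : f = ⟪φ, f⟫_ℝ • φ + perp φ f := by rw [perp]; abel
  have h1 : ⟪perp φ f, φ⟫_ℝ = 0 := by rw [real_inner_comm, h.inner_perp]
  have h2 : ⟪φ, T (perp φ f)⟫_ℝ = 0 := by rw [h.inner_apply, h.inner_perp, mul_zero]
  rw [h.apply_eq_add f]
  nth_rw 1 [e]
  simp only [inner_add_left, inner_add_right, real_inner_smul_left, real_inner_smul_right,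
    h1, h2, h.inner_self]
  ring

theorem norm_perp_le (h : SpectralGap T φ μ lo hi) (f : H) : ‖perp φ f‖ ^ 2 ≤ ‖f‖ ^ 2 := by
  have h1 : ⟪f, φ⟫_ℝ = ⟪φ, f⟫_ℝ := real_inner_comm _ _
  rw [← real_inner_self_eq_norm_sq, ← real_inner_self_eq_norm_sq, perp]
  simp only [inner_sub_left, inner_sub_right, real_inner_smul_left, real_inner_smul_right,
    h1, h.inner_self]
  nlinarith [sq_nonneg ⟪φ, f⟫_ℝ]

/-- The orthogonal component is the shortest of the vectors `f - t φ`. -/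
theorem norm_perp_le_norm_sub (h : SpectralGap T φ μ lo hi) (f : H) (t : ℝ) :
    ‖perp φ f‖ ^ 2 ≤ ‖f - t • φ‖ ^ 2 := by
  have : perp φ (f - t • φ) = perp φ f := by
    simp only [perp, inner_sub_right, real_inner_smul_right, h.inner_self, sub_smul, mul_one]
    abel
  rw [← this]
  exact h.norm_perp_le _

end SpectralGap

theorem two_mul_mul_le_of_sq_le {α y b B t : ℝ} (hB : 0 ≤ B) (ht : 0 ≤ t) (h : b ^ 2 ≤ B * t) :
    2 * (α * y * b) ≤ α ^ 2 * B + y ^ 2 * t := by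
  refine le_of_abs_le (abs_le_of_sq_le_sq ?_ (by positivity))
  nlinarith [mul_le_mul_of_nonneg_left h (sq_nonneg (α * y)), sq_nonneg (α ^ 2 * B - y ^ 2 * t)]

/-- The upper bound for the product of two gapped operators coupled by `Y`, in the form of
`K = Y N Y†`: the largest eigenvalue of `K M` is at most the squared Frobenius norm of a `2 × 2`
block matrix, the blocks belonging to `φ` and to its complement. -/
theorem SpectralGap.inner_coupled_le {H : Type*} [NormedAddCommGroup H] [InnerProductSpace ℝ H]
    [CompleteSpace H] {M N Y : H →L[ℝ] H} {φ : H} {μ η l₁ l₂ q₁ q₂ C : ℝ}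
    (hM : SpectralGap M φ μ l₁ q₁) (hN : SpectralGap N φ η l₂ q₂)
    (hY : ∀ f, ‖Y f‖ ^ 2 ≤ C * ‖f‖ ^ 2) (hC : 0 ≤ C) (f : H) :
    ⟪f, (Y * N * adjoint Y) (M ((Y * N * adjoint Y) f))⟫_ℝ ≤
      (μ * η * ⟪φ, Y φ⟫_ℝ ^ 2 + μ * q₂ * ‖perp φ (adjoint Y φ)‖ ^ 2 +
        η * q₁ * ‖perp φ (Y φ)‖ ^ 2 + C * q₁ * q₂) * ⟪f, (Y * N * adjoint Y) f⟫_ℝ := by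
  have hK : (Y * N * adjoint Y).IsPositive := hN.pos.conj_adjoint Y
  rw [← hK.inner_left_eq_inner_right]
  set g := adjoint Y f with hg
  set α := ⟪φ, g⟫_ℝ with hα
  set ζ := N (perp φ g) with hζ
  set t := ⟪perp φ g, ζ⟫_ℝ with ht
  have hKf : (Y * N * adjoint Y) f = Y (N g) := rfl
  have e1 : ⟪f, (Y * N * adjoint Y) f⟫_ℝ = η * α ^ 2 + t := by
    rw [hKf, ← adjoint_inner_left, ← hg, hN.inner_apply_self]
  have t0 : 0 ≤ t := hN.pos.inner_nonneg_right _
  have hζt : ‖ζ‖ ^ 2 ≤ q₂ * t := hN.norm_apply_sq_le (hN.inner_perp g)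
  have e2 : Y (N g) = (α * η) • Y φ + Y ζ := by
    rw [hN.apply_eq_add g, map_add, map_smul]
  have hφζ : ⟪φ, ζ⟫_ℝ = 0 := by rw [hζ, hN.inner_apply, hN.inner_perp, mul_zero]
  set y := ⟪φ, Y φ⟫_ℝ with hy
  set v := ⟪φ, Y ζ⟫_ℝ with hv
  set g2 := ‖perp φ (adjoint Y φ)‖ ^ 2 with hg2
  set f2 := ‖perp φ (Y φ)‖ ^ 2 with hf2
  have v2 : v ^ 2 ≤ (g2 * q₂) * t := by
    have : v = ⟪perp φ (adjoint Y φ), ζ⟫_ℝ := by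
      rw [perp, inner_sub_left, real_inner_smul_left, hφζ, mul_zero, sub_zero, adjoint_inner_left]
    rw [this]
    have := abs_real_inner_le_norm (perp φ (adjoint Y φ)) ζ
    rw [← sq_abs]
    calc _ ≤ (‖perp φ (adjoint Y φ)‖ * ‖ζ‖) ^ 2 := by gcongr
      _ = g2 * ‖ζ‖ ^ 2 := by rw [mul_pow]
      _ ≤ g2 * (q₂ * t) := by gcongr
      _ = _ := by ring
  set w := ⟪perp φ (Y φ), perp φ (Y ζ)⟫_ℝ with hw
  have hr : ‖perp φ (Y ζ)‖ ^ 2 ≤ C * q₂ * t := by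
    calc _ ≤ ‖Y ζ‖ ^ 2 := hM.norm_perp_le _
      _ ≤ C * ‖ζ‖ ^ 2 := hY _
      _ ≤ C * (q₂ * t) := by gcongr
      _ = _ := by ring
  have w2 : w ^ 2 ≤ (C * q₂) * (f2 * t) := by
    have := abs_real_inner_le_norm (perp φ (Y φ)) (perp φ (Y ζ))
    rw [← sq_abs]
    calc _ ≤ (‖perp φ (Y φ)‖ * ‖perp φ (Y ζ)‖) ^ 2 := by gcongr
      _ = f2 * ‖perp φ (Y ζ)‖ ^ 2 := by rw [mul_pow]
      _ ≤ f2 * (C * q₂ * t) := by gcongr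
      _ = _ := by ring
  have e3 : ⟪φ, Y (N g)⟫_ℝ = α * η * y + v := by
    rw [e2, inner_add_right, real_inner_smul_right]
  have e4 : ‖perp φ (Y (N g))‖ ^ 2 = α ^ 2 * η ^ 2 * f2 + 2 * (α * η * w) + ‖perp φ (Y ζ)‖ ^ 2 := by
    have : perp φ (Y (N g)) = (α * η) • perp φ (Y φ) + perp φ (Y ζ) := by
      rw [e2]
      simp only [perp, inner_add_right, real_inner_smul_right, smul_sub, add_smul, smul_smul]
      abel
    rw [this, norm_add_sq_real, norm_smul, real_inner_smul_left, mul_pow, Real.norm_eq_abs, sq_abs]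
    ring
  have hq₁ := hM.hi_nonneg
  have hq₂ := hN.hi_nonneg
  have hμ := hM.eigenvalue_nonneg
  have hη := hN.eigenvalue_nonneg
  have b1 := two_mul_mul_le_of_sq_le (α := α) (y := y) (by positivity) t0 v2
  have b2 := two_mul_mul_le_of_sq_le (α := α) (y := 1) (by positivity) (by positivity) w2
  rw [e1, hKf, hM.inner_apply_self]
  have h5 := hM.inner_le _ (hM.inner_perp (Y (N g)))
  rw [e3]
  rw [e4] at h5
  have s1 : (α * η * y + v) ^ 2 ≤ (η * α ^ 2 + t) * (η * y ^ 2 + g2 * q₂) := by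
    nlinarith [mul_le_mul_of_nonneg_left b1 hη]
  have s2 : α ^ 2 * η ^ 2 * f2 + 2 * (α * η * w) + ‖perp φ (Y ζ)‖ ^ 2 ≤
      (η * α ^ 2 + t) * (η * f2 + C * q₂) := by
    nlinarith [mul_le_mul_of_nonneg_left b2 hη]
  calc _ ≤ μ * ((η * α ^ 2 + t) * (η * y ^ 2 + g2 * q₂)) +
        q₁ * ((η * α ^ 2 + t) * (η * f2 + C * q₂)) :=
      add_le_add (mul_le_mul_of_nonneg_left s1 hμ)
        (h5.trans (mul_le_mul_of_nonneg_left s2 hq₁))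
    _ = _ := by ring

/-- The lower bound for the product of two gapped operators coupled by `Y`: the Rayleigh quotient of
the common eigenvector. -/
theorem SpectralGap.le_moment_one {H : Type*} [NormedAddCommGroup H] [InnerProductSpace ℝ H]
    [CompleteSpace H] {M N Y : H →L[ℝ] H} {φ : H} {μ η l₁ l₂ q₁ q₂ : ℝ}
    (hM : SpectralGap M φ μ l₁ q₁) (hN : SpectralGap N φ η l₂ q₂) :
    (μ * η * ⟪φ, Y φ⟫_ℝ ^ 2 + μ * l₂ * ‖perp φ (adjoint Y φ)‖ ^ 2) *
      moment (Y * N * adjoint Y) M φ 0 ≤ moment (Y * N * adjoint Y) M φ 1 := by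
  have e0 : moment (Y * N * adjoint Y) M φ 0 = μ := by
    simp [moment, hM.apply_eq, real_inner_smul_right, hM.norm_eq]
  have e1 : moment (Y * N * adjoint Y) M φ 1 = μ ^ 2 * ⟪adjoint Y φ, N (adjoint Y φ)⟫_ℝ := by
    rw [moment, pow_one]
    change ⟪φ, M ((Y * N * adjoint Y) (M φ))⟫_ℝ = _
    rw [hM.inner_apply, hM.apply_eq, map_smul, real_inner_smul_right]
    change μ * (μ * ⟪φ, Y (N (adjoint Y φ))⟫_ℝ) = _
    rw [← adjoint_inner_left]
    ring
  rw [e0, e1, hN.inner_apply_self]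
  have h1 := hN.le_inner _ (hN.inner_perp (adjoint Y φ))
  have h2 : ⟪φ, adjoint Y φ⟫_ℝ = ⟪φ, Y φ⟫_ℝ := by
    rw [adjoint_inner_right, real_inner_comm]
  rw [h2]
  nlinarith [mul_le_mul_of_nonneg_left h1 (sq_nonneg μ)]

/-! ### Square-summable sequences and the shift -/

/-- The Hilbert space `ℓ²(ℕ)` of square-summable functions of the height above the wall. -/
abbrev SeqSpace : Type := lp (fun _ : ℕ => ℝ) 2

/-- The standard basis of `SeqSpace`. -/
noncomputable def basisVec (n : ℕ) : SeqSpace := lp.single 2 n 1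

@[simp]
theorem inner_basisVec (n : ℕ) (f : SeqSpace) : ⟪basisVec n, f⟫_ℝ = f n := by
  rw [basisVec, lp.inner_single_left]; simp

@[simp]
theorem inner_basisVec_right (n : ℕ) (f : SeqSpace) : ⟪f, basisVec n⟫_ℝ = f n := by
  rw [real_inner_comm, inner_basisVec]

theorem basisVec_apply (n m : ℕ) : basisVec n m = if m = n then 1 else 0 := by
  rw [basisVec, lp.single_apply, Pi.single_apply]

theorem orthonormal_basisVec : Orthonormal ℝ basisVec := by
  rw [orthonormal_iff_ite]
  intro i j
  rw [inner_basisVec, basisVec_apply]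

theorem adjoint_apply_coord (B : SeqSpace →L[ℝ] SeqSpace) (f : SeqSpace) (n : ℕ) :
    (adjoint B f) n = ⟪B (basisVec n), f⟫_ℝ := by
  rw [← inner_basisVec, adjoint_inner_right]

theorem hasSum_inner_coord (f g : SeqSpace) : HasSum (fun n => f n * g n) ⟪f, g⟫_ℝ := by
  simpa [mul_comm] using lp.hasSum_inner (𝕜 := ℝ) f g

/-- The right shift of `ℓ²(ℕ)`. -/
noncomputable def shift : SeqSpace →L[ℝ] SeqSpace :=
  ((orthonormal_basisVec.comp (fun n : ℕ => n + 1)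
    (add_left_injective 1)).orthogonalFamily.linearIsometry).toContinuousLinearMap

theorem shift_basisVec (n : ℕ) : shift (basisVec n) = basisVec (n + 1) := by
  simp [shift, basisVec]

theorem inner_shift_shift (f g : SeqSpace) : ⟪shift f, shift g⟫_ℝ = ⟪f, g⟫_ℝ :=
  LinearIsometry.inner_map_map _ f g

theorem norm_shift (f : SeqSpace) : ‖shift f‖ = ‖f‖ :=
  LinearIsometry.norm_map _ f

theorem adjoint_shift_apply (f : SeqSpace) (n : ℕ) : (adjoint shift f) n = f (n + 1) := by
  rw [adjoint_apply_coord, shift_basisVec, inner_basisVec]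

theorem adjoint_shift_shift (f : SeqSpace) : adjoint shift (shift f) = f := by
  refine ext_inner_left ℝ fun g => ?_
  rw [adjoint_inner_right, inner_shift_shift]

theorem shift_apply_succ (f : SeqSpace) (n : ℕ) : (shift f) (n + 1) = f n := by
  rw [← adjoint_shift_apply, adjoint_shift_shift]

theorem adjoint_shift_basisVec_zero : adjoint shift (basisVec 0) = 0 := by
  ext n
  rw [adjoint_shift_apply, basisVec_apply]
  simp

theorem shift_apply_zero (f : SeqSpace) : (shift f) 0 = 0 := by
  rw [← inner_basisVec, ← adjoint_inner_left, adjoint_shift_basisVec_zero, inner_zero_left]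

theorem shift_pow_apply (j : ℕ) (f : SeqSpace) (n : ℕ) :
    ((shift ^ j) f) n = if j ≤ n then f (n - j) else 0 := by
  induction j generalizing n with
  | zero => simp
  | succ j ih =>
    rw [pow_succ']
    change (shift ((shift ^ j) f)) n = _
    cases n with
    | zero => rw [shift_apply_zero]; simp
    | succ n => rw [shift_apply_succ, ih]; simp

theorem norm_shift_pow (j : ℕ) (f : SeqSpace) : ‖(shift ^ j) f‖ = ‖f‖ := by
  induction j with
  | zero => simp
  | succ j ih => rw [pow_succ']; change ‖shift ((shift ^ j) f)‖ = _; rw [norm_shift, ih]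

theorem eq_basisVec_add_shift (f : SeqSpace) :
    f = f 0 • basisVec 0 + shift (adjoint shift f) := by
  ext n
  rw [lp.coeFn_add, lp.coeFn_smul, Pi.add_apply, Pi.smul_apply, basisVec_apply]
  cases n with
  | zero => rw [shift_apply_zero]; simp
  | succ n => rw [shift_apply_succ, adjoint_shift_apply]; simp

theorem norm_sq_eq_add (f : SeqSpace) : ‖f‖ ^ 2 = f 0 ^ 2 + ‖adjoint shift f‖ ^ 2 := by
  conv_lhs => rw [eq_basisVec_add_shift f]
  rw [norm_add_sq_real, norm_smul, orthonormal_basisVec.1, real_inner_smul_left, inner_basisVec,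
    shift_apply_zero, norm_shift]
  simp

/-! ### The resolvent of the shift and the exponential kernel -/

/-- The inverse of `1 - t S`, where `S` is the shift. -/
noncomputable def resolvent (t : ℝ) : SeqSpace →L[ℝ] SeqSpace := Ring.inverse (1 - t • shift)

theorem norm_smul_shift_le {t : ℝ} (h0 : 0 ≤ t) (f : SeqSpace) : ‖t • shift f‖ = t * ‖f‖ := by
  rw [norm_smul, norm_shift, Real.norm_of_nonneg h0]

theorem isUnit_one_sub_smul_shift {t : ℝ} (h0 : 0 ≤ t) (h1 : t < 1) :
    IsUnit (1 - t • shift : SeqSpace →L[ℝ] SeqSpace) := by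
  have : ‖t • shift‖ < 1 := by
    refine lt_of_le_of_lt (opNorm_le_bound _ h0 fun f => ?_) h1
    rw [smul_apply, norm_smul_shift_le h0]
  exact (Units.oneSub _ this).isUnit

theorem one_sub_shift_resolvent {t : ℝ} (h0 : 0 ≤ t) (h1 : t < 1) (f : SeqSpace) :
    resolvent t f - t • shift (resolvent t f) = f := by
  have := Ring.mul_inverse_cancel _ (isUnit_one_sub_smul_shift h0 h1)
  exact DFunLike.congr_fun this f

theorem resolvent_one_sub_shift {t : ℝ} (h0 : 0 ≤ t) (h1 : t < 1) (f : SeqSpace) :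
    resolvent t (f - t • shift f) = f := by
  have := Ring.inverse_mul_cancel _ (isUnit_one_sub_smul_shift h0 h1)
  exact DFunLike.congr_fun this f

theorem resolvent_shift {t : ℝ} (h0 : 0 ≤ t) (h1 : t < 1) (f : SeqSpace) :
    resolvent t (shift f) = shift (resolvent t f) := by
  conv_lhs => rw [← one_sub_shift_resolvent h0 h1 f]
  rw [map_sub, map_smul, resolvent_one_sub_shift h0 h1]

theorem norm_resolvent_le {t : ℝ} (h0 : 0 ≤ t) (h1 : t < 1) (f : SeqSpace) :
    (1 - t) * ‖resolvent t f‖ ≤ ‖f‖ := by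
  have h := norm_sub_norm_le (resolvent t f) (t • shift (resolvent t f))
  rw [one_sub_shift_resolvent h0 h1, norm_smul_shift_le h0] at h
  linarith

theorem le_norm_resolvent {t : ℝ} (h0 : 0 ≤ t) (h1 : t < 1) (f : SeqSpace) :
    ‖f‖ ≤ (1 + t) * ‖resolvent t f‖ := by
  have h := norm_sub_le (resolvent t f) (t • shift (resolvent t f))
  rw [one_sub_shift_resolvent h0 h1, norm_smul_shift_le h0] at h
  linarith

/-- The geometric sequence `n ↦ t ^ n`. -/
noncomputable def geometric (t : ℝ) : SeqSpace := resolvent t (basisVec 0)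

theorem geometric_sub {t : ℝ} (h0 : 0 ≤ t) (h1 : t < 1) :
    geometric t - t • shift (geometric t) = basisVec 0 :=
  one_sub_shift_resolvent h0 h1 _

theorem adjoint_shift_geometric {t : ℝ} (h0 : 0 ≤ t) (h1 : t < 1) :
    adjoint shift (geometric t) = t • geometric t := by
  have := congrArg (adjoint shift) (geometric_sub h0 h1)
  rw [map_sub, map_smul, adjoint_shift_shift, adjoint_shift_basisVec_zero, sub_eq_zero] at this
  exact this

theorem geometric_apply {t : ℝ} (h0 : 0 ≤ t) (h1 : t < 1) (n : ℕ) : (geometric t) n = t ^ n := by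
  induction n with
  | zero =>
    have := congrArg (inner ℝ (basisVec 0)) (geometric_sub h0 h1)
    rw [inner_sub_right, real_inner_smul_right, inner_basisVec, inner_basisVec, inner_basisVec,
      shift_apply_zero, basisVec_apply] at this
    simpa using this
  | succ n ih =>
    rw [← adjoint_shift_apply, adjoint_shift_geometric h0 h1, lp.coeFn_smul, Pi.smul_apply, ih,
      smul_eq_mul, pow_succ']

theorem norm_geometric_sq {t : ℝ} (h0 : 0 ≤ t) (h1 : t < 1) :
    (1 - t ^ 2) * ‖geometric t‖ ^ 2 = 1 := by
  have := norm_sq_eq_add (geometric t)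
  rw [adjoint_shift_geometric h0 h1, norm_smul, geometric_apply h0 h1, mul_pow, Real.norm_eq_abs,
    sq_abs] at this
  linear_combination this

/-- The operator on `ℓ²(ℕ)` with the kernel `s ^ |x - y|`. -/
noncomputable def expKernel (s : ℝ) : SeqSpace →L[ℝ] SeqSpace :=
  (1 - s ^ 2) • (adjoint (resolvent s) * resolvent s)

theorem inner_expKernel (s : ℝ) (f g : SeqSpace) :
    ⟪f, expKernel s g⟫_ℝ = (1 - s ^ 2) * ⟪resolvent s f, resolvent s g⟫_ℝ := by
  rw [expKernel, smul_apply, real_inner_smul_right]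
  change _ * ⟪f, adjoint (resolvent s) (resolvent s g)⟫_ℝ = _
  rw [adjoint_inner_right]

theorem expKernel_isPositive {s : ℝ} (h0 : 0 ≤ s) (h1 : s < 1) : (expKernel s).IsPositive := by
  have h : (adjoint (resolvent s) * resolvent s).IsPositive := by
    exact (isPositive_one (𝕜 := ℝ) (E := SeqSpace)).adjoint_conj (resolvent s)
  exact h.smul_of_nonneg (by nlinarith)

theorem resolvent_basisVec {s : ℝ} (h0 : 0 ≤ s) (h1 : s < 1) (n : ℕ) :
    resolvent s (basisVec n) = (shift ^ n) (geometric s) := by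
  induction n with
  | zero => rfl
  | succ n ih => rw [← shift_basisVec, resolvent_shift h0 h1, ih, pow_succ']; rfl

theorem inner_shift_pow_geometric {s : ℝ} (h0 : 0 ≤ s) (h1 : s < 1) (n k : ℕ) :
    ⟪(shift ^ (n + k)) (geometric s), (shift ^ n) (geometric s)⟫_ℝ
      = s ^ k * ‖geometric s‖ ^ 2 := by
  induction n with
  | zero =>
    rw [zero_add, pow_zero]
    change ⟪_, geometric s⟫_ℝ = _
    induction k with
    | zero => simp
    | succ k ih =>
      rw [pow_succ']
      change ⟪shift ((shift ^ k) (geometric s)), geometric s⟫_ℝ = _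
      rw [← adjoint_inner_right, adjoint_shift_geometric h0 h1, real_inner_smul_right, ih]
      ring
  | succ n ih =>
    rw [show n + 1 + k = (n + k) + 1 by ring, pow_succ', pow_succ']
    change ⟪shift ((shift ^ (n + k)) (geometric s)), shift ((shift ^ n) (geometric s))⟫_ℝ = _
    rw [inner_shift_shift, ih]

theorem expKernel_apply_basisVec {s : ℝ} (h0 : 0 ≤ s) (h1 : s < 1) (x y : ℕ) :
    (expKernel s (basisVec y)) x = s ^ ((x : ℤ) - y).natAbs := by
  rw [← inner_basisVec, inner_expKernel, resolvent_basisVec h0 h1, resolvent_basisVec h0 h1]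
  rcases le_total y x with h | h
  · obtain ⟨k, rfl⟩ := Nat.exists_eq_add_of_le h
    rw [inner_shift_pow_geometric h0 h1]
    have : (((y + k : ℕ) : ℤ) - y).natAbs = k := by omega
    rw [this]
    linear_combination s ^ k * norm_geometric_sq h0 h1
  · obtain ⟨k, rfl⟩ := Nat.exists_eq_add_of_le h
    rw [real_inner_comm, inner_shift_pow_geometric h0 h1]
    have : ((x : ℤ) - (x + k : ℕ)).natAbs = k := by omega
    rw [this]
    linear_combination s ^ k * norm_geometric_sq h0 h1

/-! ### The transfer operator of a flat wall -/

/-- Multiplication by `1` at height `0` and by `p` at all other heights. -/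
noncomputable def pinning (p : ℝ) : SeqSpace →L[ℝ] SeqSpace :=
  p • 1 + (1 - p) • rankOne ℝ (basisVec 0) (basisVec 0)

theorem pinning_eq (p : ℝ) (f : SeqSpace) :
    pinning p f = p • f + ((1 - p) * f 0) • basisVec 0 := by
  simp [pinning, smul_smul]

theorem pinning_apply (p : ℝ) (f : SeqSpace) (n : ℕ) :
    (pinning p f) n = (if n = 0 then 1 else p) * f n := by
  rw [pinning_eq, lp.coeFn_add, lp.coeFn_smul, lp.coeFn_smul, Pi.add_apply, Pi.smul_apply,
    Pi.smul_apply, basisVec_apply]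
  split_ifs with h
  · subst h; simp; ring
  · simp

theorem pinning_basisVec (p : ℝ) (n : ℕ) :
    pinning p (basisVec n) = (if n = 0 then 1 else p) • basisVec n := by
  ext m
  rw [pinning_apply, lp.coeFn_smul, Pi.smul_apply, basisVec_apply, smul_eq_mul]
  by_cases h : m = n
  · simp [h]
  · simp [h]

theorem inner_pinning_left (p : ℝ) (f g : SeqSpace) :
    ⟪pinning p f, g⟫_ℝ = ⟪f, pinning p g⟫_ℝ := by
  rw [pinning_eq, pinning_eq]
  simp only [inner_add_left, inner_add_right, real_inner_smul_left, real_inner_smul_right,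
    inner_basisVec, inner_basisVec_right]
  ring

theorem adjoint_pinning (p : ℝ) : adjoint (pinning p) = pinning p :=
  ((eq_adjoint_iff _ _).2 (inner_pinning_left p)).symm

theorem norm_pinning_sq (p : ℝ) (f : SeqSpace) :
    ‖pinning p f‖ ^ 2 = p ^ 2 * ‖f‖ ^ 2 + (1 - p ^ 2) * f 0 ^ 2 := by
  rw [← real_inner_self_eq_norm_sq, ← real_inner_self_eq_norm_sq, pinning_eq]
  simp only [inner_add_left, inner_add_right, real_inner_smul_left, real_inner_smul_right,
    inner_basisVec, inner_basisVec_right, basisVec_apply]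
  simp
  ring

/-- The transfer operator of a flat wall, in symmetric form. -/
noncomputable def flatTransfer (p s : ℝ) : SeqSpace →L[ℝ] SeqSpace :=
  pinning p * expKernel s * pinning p

theorem flatTransfer_eq (p s : ℝ) (f : SeqSpace) :
    flatTransfer p s f = pinning p (expKernel s (pinning p f)) := rfl

theorem flatTransfer_isPositive {p s : ℝ} (h0 : 0 ≤ s) (h1 : s < 1) :
    (flatTransfer p s).IsPositive := by
  have := (expKernel_isPositive h0 h1).adjoint_conj (pinning p)
  rwa [adjoint_pinning] at this

theorem flatTransfer_apply_basisVec {p s : ℝ} (h0 : 0 ≤ s) (h1 : s < 1) (x y : ℕ) :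
    (flatTransfer p s (basisVec y)) x =
      (if x = 0 then 1 else p) * s ^ ((x : ℤ) - y).natAbs * (if y = 0 then 1 else p) := by
  rw [flatTransfer_eq, pinning_basisVec, map_smul, map_smul, lp.coeFn_smul, Pi.smul_apply,
    pinning_apply, expKernel_apply_basisVec h0 h1]
  simp only [smul_eq_mul]
  ring

theorem inner_flatTransfer (p s : ℝ) (f : SeqSpace) :
    ⟪f, flatTransfer p s f⟫_ℝ = (1 - s ^ 2) * ‖resolvent s (pinning p f)‖ ^ 2 := by
  rw [flatTransfer_eq, ← inner_pinning_left, inner_expKernel, real_inner_self_eq_norm_sq]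

/-- On the vectors vanishing at height `0` the form is bounded by `p ^ 2` times the norm of the
exponential kernel. -/
theorem inner_flatTransfer_le {p s : ℝ} (h0 : 0 ≤ s) (h1 : s < 1) {f : SeqSpace} (hf : f 0 = 0) :
    ⟪f, flatTransfer p s f⟫_ℝ ≤ p ^ 2 * ((1 + s) / (1 - s)) * ‖f‖ ^ 2 := by
  have h2 := norm_resolvent_le h0 h1 (pinning p f)
  have h3 := norm_pinning_sq p f
  rw [hf] at h3
  have h4 : ((1 - s) * ‖resolvent s (pinning p f)‖) ^ 2 ≤ ‖pinning p f‖ ^ 2 :=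
    pow_le_pow_left₀ (mul_nonneg (by linarith) (norm_nonneg _)) h2 2
  rw [inner_flatTransfer]
  have h5 : 0 < 1 - s := by linarith
  rw [mul_div_assoc', div_mul_eq_mul_div, le_div_iff₀ h5]
  nlinarith [mul_le_mul_of_nonneg_left h4 (by linarith : (0 : ℝ) ≤ 1 + s)]

theorem le_inner_flatTransfer {p s : ℝ} (hp0 : 0 ≤ p) (hp1 : p ≤ 1) (h0 : 0 ≤ s) (h1 : s < 1)
    (f : SeqSpace) :
    p ^ 2 * ((1 - s) / (1 + s)) * ‖f‖ ^ 2 ≤ ⟪f, flatTransfer p s f⟫_ℝ := by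
  have h2 := le_norm_resolvent h0 h1 (pinning p f)
  have h3 := norm_pinning_sq p f
  have h4 : ‖pinning p f‖ ^ 2 ≤ ((1 + s) * ‖resolvent s (pinning p f)‖) ^ 2 :=
    pow_le_pow_left₀ (norm_nonneg _) h2 2
  rw [inner_flatTransfer]
  have h5 : 0 < 1 + s := by linarith
  rw [mul_div_assoc', div_mul_eq_mul_div, div_le_iff₀ h5]
  have h6 : p ^ 2 * ‖f‖ ^ 2 ≤ ‖pinning p f‖ ^ 2 := by
    rw [h3]
    have : 0 ≤ (1 - p ^ 2) * f 0 ^ 2 := mul_nonneg (by nlinarith) (sq_nonneg _)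
    linarith
  nlinarith [mul_le_mul_of_nonneg_left (h6.trans h4) (by linarith : (0 : ℝ) ≤ 1 - s)]

/-- The bound state of the flat wall, up to normalisation: `1` at height `0` and `p z ^ n` at the
heights `n ≥ 1`. -/
noncomputable def boundState (p z : ℝ) : SeqSpace := pinning p (geometric z)

theorem boundState_apply {p z : ℝ} (h0 : 0 ≤ z) (h1 : z < 1) (n : ℕ) :
    (boundState p z) n = (if n = 0 then 1 else p) * z ^ n := by
  rw [boundState, pinning_apply, geometric_apply h0 h1]

theorem norm_boundState_sq {p z : ℝ} (h0 : 0 ≤ z) (h1 : z < 1) :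
    ‖boundState p z‖ ^ 2 = 1 + p ^ 2 * (z ^ 2 / (1 - z ^ 2)) := by
  have h2 := norm_geometric_sq h0 h1
  have h3 : 1 - z ^ 2 ≠ 0 := by nlinarith
  rw [boundState, norm_pinning_sq, geometric_apply h0 h1]
  have : ‖geometric z‖ ^ 2 = 1 / (1 - z ^ 2) := by field_simp; linarith
  rw [this]; field_simp; ring

/-- The bound state is an eigenvector: with `S` the shift and `g` the geometric sequence of ratio
`z`, one has `D² g = (1 - s S) g` and `S† g = z g`, where `D` is the pinning operator. -/
theorem flatTransfer_boundState {p s z : ℝ} (h0 : 0 ≤ s) (h1 : s < 1) (hz0 : 0 ≤ z) (hz1 : z < 1)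
    (hz : z * (1 - p ^ 2) = s) :
    flatTransfer p s (boundState p z) = ((1 - s ^ 2) / (1 - s * z)) • boundState p z := by
  have hsz : 1 - s * z ≠ 0 := by nlinarith
  have e1 : pinning p (boundState p z) = geometric z - s • shift (geometric z) := by
    have hg := geometric_sub hz0 hz1
    have : pinning p (boundState p z) = p ^ 2 • geometric z + (1 - p ^ 2) • basisVec 0 := by
      rw [boundState, pinning_eq p (pinning p _), pinning_apply, pinning_eq, geometric_apply hz0 hz1, if_pos rfl]
      module
    rw [this, ← hg, ← hz]
    module
  have e2 : adjoint (resolvent s) (geometric z) = (1 / (1 - s * z)) • geometric z := by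
    refine ext_inner_left ℝ fun f => ?_
    rw [adjoint_inner_right, real_inner_smul_right]
    have h := one_sub_shift_resolvent h0 h1 f
    have h2 : ⟪resolvent s f, geometric z⟫_ℝ - s * (z * ⟪resolvent s f, geometric z⟫_ℝ)
        = ⟪f, geometric z⟫_ℝ := by
      conv_rhs => rw [← h]
      rw [inner_sub_left, real_inner_smul_left, ← adjoint_inner_right shift,
        adjoint_shift_geometric hz0 hz1, real_inner_smul_right]
    rw [← h2]; field_simp
  rw [flatTransfer_eq, e1]
  have e3 : expKernel s (geometric z - s • shift (geometric z)) =
      (1 - s ^ 2) • adjoint (resolvent s) (geometric z) := by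
    rw [expKernel, smul_apply]
    change _ • adjoint (resolvent s) (resolvent s _) = _
    rw [resolvent_one_sub_shift h0 h1]
  rw [e3, e2, smul_smul, map_smul, boundState]
  congr 1
  ring

/-- The normalised bound state. -/
noncomputable def groundState (p z : ℝ) : SeqSpace := ‖boundState p z‖⁻¹ • boundState p z

/-- The spectral gap of the flat transfer operator: a two-dimensional space spanned by `φ` and a
vector orthogonal to it meets the hyperplane of the vectors vanishing at height `0`, on which the
quadratic form is small. -/
theorem flatTransfer_spectralGap {p s z : ℝ} (hp0 : 0 ≤ p) (hp1 : p ≤ 1) (h0 : 0 ≤ s) (h1 : s < 1)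
    (hz0 : 0 ≤ z) (hz1 : z < 1) (hz : z * (1 - p ^ 2) = s)
    (hgap : p ^ 2 * ((1 + s) / (1 - s)) ≤ 1) :
    SpectralGap (flatTransfer p s) (groundState p z) ((1 - s ^ 2) / (1 - s * z))
      (p ^ 2 * ((1 - s) / (1 + s))) (p ^ 2 * ((1 + s) / (1 - s))) := by
  have hν : 0 < ‖boundState p z‖ := by
    have := norm_boundState_sq (p := p) hz0 hz1
    have h : 0 < ‖boundState p z‖ ^ 2 := by
      rw [this]
      have : 0 < 1 - z ^ 2 := by nlinarith
      positivity
    exact (sq_pos_iff.1 h).lt_of_le' (norm_nonneg _)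
  have hs1 : 0 < 1 - s := by linarith
  have hsz : 0 < 1 - s * z := by nlinarith
  have hzs : s ≤ z := by nlinarith [mul_nonneg hz0 (sq_nonneg p)]
  have hΛ : 1 ≤ (1 - s ^ 2) / (1 - s * z) := by
    rw [le_div_iff₀ hsz]; nlinarith
  refine ⟨flatTransfer_isPositive h0 h1, ?_, ?_, by linarith, by positivity, by positivity,
    fun f _ => le_inner_flatTransfer hp0 hp1 h0 h1 f, fun f hf => ?_⟩
  · rw [groundState, norm_smul, norm_inv, norm_norm, inv_mul_cancel₀ hν.ne']
  · rw [groundState, map_smul, flatTransfer_boundState h0 h1 hz0 hz1 hz, smul_comm]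
  · have hf' : ⟪boundState p z, f⟫_ℝ = 0 := by
      rw [groundState, real_inner_smul_left] at hf
      exact (mul_eq_zero.1 hf).resolve_left (inv_ne_zero hν.ne')
    have hf'' : ⟪f, boundState p z⟫_ℝ = 0 := by rw [real_inner_comm, hf']
    set ψ := boundState p z with hψ
    have hψ0 : ψ 0 = 1 := by rw [hψ, boundState_apply hz0 hz1]; simp
    have hh0 : (f - f 0 • ψ) 0 = 0 := by
      rw [lp.coeFn_sub, lp.coeFn_smul, Pi.sub_apply, Pi.smul_apply, hψ0]; simp
    have key := inner_flatTransfer_le (p := p) h0 h1 hh0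
    have hA : flatTransfer p s ψ = ((1 - s ^ 2) / (1 - s * z)) • ψ :=
      flatTransfer_boundState h0 h1 hz0 hz1 hz
    have hAf : ⟪ψ, flatTransfer p s f⟫_ℝ = 0 := by
      rw [← (flatTransfer_isPositive h0 h1).inner_left_eq_inner_right, hA, real_inner_smul_left,
        hf', mul_zero]
    -- The bound on `f - f 0 • ψ` contains `f 0 ^ 2 * ‖ψ‖ ^ 2` on both sides, with the coefficient `Λ`
    -- on the left and at most `1 ≤ Λ` on the right.
    rw [map_sub, map_smul, hA, norm_sub_sq_real, norm_smul, mul_pow, Real.norm_eq_abs, sq_abs] at key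
    simp only [inner_sub_left, inner_sub_right, real_inner_smul_left, real_inner_smul_right, hf'',
      hAf, real_inner_self_eq_norm_sq] at key
    have h9 : 0 ≤ f 0 ^ 2 * ‖ψ‖ ^ 2 := by positivity
    nlinarith [mul_le_mul_of_nonneg_right (hgap.trans hΛ) h9]

/-! ### The step of the wall -/

/-- The image of `basisVec 0` under `stepOp`: `1` at height `0` and `p t ^ n` for `1 ≤ n ≤ b`. -/
noncomputable def stepVec (b : ℕ) (p t : ℝ) : SeqSpace :=
  basisVec 0 + ∑ n ∈ Finset.Icc 1 b, (p * t ^ n) • basisVec n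

/-- The operator `Y` that, composed with the flat transfer operator, describes a step of height `b`
of the wall; `t = exp (β J')` is the gain for each vertical wall bond that the interface avoids. -/
noncomputable def stepOp (b : ℕ) (p t : ℝ) : SeqSpace →L[ℝ] SeqSpace :=
  rankOne ℝ (stepVec b p t) (basisVec 0) + t ^ b • (shift ^ (b + 1) * adjoint shift)

theorem stepVec_apply (b : ℕ) (p t : ℝ) (n : ℕ) :
    (stepVec b p t) n = if n = 0 then 1 else if n ≤ b then p * t ^ n else 0 := by
  rw [← inner_basisVec, stepVec, inner_add_right, inner_sum]
  simp only [real_inner_smul_right, inner_basisVec, basisVec_apply]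
  rcases Nat.eq_zero_or_pos n with rfl | h
  · simp
  · simp [h.ne', Nat.one_le_iff_ne_zero]

theorem stepOp_eq (b : ℕ) (p t : ℝ) (f : SeqSpace) :
    stepOp b p t f = f 0 • stepVec b p t + t ^ b • (shift ^ (b + 1)) (adjoint shift f) := by
  simp [stepOp]

theorem stepOp_apply (b : ℕ) (p t : ℝ) (f : SeqSpace) (n : ℕ) :
    (stepOp b p t f) n =
      if n = 0 then f 0 else if n ≤ b then p * t ^ n * f 0 else t ^ b * f (n - b) := by
  rw [stepOp_eq, lp.coeFn_add, lp.coeFn_smul, lp.coeFn_smul, Pi.add_apply, Pi.smul_apply,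
    Pi.smul_apply, stepVec_apply, shift_pow_apply, adjoint_shift_apply]
  rcases Nat.eq_zero_or_pos n with rfl | h
  · simp
  · rcases le_or_gt n b with h1 | h1
    · have : ¬ (b + 1 ≤ n) := by omega
      simp [h.ne', h1, this]; ring
    · have h2 : b + 1 ≤ n := by omega
      have h3 : n - (b + 1) + 1 = n - b := by omega
      simp [h.ne', not_le.2 h1, h2, h3]

theorem norm_stepVec_sq (b : ℕ) (p t : ℝ) :
    ‖stepVec b p t‖ ^ 2 = 1 + p ^ 2 * ∑ n ∈ Finset.Icc 1 b, t ^ (2 * n) := by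
  rw [← real_inner_self_eq_norm_sq]
  nth_rw 2 [stepVec]
  rw [inner_add_right, inner_sum, Finset.mul_sum, inner_basisVec_right, stepVec_apply]
  simp only [real_inner_smul_right, inner_basisVec_right]
  congr 1
  refine Finset.sum_congr rfl fun n hn => ?_
  rw [Finset.mem_Icc] at hn
  rw [stepVec_apply, if_neg (by omega), if_pos hn.2]
  ring

theorem norm_stepOp_sq (b : ℕ) (p t : ℝ) (f : SeqSpace) :
    ‖stepOp b p t f‖ ^ 2 =
      f 0 ^ 2 * ‖stepVec b p t‖ ^ 2 + t ^ (2 * b) * ‖adjoint shift f‖ ^ 2 := by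
  have : ⟪stepVec b p t, (shift ^ (b + 1)) (adjoint shift f)⟫_ℝ = 0 := by
    rw [stepVec, inner_add_left, sum_inner, inner_basisVec, shift_pow_apply]
    simp only [real_inner_smul_left, inner_basisVec, shift_pow_apply]
    rw [Finset.sum_eq_zero fun n hn => ?_]
    · simp
    · rw [Finset.mem_Icc] at hn
      rw [if_neg (by omega), mul_zero]
  rw [stepOp_eq, norm_add_sq_real, real_inner_smul_left, real_inner_smul_right, this, norm_smul,
    norm_smul, mul_pow, mul_pow, Real.norm_eq_abs, Real.norm_eq_abs, sq_abs, sq_abs, norm_shift_pow]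
  ring

theorem norm_stepOp_sq_le {b : ℕ} {p t : ℝ} (h : ‖stepVec b p t‖ ^ 2 ≤ t ^ (2 * b)) (f : SeqSpace) :
    ‖stepOp b p t f‖ ^ 2 ≤ t ^ (2 * b) * ‖f‖ ^ 2 := by
  rw [norm_stepOp_sq, norm_sq_eq_add f]
  nlinarith [mul_le_mul_of_nonneg_left h (sq_nonneg (f 0))]

/-! ### The energy as a sum over columns -/

/-- The bonds of the interface belonging to one column: the horizontal bond over `[i, i + 1]` at
height `x`, and the vertical bonds at site `i + 1` between the heights `x` and `y`. -/
noncomputable def columnBonds (i : ℕ) (x y : ℤ) : Finset Bond :=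
  insert (Bond.horiz i x) ((Finset.Ico (min x y) (max x y)).image (Bond.vert (i + 1)))

/-- The column to which a bond of an interface belongs. -/
def Bond.column : Bond → ℕ
  | Bond.horiz i _ => i
  | Bond.vert i _ => i - 1

theorem column_eq {i : ℕ} {x y : ℤ} {e : Bond} (h : e ∈ columnBonds i x y) : e.column = i := by
  rw [columnBonds, Finset.mem_insert, Finset.mem_image] at h
  rcases h with rfl | ⟨z, _, rfl⟩
  · rfl
  · rfl

theorem mem_interface {N : ℕ} {h : Fin (N + 1) → ℤ} {e : Bond} :
    e ∈ interface h ↔ ∃ i : Fin N, e ∈ columnBonds i (h i.castSucc) (h i.succ) := by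
  simp only [interface, columnBonds, Finset.mem_union, Finset.mem_image, Finset.mem_univ, true_and,
    Finset.mem_biUnion, Finset.mem_insert]
  constructor
  · rintro (⟨i, hi⟩ | ⟨i, hi⟩)
    · exact ⟨i, Or.inl hi.symm⟩
    · exact ⟨i, Or.inr hi⟩
  · rintro ⟨i, hi | hi⟩
    · exact Or.inl ⟨i, hi.symm⟩
    · exact Or.inr ⟨i, hi⟩

theorem card_interface_inter {N : ℕ} (h h' : Fin (N + 1) → ℤ) :
    (interface h ∩ interface h').card = ∑ i : Fin N,
      (columnBonds i (h i.castSucc) (h i.succ) ∩ columnBonds i (h' i.castSucc) (h' i.succ)).card := by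
  rw [← Finset.card_biUnion]
  · congr 1
    ext e
    simp only [Finset.mem_inter, Finset.mem_biUnion, Finset.mem_univ, true_and, mem_interface]
    constructor
    · rintro ⟨⟨i, hi⟩, ⟨j, hj⟩⟩
      have : i = j := Fin.ext ((column_eq hi).symm.trans (column_eq hj))
      subst this
      exact ⟨i, hi, hj⟩
    · rintro ⟨i, hi, hj⟩
      exact ⟨⟨i, hi⟩, ⟨i, hj⟩⟩
  · intro i _ j _ hij
    refine Finset.disjoint_left.2 fun e hi hj => ?_
    exact hij (Fin.ext ((column_eq (Finset.mem_inter.1 hi).1).symm.trans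
      (column_eq (Finset.mem_inter.1 hj).1)))

/-- The number of bonds common to two interfaces in one column. -/
def commonLength (x y x' y' : ℤ) : ℕ :=
  (if x = x' then 1 else 0) + (min (max x y) (max x' y') - max (min x y) (min x' y')).toNat

theorem card_columnBonds_inter (i : ℕ) (x y x' y' : ℤ) :
    (columnBonds i x y ∩ columnBonds i x' y').card = commonLength x y x' y' := by
  have inj : Function.Injective (Bond.vert (i + 1)) := fun a b h => by
    injection h
  have key : columnBonds i x y ∩ columnBonds i x' y' =
      (if x = x' then {Bond.horiz i x} else ∅) ∪
        (Finset.Ico (max (min x y) (min x' y')) (min (max x y) (max x' y'))).image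
          (Bond.vert (i + 1)) := by
    rw [← Finset.Ico_inter_Ico, Finset.image_inter _ _ inj]
    ext e
    simp only [columnBonds, Finset.mem_inter, Finset.mem_insert, Finset.mem_union, Finset.mem_image]
    cases e with
    | horiz j z =>
      simp only [reduceCtorEq, and_false, exists_false, or_false, Bond.horiz.injEq]
      split_ifs with h
      · subst h; simp
      · simp only [Finset.notMem_empty, iff_false]; rintro ⟨⟨_, rfl⟩, ⟨_, h2⟩⟩; exact h h2
    | vert j z =>
      simp only [reduceCtorEq, false_or]
      split_ifs with h <;> simp
  rw [key, Finset.card_union_of_disjoint, Finset.card_image_of_injective _ inj, Int.card_Ico,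
    commonLength]
  · split_ifs <;> simp
  · rw [Finset.disjoint_left]
    intro e h1 h2
    rw [Finset.mem_image] at h2
    obtain ⟨z, _, rfl⟩ := h2
    split_ifs at h1 <;> simp at h1

/-- The length of an interface in one column. -/
def columnLength (x y : ℤ) : ℕ := 1 + (x - y).natAbs

theorem commonLength_self (x y : ℤ) : commonLength x y x y = columnLength x y := by
  rw [commonLength, columnLength, if_pos rfl]
  omega

theorem commonLength_le (x y x' y' : ℤ) : commonLength x y x' y' ≤ columnLength x y := by
  rw [commonLength, columnLength]
  split_ifs <;> omega

theorem card_interface_inter_eq {N : ℕ} (h h' : Fin (N + 1) → ℤ) :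
    (interface h ∩ interface h').card = ∑ i : Fin N,
      commonLength (h i.castSucc) (h i.succ) (h' i.castSucc) (h' i.succ) := by
  rw [card_interface_inter]
  exact Finset.sum_congr rfl fun i _ => card_columnBonds_inter _ _ _ _ _

theorem card_interface {N : ℕ} (h : Fin (N + 1) → ℤ) :
    (interface h).card = ∑ i : Fin N, columnLength (h i.castSucc) (h i.succ) := by
  rw [← Finset.inter_self (interface h), card_interface_inter_eq]
  exact Finset.sum_congr rfl fun i _ => commonLength_self _ _

/-- The Boltzmann weight of one column, for a wall with the heights `v, v'` and an interface with
the heights `x, y`; here `k = exp (-β J_BW)`, `s = exp (-β J)` and `u = exp (-β J')`. -/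
def columnWeight (k s u : ℝ) (v v' x y : ℤ) : ℝ :=
  k ^ columnLength v v' *
    (s ^ (columnLength x y - commonLength x y v v') * u ^ commonLength x y v v')

theorem weight_eq_prod (β JAB JAW JBW : ℝ) (w : ℕ → ℤ) (N : ℕ) (h : Config w N) :
    weight β JAB JAW JBW w N h = ∏ i : Fin N,
      columnWeight (Real.exp (-β * JBW)) (Real.exp (-β * JAB)) (Real.exp (-β * (JAW - JBW)))
        (w i) (w (i + 1)) (h.1 i.castSucc) (h.1 i.succ) := by
  have e : ∀ i : Fin N, columnWeight (Real.exp (-β * JBW)) (Real.exp (-β * JAB))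
      (Real.exp (-β * (JAW - JBW))) (w i) (w (i + 1)) (h.1 i.castSucc) (h.1 i.succ) =
      Real.exp (-β * (JBW * (columnLength (w i) (w (i + 1)) : ℝ) +
        JAB * (columnLength (h.1 i.castSucc) (h.1 i.succ) : ℝ) +
        (JAW - JBW - JAB) *
          (commonLength (h.1 i.castSucc) (h.1 i.succ) (w i) (w (i + 1)) : ℝ))) := fun i => by
    rw [columnWeight, ← Real.exp_nat_mul, ← Real.exp_nat_mul, ← Real.exp_nat_mul, ← Real.exp_add,
      ← Real.exp_add, Nat.cast_sub (commonLength_le _ _ _ _)]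
    congr 1
    ring
  rw [Finset.prod_congr rfl fun i _ => e i, ← Real.exp_sum, weight, energy,
    Finset.card_sdiff_of_subset Finset.inter_subset_left,
    Finset.card_sdiff_of_subset Finset.inter_subset_right,
    Nat.cast_sub (Finset.card_le_card Finset.inter_subset_left),
    Nat.cast_sub (Finset.card_le_card Finset.inter_subset_right),
    card_interface_inter_eq, card_interface, card_interface]
  congr 1
  simp only [restrict, Fin.val_castSucc, Fin.val_succ]
  push_cast
  simp only [mul_add, Finset.sum_add_distrib, ← Finset.mul_sum]
  ring

/-! ### Sums over paths and transfer operators -/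

/-- Operators preserving the nonnegativity of all coordinates. -/
def Preserving (B : SeqSpace →L[ℝ] SeqSpace) : Prop :=
  ∀ f : SeqSpace, (∀ n, 0 ≤ f n) → ∀ n, 0 ≤ (B f) n

theorem Preserving.mul {B C : SeqSpace →L[ℝ] SeqSpace} (hB : Preserving B) (hC : Preserving C) :
    Preserving (B * C) := fun f hf => hB _ (hC f hf)

theorem Preserving.one : Preserving 1 := fun _ hf => hf

theorem Preserving.pow {B : SeqSpace →L[ℝ] SeqSpace} (hB : Preserving B) (n : ℕ) :
    Preserving (B ^ n) := by
  induction n with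
  | zero => exact Preserving.one
  | succ n ih => rw [pow_succ]; exact ih.mul hB

theorem inner_nonneg_of_nonneg {f g : SeqSpace} (hf : ∀ n, 0 ≤ f n) (hg : ∀ n, 0 ≤ g n) :
    0 ≤ ⟪f, g⟫_ℝ :=
  (hasSum_inner_coord f g).nonneg fun n => mul_nonneg (hf n) (hg n)

theorem basisVec_nonneg (n m : ℕ) : 0 ≤ basisVec n m := by
  rw [basisVec_apply]; split_ifs <;> norm_num

theorem Preserving.adjoint {B : SeqSpace →L[ℝ] SeqSpace} (hB : Preserving B) :
    Preserving (adjoint B) := fun f hf n => by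
  rw [adjoint_apply_coord]
  exact inner_nonneg_of_nonneg (hB _ (basisVec_nonneg n)) hf

theorem hasSum_apply_coord (B : SeqSpace →L[ℝ] SeqSpace) (f : SeqSpace) (n : ℕ) :
    HasSum (fun m => (B (basisVec m)) n * f m) ((B f) n) := by
  have h := hasSum_inner_coord (ContinuousLinearMap.adjoint B (basisVec n)) f
  rw [adjoint_inner_left, inner_basisVec] at h
  refine h.congr_fun fun m => ?_
  rw [adjoint_apply_coord, inner_basisVec_right]

/-- The product `B 0 * B 1 * ⋯ * B (N - 1)`. -/
noncomputable def operatorProd (B : ℕ → SeqSpace →L[ℝ] SeqSpace) : ℕ → SeqSpace →L[ℝ] SeqSpace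
  | 0 => 1
  | N + 1 => operatorProd B N * B N

theorem tsum_snoc {N : ℕ} (F : (Fin (N + 1) → ℕ) → ENNReal) :
    ∑' k, F k = ∑' k : Fin N → ℕ, ∑' y : ℕ, F (Fin.snoc (α := fun _ => ℕ) k y) := by
  rw [← (Fin.snocEquiv (fun _ : Fin (N + 1) => ℕ)).tsum_eq, ← ENNReal.tsum_comm,
    ← ENNReal.tsum_prod]
  rfl

/-- A sum over paths `k 0 = 0, k 1, …, k N` of products of step weights is a matrix element of the
product of the transfer operators. The operators are conjugated by the multiplication with `d` and
normalised by the factors `κ i`. -/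
theorem tsum_paths_eq (g : ℕ → ℕ → ℕ → ℝ) (B : ℕ → SeqSpace →L[ℝ] SeqSpace) (κ d : ℕ → ℝ)
    (hg : ∀ i x y, 0 ≤ g i x y) (hκ : ∀ i, 0 ≤ κ i) (hd : ∀ x, 0 ≤ d x)
    (hB : ∀ i, Preserving (B i))
    (h : ∀ i x y, g i x y * d y = κ i * d x * (B i (basisVec y)) x) (N : ℕ)
    (f : SeqSpace) (hf : ∀ n, 0 ≤ f n) :
    ∑' k : Fin (N + 1) → ℕ, (if k 0 = 0 then ENNReal.ofReal
      ((∏ i : Fin N, g i (k i.castSucc) (k i.succ)) * (d (k (Fin.last N)) * f (k (Fin.last N))))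
        else 0) =
      ENNReal.ofReal ((∏ i ∈ Finset.range N, κ i) * (d 0 * (operatorProd B N f) 0)) := by
  induction N generalizing f with
  | zero =>
    rw [← (Equiv.funUnique (Fin 1) ℕ).symm.tsum_eq, tsum_eq_single 0]
    · simp [operatorProd]
    · intro n hn
      rw [if_neg]
      simpa using hn
  | succ N ih =>
    rw [tsum_snoc, operatorProd, Finset.prod_range_succ]
    have h2 := ih (B N f) (hB N f hf)
    rw [mul_comm (∏ i ∈ Finset.range N, κ i) (κ N), mul_assoc, ENNReal.ofReal_mul (hκ N)]
    change _ = _ * ENNReal.ofReal (_ * (_ * (operatorProd B N (B N f)) 0))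
    rw [← h2, ← ENNReal.tsum_mul_left]
    refine tsum_congr fun k => ?_
    have e0 : ∀ y : ℕ, Fin.snoc (α := fun _ => ℕ) k y 0 = k 0 := fun y =>
      Fin.snoc_castSucc (α := fun _ => ℕ) y k 0
    simp only [e0]
    split_ifs with hk
    · have hprod : 0 ≤ ∏ i : Fin N, g i (k i.castSucc) (k i.succ) :=
        Finset.prod_nonneg fun i _ => hg _ _ _
      have hs := (hasSum_apply_coord (B N) f (k (Fin.last N))).mul_left
        ((∏ i : Fin N, g i (k i.castSucc) (k i.succ)) * (κ N * d (k (Fin.last N))))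
      rw [← ENNReal.ofReal_mul (hκ N)]
      have e1 : κ N * ((∏ i : Fin N, g i (k i.castSucc) (k i.succ)) *
          (d (k (Fin.last N)) * (B N f) (k (Fin.last N)))) =
          (∏ i : Fin N, g i (k i.castSucc) (k i.succ)) * (κ N * d (k (Fin.last N))) *
            (B N f) (k (Fin.last N)) := by ring
      rw [e1, ← hs.tsum_eq, ENNReal.ofReal_tsum_of_nonneg _ hs.summable]
      · refine tsum_congr fun y => ?_
        congr 1
        rw [Fin.prod_univ_castSucc]
        have e2 : ∀ i : Fin (N + 1), Fin.snoc (α := fun _ => ℕ) k y i.castSucc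
            = k i := fun i => Fin.snoc_castSucc (α := fun _ => ℕ) y k i
        have e3 : Fin.snoc (α := fun _ => ℕ) k y (Fin.last (N + 1)) = y :=
          Fin.snoc_last (α := fun _ => ℕ) y k
        simp only [Fin.succ_castSucc, Fin.succ_last, e2, e3, Fin.val_castSucc, Fin.val_last]
        linear_combination (∏ i : Fin N, g i (k i.castSucc) (k i.succ)) * f y *
          h N (k (Fin.last N)) y
      · intro y
        exact mul_nonneg (mul_nonneg hprod (mul_nonneg (hκ N) (hd _)))
          (mul_nonneg (hB N _ (basisVec_nonneg y) _) (hf y))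
    · simp

theorem Preserving.operatorProd {B : ℕ → SeqSpace →L[ℝ] SeqSpace} (hB : ∀ i, Preserving (B i))
    (N : ℕ) : Preserving (operatorProd B N) := by
  induction N with
  | zero => exact Preserving.one
  | succ N ih => exact ih.mul (hB N)

/-- The heights of a configuration relative to the wall. -/
def relativeHeight {w : ℕ → ℤ} {N : ℕ} (h : Config w N) (i : Fin (N + 1)) : ℕ :=
  (h.1 i - w i).toNat

theorem coe_relativeHeight {w : ℕ → ℤ} {N : ℕ} (h : Config w N) (i : Fin (N + 1)) :
    w i + (relativeHeight h i : ℤ) = h.1 i := by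
  have := h.2.2.2 i
  rw [relativeHeight]; omega

theorem relativeHeight_injective (w : ℕ → ℤ) (N : ℕ) :
    Function.Injective (relativeHeight : Config w N → Fin (N + 1) → ℕ) := fun h h' e => by
  refine Subtype.ext (funext fun i => ?_)
  rw [← coe_relativeHeight h i, ← coe_relativeHeight h' i, e]

/-- The partition function as a matrix element, when the column weights are the kernels of operators
`B i` up to the normalising factors `κ i` and the conjugation with `d`. -/
theorem hasSum_weight {β JAB JAW JBW : ℝ} {w : ℕ → ℤ} (B : ℕ → SeqSpace →L[ℝ] SeqSpace)
    (κ d : ℕ → ℝ) (hκ : ∀ i, 0 ≤ κ i) (hd : ∀ x, 0 ≤ d x) (hd0 : d 0 = 1)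
    (hB : ∀ i, Preserving (B i))
    (h : ∀ i (x y : ℕ), columnWeight (Real.exp (-β * JBW)) (Real.exp (-β * JAB))
      (Real.exp (-β * (JAW - JBW))) (w i) (w (i + 1)) (w i + x) (w (i + 1) + y) * d y =
        κ i * d x * (B i (basisVec y)) x) (N : ℕ) :
    HasSum (weight β JAB JAW JBW w N)
      ((∏ i ∈ Finset.range N, κ i) * (operatorProd B N (basisVec 0)) 0) := by
  set g : ℕ → ℕ → ℕ → ℝ := fun i x y => columnWeight (Real.exp (-β * JBW)) (Real.exp (-β * JAB))
      (Real.exp (-β * (JAW - JBW))) (w i) (w (i + 1)) (w i + x) (w (i + 1) + y) with hgdef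
  have hg : ∀ i x y, 0 ≤ g i x y := fun i x y => by
    rw [hgdef]; simp only [columnWeight]; positivity
  have key := tsum_paths_eq g B κ d hg hκ hd hB h N (basisVec 0) (basisVec_nonneg 0)
  rw [hd0, one_mul] at key
  have hnn : 0 ≤ (∏ i ∈ Finset.range N, κ i) * (operatorProd B N (basisVec 0)) 0 :=
    mul_nonneg (Finset.prod_nonneg fun i _ => hκ i)
      (Preserving.operatorProd hB N _ (basisVec_nonneg 0) 0)
  have e : ∑' h : Config w N, ENNReal.ofReal (weight β JAB JAW JBW w N h) =
      ENNReal.ofReal ((∏ i ∈ Finset.range N, κ i) * (operatorProd B N (basisVec 0)) 0) := by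
    rw [← key, ← (relativeHeight_injective w N).tsum_eq]
    · refine tsum_congr fun h => ?_
      have r0 : relativeHeight h 0 = 0 := by
        have := h.2.1
        rw [relativeHeight]; simp [this]
      have r1 : relativeHeight h (Fin.last N) = 0 := by
        have := h.2.2.1
        rw [relativeHeight]; simp [this]
      rw [if_pos r0, r1, hd0, basisVec_apply, if_pos rfl, mul_one, mul_one, weight_eq_prod]
      congr 1
      refine Finset.prod_congr rfl fun i _ => ?_
      have c0 := coe_relativeHeight h i.castSucc
      have c1 := coe_relativeHeight h i.succ
      rw [Fin.val_castSucc] at c0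
      rw [Fin.val_succ] at c1
      rw [hgdef]
      simp only [c0, c1]
    · intro k hk
      rw [Function.mem_support] at hk
      have k0 : k 0 = 0 := by
        by_contra hne
        exact hk (if_neg hne)
      have k1 : k (Fin.last N) = 0 := by
        by_contra hne
        refine hk ?_
        rw [basisVec_apply, if_neg hne]
        simp
      refine ⟨⟨fun i => w i + k i, by simp [k0], by simp [k1], fun i => by simp⟩, ?_⟩
      funext i
      simp [relativeHeight]
  have hw : ∀ h : Config w N, 0 ≤ weight β JAB JAW JBW w N h := fun h => (Real.exp_pos _).le
  have hfin : ∑' h : Config w N, ENNReal.ofReal (weight β JAB JAW JBW w N h) ≠ ⊤ := by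
    rw [e]; exact ENNReal.ofReal_ne_top
  have hsum := ENNReal.hasSum_toReal hfin
  rw [← ENNReal.tsum_toReal_eq (fun _ => ENNReal.ofReal_ne_top), e, ENNReal.toReal_ofReal hnn]
    at hsum
  refine hsum.congr_fun fun h => ?_
  rw [ENNReal.toReal_ofReal (hw h)]

/-! ### Exponential growth rates of matrix elements -/

theorem Preserving.mul_le {B : SeqSpace →L[ℝ] SeqSpace} (hB : Preserving B) {f : SeqSpace}
    (hf : ∀ n, 0 ≤ f n) (n m : ℕ) : (B (basisVec m)) n * f m ≤ (B f) n :=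
  le_hasSum (hasSum_apply_coord B f n) m fun j _ => mul_nonneg (hB _ (basisVec_nonneg j) n) (hf j)

/-- Sequences with nonnegative coordinates, the first of which is positive. -/
def PosAtZero (f : SeqSpace) : Prop := (∀ n, 0 ≤ f n) ∧ 0 < f 0

/-- Sequences all of whose coordinates are positive. -/
def StrictlyPos (f : SeqSpace) : Prop := ∀ n, 0 < f n

theorem StrictlyPos.posAtZero {f : SeqSpace} (hf : StrictlyPos f) : PosAtZero f :=
  ⟨fun n => (hf n).le, hf 0⟩

theorem posAtZero_basisVec : PosAtZero (basisVec 0) :=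
  ⟨basisVec_nonneg 0, by rw [basisVec_apply]; norm_num⟩

theorem Preserving.posAtZero {B : SeqSpace →L[ℝ] SeqSpace} (hB : Preserving B)
    (h : 0 < (B (basisVec 0)) 0) {f : SeqSpace} (hf : PosAtZero f) : PosAtZero (B f) :=
  ⟨hB f hf.1, (mul_pos h hf.2).trans_le (hB.mul_le hf.1 0 0)⟩

/-- The growth rate of the matrix elements `⟪e₀, T ^ n e₀⟫`. -/
def HasRate (T : SeqSpace →L[ℝ] SeqSpace) (L : ℝ) : Prop :=
  Tendsto (fun n : ℕ => Real.log (((T ^ n) (basisVec 0)) 0) / n) atTop (𝓝 L)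

theorem one_le_pow_coord {T : SeqSpace →L[ℝ] SeqSpace} (hT : Preserving T)
    (h1 : 1 ≤ (T (basisVec 0)) 0) (n : ℕ) : 1 ≤ ((T ^ n) (basisVec 0)) 0 := by
  induction n with
  | zero => simp [basisVec_apply]
  | succ n ih =>
    rw [pow_succ']
    refine le_trans ?_ (hT.mul_le ((hT.pow n) _ (basisVec_nonneg 0)) 0 0)
    nlinarith

/-- The growth rate exists by Fekete's lemma: the matrix elements are supermultiplicative, since the
paths through height `0` at an intermediate site form part of all paths. -/
theorem exists_hasRate {T : SeqSpace →L[ℝ] SeqSpace} (hT : Preserving T)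
    (h1 : 1 ≤ (T (basisVec 0)) 0) : ∃ L, HasRate T L := by
  set v : ℕ → ℝ := fun n => -Real.log (((T ^ n) (basisVec 0)) 0) with hv
  have hpos : ∀ n, 0 < ((T ^ n) (basisVec 0)) 0 := fun n =>
    zero_lt_one.trans_le (one_le_pow_coord hT h1 n)
  have hle : ∀ n, ((T ^ n) (basisVec 0)) 0 ≤ ‖T‖ ^ n := fun n => by
    rw [← inner_basisVec]
    refine (real_inner_le_norm _ _).trans ?_
    rw [orthonormal_basisVec.1, one_mul]
    refine ((T ^ n).le_opNorm _).trans ?_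
    rw [orthonormal_basisVec.1, mul_one]
    rcases Nat.eq_zero_or_pos n with rfl | hn
    · rw [pow_zero, pow_zero]; exact norm_id_le
    · exact norm_pow_le' T hn
  have hsub : Subadditive v := fun m n => by
    rw [hv]
    simp only
    rw [← neg_add, neg_le_neg_iff, ← Real.log_mul (hpos m).ne' (hpos n).ne']
    refine Real.log_le_log (mul_pos (hpos m) (hpos n)) ?_
    rw [pow_add]
    exact (hT.pow m).mul_le ((hT.pow n) _ (basisVec_nonneg 0)) 0 0
  have hbdd : BddBelow (Set.range fun n => v n / n) := by
    refine ⟨-|Real.log ‖T‖|, ?_⟩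
    rintro _ ⟨n, rfl⟩
    simp only [hv]
    rw [neg_div, neg_le_neg_iff]
    refine div_le_of_le_mul₀ (Nat.cast_nonneg n) (abs_nonneg _) ?_
    calc _ ≤ Real.log (‖T‖ ^ n) := Real.log_le_log (hpos n) (hle n)
      _ = n * Real.log ‖T‖ := Real.log_pow _ _
      _ ≤ n * |Real.log ‖T‖| := by gcongr; exact le_abs_self _
      _ = _ := mul_comm _ _
  refine ⟨-hsub.lim, ?_⟩
  have := (hsub.tendsto_lim hbdd).neg
  refine this.congr fun n => ?_
  rw [hv]; simp [neg_div]

theorem HasRate.le_log {T : SeqSpace →L[ℝ] SeqSpace} {L : ℝ} (hL : HasRate T L)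
    (hpos : ∀ n, 0 < ((T ^ n) (basisVec 0)) 0) {ρ C : ℝ} (hρ : 0 < ρ)
    (h : ∀ n, ((T ^ n) (basisVec 0)) 0 ≤ ρ ^ n * C) : L ≤ Real.log ρ := by
  have hC : 0 < C := by
    have := (hpos 0).trans_le (h 0)
    simpa using this
  have hlim : Tendsto (fun n : ℕ => Real.log ρ + Real.log C / n) atTop (𝓝 (Real.log ρ)) := by
    simpa using tendsto_const_nhds.add (tendsto_const_div_atTop_nhds_zero_nat (Real.log C))
  refine le_of_tendsto_of_tendsto hL hlim ?_
  filter_upwards [eventually_gt_atTop 0] with n hn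
  have hn' : (0 : ℝ) < n := by exact_mod_cast hn
  have := Real.log_le_log (hpos n) (h n)
  rw [Real.log_mul (by positivity) hC.ne', Real.log_pow] at this
  rw [div_le_iff₀ hn', add_mul, div_mul_cancel₀ _ hn'.ne']
  linarith

theorem HasRate.log_le {T : SeqSpace →L[ℝ] SeqSpace} {L : ℝ} (hL : HasRate T L)
    {σ C : ℝ} (hσ : 0 < σ) (hC : 0 < C) (j : ℕ)
    (h : ∀ n, σ ^ n * C ≤ ((T ^ (n + j)) (basisVec 0)) 0) : Real.log σ ≤ L := by
  have hlim : Tendsto (fun n : ℕ => Real.log σ + Real.log (C / σ ^ j) / n) atTop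
      (𝓝 (Real.log σ)) := by
    simpa using tendsto_const_nhds.add
      (tendsto_const_div_atTop_nhds_zero_nat (Real.log (C / σ ^ j)))
  refine le_of_tendsto_of_tendsto hlim hL ?_
  filter_upwards [eventually_gt_atTop 0, eventually_ge_atTop j] with n hn hj
  have hn' : (0 : ℝ) < n := by exact_mod_cast hn
  have h2 := h (n - j)
  rw [Nat.sub_add_cancel hj] at h2
  have e : σ ^ (n - j) * C = σ ^ n * (C / σ ^ j) := by
    have : σ ^ n = σ ^ (n - j) * σ ^ j := by rw [← pow_add, Nat.sub_add_cancel hj]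
    rw [this]; field_simp
  rw [e] at h2
  have := Real.log_le_log (by positivity) h2
  rw [Real.log_mul (by positivity) (by positivity), Real.log_pow] at this
  rw [le_div_iff₀ hn', add_mul, div_mul_cancel₀ _ hn'.ne']
  linarith

/-- The upper bound of the growth rate of `M K` by the form of `K`. -/
theorem HasRate.le_log_of_inner_le {M K : SeqSpace →L[ℝ] SeqSpace} {L : ℝ} (hL : HasRate (M * K) L)
    (hM : M.IsPositive) (hK : K.IsPositive) (pM : Preserving M) (pK : Preserving K)
    (h1 : 1 ≤ ((M * K) (basisVec 0)) 0) (hK1 : 1 ≤ (K (basisVec 0)) 0) {ρ : ℝ} (hρ : 0 < ρ)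
    (h : ∀ f, ⟪f, K (M (K f))⟫_ℝ ≤ ρ * ⟪f, K f⟫_ℝ) : L ≤ Real.log ρ := by
  refine hL.le_log (C := moment M K (basisVec 0) 0)
    (fun n => zero_lt_one.trans_le (one_le_pow_coord (pM.mul pK) h1 n)) hρ fun n => ?_
  refine le_trans ?_ (moment_le hM hK hρ.le h (basisVec 0) n)
  have := pK.mul_le (((pM.mul pK).pow n) _ (basisVec_nonneg 0)) 0 0
  rw [moment, inner_basisVec]
  refine le_trans ?_ this
  exact le_mul_of_one_le_left (((pM.mul pK).pow n) _ (basisVec_nonneg 0) 0) hK1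

/-- The restriction of a sequence to the heights below `n`. -/
noncomputable def truncation (f : SeqSpace) (n : ℕ) : SeqSpace :=
  ∑ i ∈ Finset.range n, f i • basisVec i

theorem truncation_apply (f : SeqSpace) (n m : ℕ) :
    (truncation f n) m = if m < n then f m else 0 := by
  rw [← inner_basisVec, truncation, inner_sum]
  simp only [real_inner_smul_right, inner_basisVec, basisVec_apply]
  simp

theorem tendsto_truncation (f : SeqSpace) : Tendsto (truncation f) atTop (𝓝 f) := by
  have := (lp.hasSum_single (E := fun _ : ℕ => ℝ) (p := 2) (by norm_num) f).tendsto_sum_nat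
  refine this.congr fun n => Finset.sum_congr rfl fun i _ => ?_
  rw [basisVec, ← lp.single_smul]
  simp

/-- The lower bound of growth rates by Rayleigh quotients of nonnegative vectors. A truncated vector
is dominated by the strictly positive end vectors `x` and `y`. -/
theorem HasRate.log_le_of_moment {T S B : SeqSpace →L[ℝ] SeqSpace} {L : ℝ} (hL : HasRate T L)
    (hS : S.IsPositive) (hB : B.IsPositive) (pS : Preserving S) (pB : Preserving B)
    {x y φ : SeqSpace} (hx : StrictlyPos x) (hy : StrictlyPos y) (hφ : ∀ n, 0 ≤ φ n) (j : ℕ)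
    (h : ∀ n, ((T ^ (n + j)) (basisVec 0)) 0 = ⟪x, S (((B * S) ^ n) y)⟫_ℝ)
    {σ : ℝ} (hσ : 0 < σ) (h0 : 0 < moment B S φ 0) (h1 : σ * moment B S φ 0 < moment B S φ 1) :
    Real.log σ ≤ L := by
  have cont : ∀ k, Continuous fun f : SeqSpace => moment B S f k := fun k => by
    unfold moment; fun_prop
  have t0 := ((cont 0).tendsto φ).comp (tendsto_truncation φ)
  have t1 := ((cont 1).tendsto φ).comp (tendsto_truncation φ)
  have ev0 := t0.eventually (lt_mem_nhds h0)
  have ev1 := (t0.const_mul σ).eventually_lt t1 h1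
  obtain ⟨N, hN0, hN1⟩ := (ev0.and ev1).exists
  simp only [Function.comp_apply] at hN0 hN1
  set f := truncation φ N with hf
  have f0 : ∀ n, 0 ≤ f n := fun n => by
    rw [hf, truncation_apply]; split_ifs; exacts [hφ n, le_rfl]
  have dom : ∀ z : SeqSpace, StrictlyPos z → ∃ c > 0, ∀ n, c * f n ≤ z n := fun z hz => by
    have hnn : ∀ i, 0 ≤ φ i / z i := fun i => div_nonneg (hφ i) (hz i).le
    have hpos : 0 < 1 + ∑ i ∈ Finset.range N, φ i / z i := by
      have := Finset.sum_nonneg fun i (_ : i ∈ Finset.range N) => hnn i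
      linarith
    refine ⟨(1 + ∑ i ∈ Finset.range N, φ i / z i)⁻¹, inv_pos.2 hpos, fun n => ?_⟩
    rw [inv_mul_le_iff₀ hpos, hf, truncation_apply]
    split_ifs with hn
    · have := Finset.single_le_sum (fun i _ => hnn i) (Finset.mem_range.2 hn)
      calc φ n = φ n / z n * z n := (div_mul_cancel₀ _ (hz n).ne').symm
        _ ≤ _ := mul_le_mul_of_nonneg_right (by linarith) (hz n).le
    · exact mul_nonneg hpos.le (hz n).le
  obtain ⟨c, hc, hcx⟩ := dom x hx
  obtain ⟨d, hd, hdy⟩ := dom y hy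
  refine hL.log_le hσ (C := c * d * moment B S f 0) (by positivity) j fun n => ?_
  rw [h n]
  set Q := S * (B * S) ^ n with hQ
  have pQ : Preserving Q := pS.mul ((pB.mul pS).pow n)
  change _ ≤ ⟪x, Q y⟫_ℝ
  have s1 : 0 ≤ ⟪x - c • f, Q y⟫_ℝ := by
    refine inner_nonneg_of_nonneg (fun m => ?_) (pQ _ fun m => (hy m).le)
    rw [← inner_basisVec, inner_sub_right, real_inner_smul_right, inner_basisVec, inner_basisVec]
    exact sub_nonneg.2 (hcx m)
  have s2 : 0 ≤ ⟪f, Q (y - d • f)⟫_ℝ := by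
    refine inner_nonneg_of_nonneg f0 (pQ _ fun m => ?_)
    rw [← inner_basisVec, inner_sub_right, real_inner_smul_right, inner_basisVec, inner_basisVec]
    exact sub_nonneg.2 (hdy m)
  rw [inner_sub_left, real_inner_smul_left] at s1
  rw [map_sub, map_smul, inner_sub_right, real_inner_smul_right] at s2
  have s3 := le_moment hB hS f hσ hN0 hN1.le n
  change _ ≤ ⟪f, Q f⟫_ℝ at s3
  calc σ ^ n * (c * d * moment B S f 0) = c * (d * (σ ^ n * moment B S f 0)) := by ring
    _ ≤ c * (d * ⟪f, Q f⟫_ℝ) := by gcongr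
    _ ≤ c * ⟪f, Q y⟫_ℝ := by gcongr; linarith
    _ ≤ _ := by linarith

/-! ### The transfer operator of a period of the wall -/

/-- The transfer operators of the columns of the two-step wall, the column `i` lying between the
sites `i` and `i + 1`. -/
noncomputable def wallOperator (a b c : ℕ) (p s t : ℝ) (i : ℕ) : SeqSpace →L[ℝ] SeqSpace :=
  if i % a + 1 = c then stepOp b p t * flatTransfer p s
  else if i % a + 1 = a then flatTransfer p s * adjoint (stepOp b p t)
  else flatTransfer p s

/-- The part of the transfer operator of a period due to the plateau and the two steps. -/
noncomputable def plateauOperator (b m : ℕ) (p s t : ℝ) : SeqSpace →L[ℝ] SeqSpace :=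
  stepOp b p t * flatTransfer p s ^ (m + 1) * adjoint (stepOp b p t)

/-- The transfer operator of one period of the wall. -/
noncomputable def periodOperator (a b c : ℕ) (p s t : ℝ) : SeqSpace →L[ℝ] SeqSpace :=
  flatTransfer p s ^ (c - 1) * plateauOperator b (a - c) p s t

theorem operatorProd_add (B : ℕ → SeqSpace →L[ℝ] SeqSpace) (M N : ℕ) :
    operatorProd B (M + N) = operatorProd B M * operatorProd (fun i => B (M + i)) N := by
  induction N with
  | zero => simp [operatorProd]
  | succ N ih => rw [← add_assoc, operatorProd, ih, operatorProd, mul_assoc]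

theorem operatorProd_eq_pow {B : ℕ → SeqSpace →L[ℝ] SeqSpace} {A : SeqSpace →L[ℝ] SeqSpace} {N : ℕ}
    (h : ∀ i < N, B i = A) : operatorProd B N = A ^ N := by
  induction N with
  | zero => rfl
  | succ N ih =>
    rw [operatorProd, ih fun i hi => h i (hi.trans N.lt_succ_self), h N N.lt_succ_self, pow_succ]

theorem apply_mul_add_of_periodic {α : Type*} {F : ℕ → α} {a : ℕ} (h : ∀ i, F (i + a) = F i)
    (n i : ℕ) : F (n * a + i) = F i := by
  induction n with
  | zero => simp
  | succ n ih => rw [← ih, ← h (n * a + i), Nat.succ_mul, add_right_comm]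

theorem operatorProd_mul {B : ℕ → SeqSpace →L[ℝ] SeqSpace} {a : ℕ} (h : ∀ i, B (i + a) = B i)
    (n : ℕ) : operatorProd B (n * a) = operatorProd B a ^ n := by
  induction n with
  | zero => simp [operatorProd]
  | succ n ih =>
    rw [Nat.succ_mul, operatorProd_add, ih, pow_succ]
    congr 2
    funext i
    exact apply_mul_add_of_periodic h n i

theorem operatorProd_wallOperator {a b c : ℕ} (hc : 1 ≤ c) (hca : c < a) (p s t : ℝ) (n : ℕ) :
    operatorProd (wallOperator a b c p s t) (n * a) = periodOperator a b c p s t ^ n := by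
  rw [operatorProd_mul fun i => by simp only [wallOperator, Nat.add_mod_right]]
  congr 1
  obtain ⟨d, rfl⟩ := Nat.exists_eq_add_of_le' hc
  obtain ⟨m, rfl⟩ := Nat.exists_eq_add_of_lt hca
  have hmod : ∀ i, i < d + 1 + m + 1 → i % (d + 1 + m + 1) = i := fun i hi => Nat.mod_eq_of_lt hi
  rw [periodOperator, operatorProd, operatorProd_add, operatorProd,
    operatorProd_eq_pow (A := flatTransfer p s) (N := d),
    operatorProd_eq_pow (A := flatTransfer p s) (N := m)]
  · rw [wallOperator, hmod d (by omega), if_pos rfl, wallOperator, hmod _ (by omega),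
      if_neg (by omega), if_pos rfl, plateauOperator,
      show d + 1 + m + 1 - (d + 1) + 1 = 1 + m + 1 by omega, show d + 1 - 1 = d by omega, pow_add,
      pow_add, pow_one]
    simp only [mul_assoc]
  · intro i hi
    rw [wallOperator, hmod _ (by omega), if_neg (by omega), if_neg (by omega)]
  · intro i hi
    rw [wallOperator, hmod _ (by omega), if_neg (by omega), if_neg (by omega)]

/-- The square root of the relative weight of the horizontal bond at height `x`. -/
noncomputable def pinWeight (p : ℝ) (x : ℕ) : ℝ := if x = 0 then 1 else p

theorem flatTransfer_coord {p s : ℝ} (h0 : 0 ≤ s) (h1 : s < 1) (x y : ℕ) :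
    (flatTransfer p s (basisVec y)) x =
      pinWeight p x * s ^ ((x : ℤ) - y).natAbs * pinWeight p y :=
  flatTransfer_apply_basisVec h0 h1 x y

theorem stepOp_flatTransfer_coord {b : ℕ} {p s t : ℝ} (h0 : 0 ≤ s) (h1 : s < 1) (x y : ℕ) :
    (stepOp b p t (flatTransfer p s (basisVec y))) x =
      pinWeight p x * pinWeight p y *
        (if x ≤ b then t ^ x * s ^ y else t ^ b * s ^ ((x : ℤ) - (b + y)).natAbs) := by
  rw [stepOp_apply, flatTransfer_coord h0 h1, flatTransfer_coord h0 h1]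
  rcases Nat.eq_zero_or_pos x with rfl | hx
  · simp [pinWeight]; ring_nf
  · rcases le_or_gt x b with hb | hb
    · simp [pinWeight, hx.ne', hb]; ring_nf
    · have e : (((x - b : ℕ) : ℤ) - y).natAbs = ((x : ℤ) - (b + y)).natAbs := by omega
      have e2 : x - b ≠ 0 := by omega
      rw [if_neg hx.ne', if_neg (not_le.2 hb), if_neg (not_le.2 hb), e]
      simp [pinWeight, hx.ne', e2]
      ring_nf

/-- The weight of a column in terms of the vertical bonds alone. -/
theorem columnWeight_eq {k s u p : ℝ} (hp : s = u * p ^ 2) (v v' x' : ℤ) (x l c : ℕ)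
    (hl : (v + x - x').natAbs = l + c)
    (hc : (min (max (v + x) x') (max v v') - max (min (v + x) x') (min v v')).toNat = c) :
    columnWeight k s u v v' (v + x) x' =
      k ^ columnLength v v' * (u * pinWeight p x ^ 2) * (s ^ l * u ^ c) := by
  rw [columnWeight, columnLength, columnLength, commonLength, hc, hl]
  rcases Nat.eq_zero_or_pos x with rfl | hx
  · have : 1 + (l + c) - (1 + c) = l := by omega
    simp only [Nat.cast_zero, add_zero, if_true, this, pinWeight]
    ring
  · have : v + (x : ℤ) ≠ v := by omega
    have e : 1 + (l + c) - (0 + c) = l + 1 := by omega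
    rw [if_neg this, e, pinWeight, if_neg hx.ne', ← hp]
    ring

theorem columnWeight_flat {k s u p : ℝ} (hp : s = u * p ^ 2) (h0 : 0 ≤ s) (h1 : s < 1) (v : ℤ)
    (x y : ℕ) : columnWeight k s u v v (v + x) (v + y) * pinWeight p y =
      (k * u) ^ columnLength v v * pinWeight p x * (flatTransfer p s (basisVec y)) x := by
  rw [columnWeight_eq hp v v (v + y) x ((x : ℤ) - y).natAbs 0 (by omega) (by omega),
    flatTransfer_coord h0 h1, columnLength]
  simp
  ring

theorem columnWeight_up {k s u p t : ℝ} (hp : s = u * p ^ 2) (h0 : 0 ≤ s) (h1 : s < 1)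
    (ht : u * t = 1) (b x y : ℕ) :
    columnWeight k s u 0 b (0 + x) (b + y) * pinWeight p y =
      (k * u) ^ columnLength 0 b * pinWeight p x *
        (stepOp b p t (flatTransfer p s (basisVec y))) x := by
  rw [stepOp_flatTransfer_coord h0 h1]
  have hlen : columnLength 0 b = 1 + b := by rw [columnLength]; omega
  split_ifs with hb
  · rw [columnWeight_eq hp 0 b (b + y) x y (b - x) (by omega) (by omega), hlen]
    have e : u ^ b * t ^ x = u ^ (b - x) := by
      obtain ⟨d, rfl⟩ := Nat.exists_eq_add_of_le hb
      rw [Nat.add_sub_cancel_left, pow_add, mul_right_comm, ← mul_pow, ht, one_pow, one_mul]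
    rw [← e]
    ring
  · rw [columnWeight_eq hp 0 b (b + y) x ((x : ℤ) - (b + y)).natAbs 0 (by omega) (by omega), hlen]
    have e : u ^ b * t ^ b = 1 := by rw [← mul_pow, ht, one_pow]
    linear_combination (-(k ^ (1 + b) * u * pinWeight p x ^ 2 * pinWeight p y *
      s ^ ((x : ℤ) - (b + y)).natAbs)) * e

theorem columnWeight_down {k s u p t : ℝ} (hp : s = u * p ^ 2) (h0 : 0 ≤ s) (h1 : s < 1)
    (ht : u * t = 1) (b x y : ℕ) :
    columnWeight k s u b 0 (b + x) (0 + y) * pinWeight p y =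
      (k * u) ^ columnLength b 0 * pinWeight p x *
        (flatTransfer p s (adjoint (stepOp b p t) (basisVec y))) x := by
  have e0 : (flatTransfer p s (adjoint (stepOp b p t) (basisVec y))) x =
      (stepOp b p t (flatTransfer p s (basisVec x))) y := by
    rw [← inner_basisVec, ← (flatTransfer_isPositive h0 h1).inner_left_eq_inner_right,
      adjoint_inner_right, inner_basisVec_right]
  rw [e0, stepOp_flatTransfer_coord h0 h1]
  have hlen : columnLength b 0 = 1 + b := by rw [columnLength]; omega
  split_ifs with hb
  · rw [columnWeight_eq hp b 0 (0 + y) x x (b - y) (by omega) (by omega), hlen]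
    have e : u ^ b * t ^ y = u ^ (b - y) := by
      obtain ⟨d, rfl⟩ := Nat.exists_eq_add_of_le hb
      rw [Nat.add_sub_cancel_left, pow_add, mul_right_comm, ← mul_pow, ht, one_pow, one_mul]
    rw [← e]
    ring
  · rw [columnWeight_eq hp b 0 (0 + y) x ((y : ℤ) - (b + x)).natAbs 0 (by omega) (by omega), hlen]
    have e : u ^ b * t ^ b = 1 := by rw [← mul_pow, ht, one_pow]
    linear_combination (-(k ^ (1 + b) * u * pinWeight p x ^ 2 * pinWeight p y *
      s ^ ((y : ℤ) - (b + x)).natAbs)) * e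

theorem succ_mod_cases {a : ℕ} (ha : 0 < a) (i : ℕ) :
    (i % a + 1 < a ∧ (i + 1) % a = i % a + 1) ∨ (i % a + 1 = a ∧ (i + 1) % a = 0) := by
  have h := Nat.mod_lt i ha
  rcases Nat.lt_or_ge (i % a + 1) a with h1 | h1
  · exact Or.inl ⟨h1, by rw [← Nat.mod_add_mod, Nat.mod_eq_of_lt h1]⟩
  · have : i % a + 1 = a := by omega
    exact Or.inr ⟨this, by rw [← Nat.mod_add_mod, this, Nat.mod_self]⟩

/-- The column weights of the two-step wall are the kernels of `wallOperator`. The factor `k * u` for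
each bond of the wall is the weight of an interface that follows the wall. -/
theorem columnWeight_stepWall {a b c : ℕ} (hc : 1 ≤ c) (hca : c < a) {k s u p t : ℝ}
    (hp : s = u * p ^ 2) (h0 : 0 ≤ s) (h1 : s < 1) (ht : u * t = 1) (i x y : ℕ) :
    columnWeight k s u (stepWall a b c i) (stepWall a b c (i + 1)) (stepWall a b c i + x)
        (stepWall a b c (i + 1) + y) * pinWeight p y =
      (k * u) ^ columnLength (stepWall a b c i) (stepWall a b c (i + 1)) * pinWeight p x *
        (wallOperator a b c p s t i (basisVec y)) x := by
  rcases succ_mod_cases (by omega : 0 < a) i with ⟨h2, h3⟩ | ⟨h2, h3⟩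
  · rcases lt_trichotomy (i % a + 1) c with h4 | h4 | h4
    · have e1 : stepWall a b c i = 0 := if_pos (by omega)
      have e2 : stepWall a b c (i + 1) = 0 := if_pos (by omega)
      rw [e1, e2, wallOperator, if_neg h4.ne, if_neg h2.ne]
      exact columnWeight_flat hp h0 h1 0 x y
    · have e1 : stepWall a b c i = 0 := if_pos (by omega)
      have e2 : stepWall a b c (i + 1) = b := if_neg (by omega)
      rw [e1, e2, wallOperator, if_pos h4]
      exact columnWeight_up hp h0 h1 ht b x y
    · have e1 : stepWall a b c i = b := if_neg (by omega)
      have e2 : stepWall a b c (i + 1) = b := if_neg (by omega)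
      rw [e1, e2, wallOperator, if_neg h4.ne', if_neg h2.ne]
      exact columnWeight_flat hp h0 h1 b x y
  · have e1 : stepWall a b c i = b := if_neg (by omega)
    have e2 : stepWall a b c (i + 1) = 0 := if_pos (by omega)
    rw [e1, e2, wallOperator, if_neg (by omega), if_pos h2]
    exact columnWeight_down hp h0 h1 ht b x y

theorem columnLength_stepWall {a b c : ℕ} (hc : 1 ≤ c) (hca : c < a) {i : ℕ} (hi : i < a) :
    columnLength (stepWall a b c i) (stepWall a b c (i + 1)) =
      1 + (if i = c - 1 then b else 0) + (if i = a - 1 then b else 0) := by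
  have hm := Nat.mod_eq_of_lt hi
  have hcase := succ_mod_cases (by omega : 0 < a) i
  rw [hm] at hcase
  rw [stepWall, stepWall, hm, columnLength]
  split_ifs <;> omega

theorem sum_columnLength_stepWall {a b c : ℕ} (hc : 1 ≤ c) (hca : c < a) :
    ∑ i ∈ Finset.range a, columnLength (stepWall a b c i) (stepWall a b c (i + 1)) =
      a + 2 * b := by
  rw [Finset.sum_congr rfl fun i hi => columnLength_stepWall hc hca (Finset.mem_range.1 hi),
    Finset.sum_add_distrib, Finset.sum_add_distrib, Finset.sum_ite_eq', Finset.sum_ite_eq',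
    if_pos (Finset.mem_range.2 (by omega)), if_pos (Finset.mem_range.2 (by omega))]
  simp
  ring

theorem roughness_stepWall {a b c : ℕ} (hc : 1 ≤ c) (hca : c < a) :
    roughness a (stepWall a b c) = 1 + 2 * (b : ℝ) / (a : ℝ) := by
  have h := sum_columnLength_stepWall (b := b) hc hca
  have h2 : (∑ i ∈ Finset.range a, ((columnLength (stepWall a b c i) (stepWall a b c (i + 1)) : ℕ) : ℝ))
      = a + 2 * b := by exact_mod_cast h
  have h3 : ∑ i ∈ Finset.Icc 1 a, |(stepWall a b c i : ℝ) - (stepWall a b c (i - 1) : ℝ)| =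
      ∑ i ∈ Finset.range a,
        (((columnLength (stepWall a b c i) (stepWall a b c (i + 1)) : ℕ) : ℝ) - 1) := by
    refine Finset.sum_nbij' (· - 1) (· + 1) ?_ ?_ ?_ ?_ ?_
    · intro i hi; rw [Finset.mem_Icc] at hi; rw [Finset.mem_range]; omega
    · intro i hi; rw [Finset.mem_range] at hi; rw [Finset.mem_Icc]; omega
    · intro i hi; rw [Finset.mem_Icc] at hi; omega
    · intro i _; omega
    · intro i hi
      rw [Finset.mem_Icc] at hi
      rw [Nat.sub_add_cancel hi.1, columnLength, Nat.cast_add, Nat.cast_natAbs, ← abs_sub_comm]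
      push_cast
      ring
  rw [roughness, h3, Finset.sum_sub_distrib, h2]
  simp

theorem prod_period {κ : ℕ → ℝ} {a : ℕ} (h : ∀ i, κ (i + a) = κ i) (n : ℕ) :
    ∏ i ∈ Finset.range (n * a), κ i = (∏ i ∈ Finset.range a, κ i) ^ n := by
  induction n with
  | zero => simp
  | succ n ih =>
    rw [Nat.succ_mul, Finset.prod_range_add, ih, pow_succ]
    congr 1
    exact Finset.prod_congr rfl fun i _ => apply_mul_add_of_periodic h n i

/-! ### Positivity of the transfer operators -/

theorem preserving_of_entries {B : SeqSpace →L[ℝ] SeqSpace}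
    (h : ∀ x y, 0 ≤ (B (basisVec y)) x) : Preserving B := fun f hf n =>
  (hasSum_apply_coord B f n).nonneg fun m => mul_nonneg (h n m) (hf m)

theorem pinWeight_pos {p : ℝ} (hp : 0 < p) (x : ℕ) : 0 < pinWeight p x := by
  rw [pinWeight]; split_ifs <;> linarith

theorem preserving_flatTransfer {p s : ℝ} (hp : 0 < p) (h0 : 0 ≤ s) (h1 : s < 1) :
    Preserving (flatTransfer p s) := preserving_of_entries fun x y => by
  rw [flatTransfer_coord h0 h1]
  have := pinWeight_pos hp x
  have := pinWeight_pos hp y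
  positivity

theorem preserving_stepOp {b : ℕ} {p t : ℝ} (hp : 0 < p) (ht : 0 < t) :
    Preserving (stepOp b p t) := fun f hf n => by
  rw [stepOp_apply]
  have := hf 0
  have := hf (n - b)
  split_ifs <;> positivity

theorem preserving_wallOperator {a b c : ℕ} {p s t : ℝ} (hp : 0 < p) (h0 : 0 ≤ s) (h1 : s < 1)
    (ht : 0 < t) (i : ℕ) : Preserving (wallOperator a b c p s t i) := by
  have hA := preserving_flatTransfer hp h0 h1
  have hY := preserving_stepOp (b := b) hp ht
  rw [wallOperator]
  split_ifs
  exacts [hY.mul hA, hA.mul hY.adjoint, hA]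

theorem one_le_mul_coord {B C : SeqSpace →L[ℝ] SeqSpace} (pB : Preserving B) (pC : Preserving C)
    (hB : 1 ≤ (B (basisVec 0)) 0) (hC : 1 ≤ (C (basisVec 0)) 0) :
    1 ≤ ((B * C) (basisVec 0)) 0 := by
  refine le_trans ?_ (pB.mul_le (pC _ (basisVec_nonneg 0)) 0 0)
  nlinarith

theorem flatTransfer_zero_zero {p s : ℝ} (h0 : 0 ≤ s) (h1 : s < 1) :
    (flatTransfer p s (basisVec 0)) 0 = 1 := by
  rw [flatTransfer_coord h0 h1]; simp [pinWeight]

theorem stepOp_zero_zero (b : ℕ) (p t : ℝ) : (stepOp b p t (basisVec 0)) 0 = 1 := by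
  rw [stepOp_apply, basisVec_apply]; simp

theorem adjoint_stepOp_zero_zero (b : ℕ) (p t : ℝ) :
    (adjoint (stepOp b p t) (basisVec 0)) 0 = 1 := by
  rw [adjoint_apply_coord, inner_basisVec_right, stepOp_zero_zero]

theorem preserving_plateauOperator {b m : ℕ} {p s t : ℝ} (hp : 0 < p) (h0 : 0 ≤ s) (h1 : s < 1)
    (ht : 0 < t) : Preserving (plateauOperator b m p s t) :=
  ((preserving_stepOp hp ht).mul ((preserving_flatTransfer hp h0 h1).pow _)).mul
    (preserving_stepOp hp ht).adjoint

theorem plateauOperator_isPositive {b m : ℕ} {p s t : ℝ} (h0 : 0 ≤ s) (h1 : s < 1) :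
    (plateauOperator b m p s t).IsPositive :=
  (isPositive_pow (flatTransfer_isPositive h0 h1) (m + 1)).conj_adjoint (stepOp b p t)

theorem one_le_plateauOperator {b m : ℕ} {p s t : ℝ} (hp : 0 < p) (h0 : 0 ≤ s) (h1 : s < 1)
    (ht : 0 < t) : 1 ≤ (plateauOperator b m p s t (basisVec 0)) 0 := by
  have hA := preserving_flatTransfer hp h0 h1
  have hY := preserving_stepOp (b := b) hp ht
  exact one_le_mul_coord (hY.mul (hA.pow _)) hY.adjoint
    (one_le_mul_coord hY (hA.pow _) (stepOp_zero_zero b p t).ge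
      (one_le_pow_coord hA (flatTransfer_zero_zero h0 h1).ge _))
    (adjoint_stepOp_zero_zero b p t).ge

theorem preserving_periodOperator {a b c : ℕ} {p s t : ℝ} (hp : 0 < p) (h0 : 0 ≤ s) (h1 : s < 1)
    (ht : 0 < t) : Preserving (periodOperator a b c p s t) :=
  ((preserving_flatTransfer hp h0 h1).pow _).mul (preserving_plateauOperator hp h0 h1 ht)

theorem one_le_periodOperator {a b c : ℕ} {p s t : ℝ} (hp : 0 < p) (h0 : 0 ≤ s) (h1 : s < 1)
    (ht : 0 < t) : 1 ≤ (periodOperator a b c p s t (basisVec 0)) 0 :=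
  one_le_mul_coord ((preserving_flatTransfer hp h0 h1).pow _)
    (preserving_plateauOperator hp h0 h1 ht)
    (one_le_pow_coord (preserving_flatTransfer hp h0 h1) (flatTransfer_zero_zero h0 h1).ge _)
    (one_le_plateauOperator hp h0 h1 ht)

theorem PosAtZero.apply_flatTransfer {p s : ℝ} (hp : 0 < p) (h0 : 0 < s) (h1 : s < 1) {f : SeqSpace}
    (hf : PosAtZero f) : StrictlyPos (flatTransfer p s f) := fun n => by
  refine lt_of_lt_of_le ?_ ((preserving_flatTransfer hp h0.le h1).mul_le hf.1 n 0)
  rw [flatTransfer_coord h0.le h1]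
  have := pinWeight_pos hp n
  have := pinWeight_pos hp 0
  have := hf.2
  positivity

theorem StrictlyPos.apply_flatTransfer_pow {p s : ℝ} (hp : 0 < p) (h0 : 0 < s) (h1 : s < 1)
    {f : SeqSpace} (hf : StrictlyPos f) (n : ℕ) : StrictlyPos ((flatTransfer p s ^ n) f) := by
  induction n with
  | zero => exact hf
  | succ n ih => rw [pow_succ']; exact ih.posAtZero.apply_flatTransfer hp h0 h1

theorem StrictlyPos.apply_stepOp {b : ℕ} {p t : ℝ} (hp : 0 < p) (ht : 0 < t) {f : SeqSpace}
    (hf : StrictlyPos f) : StrictlyPos (stepOp b p t f) := fun n => by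
  rw [stepOp_apply]
  have := hf 0
  have := hf (n - b)
  split_ifs <;> positivity

theorem StrictlyPos.apply_adjoint_stepOp {b : ℕ} {p t : ℝ} (hp : 0 < p) (ht : 0 < t) {f : SeqSpace}
    (hf : StrictlyPos f) : StrictlyPos (adjoint (stepOp b p t) f) := fun n => by
  have hY := preserving_stepOp (b := b) hp ht
  have key : ∃ m, 0 < (stepOp b p t (basisVec n)) m := by
    rcases Nat.eq_zero_or_pos n with rfl | hn
    · exact ⟨0, by rw [stepOp_zero_zero]; exact one_pos⟩
    · refine ⟨n + b, ?_⟩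
      rw [stepOp_apply, if_neg (by omega), if_neg (by omega), basisVec_apply, if_pos (by omega)]
      positivity
  obtain ⟨m, hm⟩ := key
  rw [adjoint_apply_coord]
  exact (mul_pos hm (hf m)).trans_le (le_hasSum (hasSum_inner_coord _ f) m fun j _ =>
    mul_nonneg (hY _ (basisVec_nonneg n) j) (hf j).le)

theorem PosAtZero.apply_plateauOperator {b m : ℕ} {p s t : ℝ} (hp : 0 < p) (h0 : 0 < s) (h1 : s < 1)
    (ht : 0 < t) {f : SeqSpace} (hf : PosAtZero f) :
    StrictlyPos (plateauOperator b m p s t f) := by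
  have hY := preserving_stepOp (b := b) hp ht
  refine StrictlyPos.apply_stepOp hp ht ?_
  rw [pow_succ]
  refine StrictlyPos.apply_flatTransfer_pow hp h0 h1 (PosAtZero.apply_flatTransfer hp h0 h1 ?_) m
  exact hY.adjoint.posAtZero (by rw [adjoint_stepOp_zero_zero]; exact one_pos) hf

/-! ### Two-sided bounds of the growth rate -/

/-- The upper bound of the growth rate by the blocks belonging to `φ` and its complement: the term
without excursion, the plateau excess, the well excess, and both together. -/
theorem HasRate.le_log_period {a b c : ℕ} {p s t L μ lo hi : ℝ} {φ : SeqSpace}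
    (hp : 0 < p) (h0 : 0 < s) (h1 : s < 1) (ht : 0 < t)
    (hL : HasRate (periodOperator a b c p s t) L) (gap : SpectralGap (flatTransfer p s) φ μ lo hi)
    (hhi : 0 < hi) (hb : ‖stepVec b p t‖ ^ 2 ≤ t ^ (2 * b)) :
    L ≤ Real.log (μ ^ (c - 1) * μ ^ (a - c + 1) * ⟪φ, stepOp b p t φ⟫_ℝ ^ 2 +
      μ ^ (c - 1) * hi ^ (a - c + 1) * ‖perp φ (adjoint (stepOp b p t) φ)‖ ^ 2 +
      μ ^ (a - c + 1) * hi ^ (c - 1) * ‖perp φ (stepOp b p t φ)‖ ^ 2 +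
      t ^ (2 * b) * hi ^ (c - 1) * hi ^ (a - c + 1)) := by
  have gM := gap.pow (c - 1)
  have gN := gap.pow (a - c + 1)
  have hμ := gap.eigenvalue_nonneg
  refine HasRate.le_log_of_inner_le hL gM.pos (plateauOperator_isPositive h0.le h1)
    ((preserving_flatTransfer hp h0.le h1).pow _) (preserving_plateauOperator hp h0.le h1 ht)
    (one_le_periodOperator hp h0.le h1 ht) (one_le_plateauOperator hp h0.le h1 ht)
    (by positivity) fun f => ?_
  have hC : 0 ≤ t ^ (2 * b) := by positivity
  have key := SpectralGap.inner_coupled_le gM gN (norm_stepOp_sq_le hb) hC f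
  unfold plateauOperator
  convert key using 2

/-- The lower bound with the plateau excess: the period operator is regarded as `M K`, where `M` is the
power of the flat transfer operator over the well, and `φ` is the test vector. -/
theorem HasRate.log_le_of_lt_plateau {a b c : ℕ} {p s t L μ lo hi : ℝ} {φ : SeqSpace}
    (hp : 0 < p) (h0 : 0 < s) (h1 : s < 1) (ht : 0 < t)
    (hL : HasRate (periodOperator a b c p s t) L) (gap : SpectralGap (flatTransfer p s) φ μ lo hi)
    (hμ : 0 < μ) (hφ : ∀ n, 0 ≤ φ n) {σ : ℝ} (hσ : 0 < σ)
    (h : σ < μ ^ (c - 1) * μ ^ (a - c + 1) * ⟪φ, stepOp b p t φ⟫_ℝ ^ 2 +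
      μ ^ (c - 1) * lo ^ (a - c + 1) * ‖perp φ (adjoint (stepOp b p t) φ)‖ ^ 2) :
    Real.log σ ≤ L := by
  set M := flatTransfer p s ^ (c - 1) with hM
  set K := plateauOperator b (a - c) p s t with hK
  have pA := preserving_flatTransfer hp h0.le h1
  have pM : Preserving M := pA.pow _
  have pK : Preserving K := preserving_plateauOperator hp h0.le h1 ht
  have gM : SpectralGap M φ _ _ _ := gap.pow (c - 1)
  have gN := gap.pow (a - c + 1)
  have hM0 : PosAtZero (M (basisVec 0)) := pM.posAtZero
    (zero_lt_one.trans_le (one_le_pow_coord pA (flatTransfer_zero_zero h0.le h1).ge _))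
    posAtZero_basisVec
  have hKpos : K.IsPositive := plateauOperator_isPositive h0.le h1
  have m0 : 0 < moment K M φ 0 := by
    have : moment K M φ 0 = μ ^ (c - 1) := by
      simp [moment, gM.apply_eq, real_inner_smul_right, gM.norm_eq]
    rw [this]; positivity
  refine hL.log_le_of_moment gM.pos hKpos pM pK (x := K (M (basisVec 0))) (y := K (basisVec 0))
    (PosAtZero.apply_plateauOperator hp h0 h1 ht hM0)
    (PosAtZero.apply_plateauOperator hp h0 h1 ht posAtZero_basisVec) hφ 2 (fun n => ?_) hσ m0
    ((mul_lt_mul_of_pos_right h m0).trans_le (SpectralGap.le_moment_one gM gN))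
  have e : (M * K) ^ (n + 2) = M * K * (M * (K * M) ^ n) * K := by
    rw [← mul_pow_mul, pow_succ, pow_succ']
    simp only [mul_assoc]
  change (((M * K) ^ (n + 2)) (basisVec 0)) 0 = _
  rw [e, ← inner_basisVec]
  change ⟪basisVec 0, M (K (M (((K * M) ^ n) (K (basisVec 0)))))⟫_ℝ = _
  rw [← gM.pos.inner_left_eq_inner_right, ← hKpos.inner_left_eq_inner_right]

theorem inner_chain {H : Type*} [NormedAddCommGroup H] [InnerProductSpace ℝ H] [CompleteSpace H]
    {M N : H →L[ℝ] H} (hM : M.IsPositive) (hN : N.IsPositive) (Y Q : H →L[ℝ] H) (f g : H) :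
    ⟪f, (M * Y * N * adjoint Y * (M * Y * N * Q) * adjoint Y * (M * Y * N * adjoint Y)) g⟫_ℝ =
      ⟪adjoint Y (M (Y (N (adjoint Y (M f))))),
        N (Q (adjoint Y (M (Y (N (adjoint Y g))))))⟫_ℝ := by
  change ⟪f, M (Y (N (adjoint Y (M (Y (N (Q (adjoint Y (M (Y (N (adjoint Y g))))))))))))⟫_ℝ = _
  rw [← hM.inner_left_eq_inner_right, ← adjoint_inner_left Y,
    ← hN.inner_left_eq_inner_right, adjoint_inner_right, ← hM.inner_left_eq_inner_right,
    ← adjoint_inner_left Y]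

/-- The lower bound with the well excess: after a cyclic permutation the period operator is the product
of the operator `Y† M Y` of the well and its two steps and the power `N` of the flat transfer operator
over the plateau, and `φ` is again the test vector. -/
theorem HasRate.log_le_of_lt_well {a b c : ℕ} {p s t L μ lo hi : ℝ} {φ : SeqSpace}
    (hp : 0 < p) (h0 : 0 < s) (h1 : s < 1) (ht : 0 < t)
    (hL : HasRate (periodOperator a b c p s t) L) (gap : SpectralGap (flatTransfer p s) φ μ lo hi)
    (hμ : 0 < μ) (hφ : ∀ n, 0 ≤ φ n) {σ : ℝ} (hσ : 0 < σ)
    (h : σ < μ ^ (c - 1) * μ ^ (a - c + 1) * ⟪φ, stepOp b p t φ⟫_ℝ ^ 2 +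
      μ ^ (a - c + 1) * lo ^ (c - 1) * ‖perp φ (stepOp b p t φ)‖ ^ 2) :
    Real.log σ ≤ L := by
  set M := flatTransfer p s ^ (c - 1) with hM
  set N := flatTransfer p s ^ (a - c + 1) with hN
  set Y := stepOp b p t with hY
  have pA := preserving_flatTransfer hp h0.le h1
  have pY : Preserving Y := preserving_stepOp hp ht
  have gM : SpectralGap M φ _ _ _ := gap.pow (c - 1)
  have gN : SpectralGap N φ _ _ _ := gap.pow (a - c + 1)
  have spN : ∀ f, PosAtZero f → StrictlyPos (N f) := fun f hf => by
    rw [hN, pow_succ]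
    exact StrictlyPos.apply_flatTransfer_pow hp h0 h1 (hf.apply_flatTransfer hp h0 h1) _
  have spB : ∀ f, StrictlyPos f → StrictlyPos (adjoint Y (M (Y f))) := fun f hf =>
    ((hf.apply_stepOp hp ht).apply_flatTransfer_pow hp h0 h1 _).apply_adjoint_stepOp hp ht
  have hY0 : ∀ f, PosAtZero f → PosAtZero (adjoint Y f) := fun f hf =>
    pY.adjoint.posAtZero (by rw [adjoint_stepOp_zero_zero]; exact one_pos) hf
  have hM0 : PosAtZero (M (basisVec 0)) := (pA.pow _).posAtZero
    (zero_lt_one.trans_le (one_le_pow_coord pA (flatTransfer_zero_zero h0.le h1).ge _))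
    posAtZero_basisVec
  have hB : (adjoint Y * M * Y).IsPositive := gM.pos.adjoint_conj Y
  have m0 : 0 < moment (adjoint Y * M * Y) N φ 0 := by
    have : moment (adjoint Y * M * Y) N φ 0 = μ ^ (a - c + 1) := by
      simp [moment, gN.apply_eq, real_inner_smul_right, gN.norm_eq]
    rw [this]; positivity
  have key := SpectralGap.le_moment_one (Y := adjoint Y) gN gM
  rw [adjoint_adjoint, adjoint_inner_right, real_inner_comm] at key
  refine hL.log_le_of_moment gN.pos hB (pA.pow _) ((pY.adjoint.mul (pA.pow _)).mul pY)
    (x := adjoint Y (M (Y (N (adjoint Y (M (basisVec 0)))))))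
    (y := adjoint Y (M (Y (N (adjoint Y (basisVec 0))))))
    (spB _ (spN _ (hY0 _ hM0))) (spB _ (spN _ (hY0 _ posAtZero_basisVec))) hφ 3 (fun n => ?_) hσ m0
    (((mul_lt_mul_of_pos_right h m0).trans_le (le_of_eq (by ring))).trans_le key)
  have e0 : periodOperator a b c p s t = (M * Y * N) * adjoint Y := by
    rw [periodOperator, plateauOperator]; simp only [mul_assoc]; rfl
  have e : (periodOperator a b c p s t) ^ (n + 3) =
      M * Y * N * adjoint Y * (M * Y * N * (adjoint Y * (M * Y * N)) ^ n) * adjoint Y *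
        (M * Y * N * adjoint Y) := by
    rw [e0, ← mul_pow_mul, pow_succ, pow_succ, pow_succ']
    simp only [mul_assoc]
  have e1 : adjoint Y * M * Y * N = adjoint Y * (M * Y * N) := by simp only [mul_assoc]
  rw [e, ← inner_basisVec, e1]
  convert inner_chain gM.pos gN.pos Y ((adjoint Y * (M * Y * N)) ^ n) (basisVec 0) (basisVec 0)
    using 2

/-! ### The ground state and the step of the wall -/

theorem stepOp_basisVec_succ (b : ℕ) (p t : ℝ) (n : ℕ) :
    stepOp b p t (basisVec (n + 1)) = t ^ b • basisVec (n + 1 + b) := by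
  ext m
  rw [stepOp_apply, lp.coeFn_smul, Pi.smul_apply, basisVec_apply, basisVec_apply, basisVec_apply,
    smul_eq_mul, if_neg (by omega : ¬(0 = n + 1)), mul_zero]
  rcases Nat.eq_zero_or_pos m with rfl | hm
  · rw [if_pos rfl, if_neg (by omega), mul_zero]
  · rcases le_or_gt m b with hb | hb
    · rw [if_neg hm.ne', if_pos hb, if_neg (by omega), mul_zero]
    · rw [if_neg hm.ne', if_neg (not_le.2 hb)]
      congr 1
      exact if_congr (by omega) rfl rfl

/-- The adjoint of the step operator maps the bound state into the span of `basisVec 0` and the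
bound state itself. -/
theorem adjoint_stepOp_boundState {b : ℕ} {p t z : ℝ} (h0 : 0 ≤ z) (h1 : z < 1) :
    adjoint (stepOp b p t) (boundState p z) =
      (⟪stepVec b p t, boundState p z⟫_ℝ - (t * z) ^ b) • basisVec 0 +
        (t * z) ^ b • boundState p z := by
  ext n
  rw [adjoint_apply_coord, lp.coeFn_add, lp.coeFn_smul, lp.coeFn_smul, Pi.add_apply, Pi.smul_apply,
    Pi.smul_apply, basisVec_apply, smul_eq_mul, smul_eq_mul, boundState_apply h0 h1]
  cases n with
  | zero =>
    have : stepOp b p t (basisVec 0) = stepVec b p t := by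
      rw [stepOp_eq, adjoint_shift_basisVec_zero, basisVec_apply]; simp
    rw [this]; simp
  | succ n =>
    rw [stepOp_basisVec_succ, real_inner_smul_left, inner_basisVec, boundState_apply h0 h1,
      if_neg (by omega), if_neg (by omega), if_neg (by omega)]
    ring

theorem inner_stepVec_boundState {b : ℕ} {p t z : ℝ} (h0 : 0 ≤ z) (h1 : z < 1) :
    ⟪stepVec b p t, boundState p z⟫_ℝ = 1 + p ^ 2 * ∑ n ∈ Finset.Icc 1 b, (t * z) ^ n := by
  rw [stepVec, inner_add_left, sum_inner, inner_basisVec, boundState_apply h0 h1, Finset.mul_sum]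
  simp only [real_inner_smul_left, inner_basisVec, boundState_apply h0 h1]
  congr 1
  · simp
  · refine Finset.sum_congr rfl fun n hn => ?_
    rw [Finset.mem_Icc] at hn
    rw [if_neg (by omega)]
    ring

theorem norm_perp_sq {H : Type*} [NormedAddCommGroup H] [InnerProductSpace ℝ H] {φ : H}
    (hφ : ‖φ‖ = 1) (f : H) : ‖perp φ f‖ ^ 2 = ‖f‖ ^ 2 - ⟪φ, f⟫_ℝ ^ 2 := by
  rw [perp, norm_sub_sq_real, norm_smul, real_inner_smul_right, hφ, mul_one, Real.norm_eq_abs,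
    sq_abs, real_inner_comm]
  ring

theorem perp_smul_add_smul {H : Type*} [NormedAddCommGroup H] [InnerProductSpace ℝ H] {φ : H}
    (hφ : ‖φ‖ = 1) (f : H) (x y : ℝ) : perp φ (x • f + y • φ) = x • perp φ f := by
  have : ⟪φ, φ⟫_ℝ = 1 := by rw [real_inner_self_eq_norm_sq, hφ]; norm_num
  rw [perp, perp, inner_add_right, real_inner_smul_right, real_inner_smul_right, this]
  module

theorem norm_perp_adjoint_stepOp {b : ℕ} {p t z : ℝ} (h0 : 0 ≤ z) (h1 : z < 1)
    (hφ : ‖groundState p z‖ = 1) (hψ : 0 < ‖boundState p z‖) :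
    ‖perp (groundState p z) (adjoint (stepOp b p t) (groundState p z))‖ ^ 2 =
      (1 + p ^ 2 * ∑ n ∈ Finset.Icc 1 b, (t * z) ^ n - (t * z) ^ b) ^ 2 *
        (‖boundState p z‖ ^ 2 - 1) / (‖boundState p z‖ ^ 2) ^ 2 := by
  have e : adjoint (stepOp b p t) (groundState p z) =
      (‖boundState p z‖⁻¹ * (⟪stepVec b p t, boundState p z⟫_ℝ - (t * z) ^ b)) • basisVec 0 +
        (t * z) ^ b • groundState p z := by
    rw [groundState, map_smul, adjoint_stepOp_boundState h0 h1]
    module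
  have e2 : ⟪groundState p z, basisVec 0⟫_ℝ = ‖boundState p z‖⁻¹ := by
    rw [groundState, real_inner_smul_left, inner_basisVec_right, boundState_apply h0 h1]
    simp
  rw [e, perp_smul_add_smul hφ, norm_smul, mul_pow, Real.norm_eq_abs, sq_abs, norm_perp_sq hφ, e2,
    orthonormal_basisVec.1, inner_stepVec_boundState h0 h1]
  field_simp

/-- The upper bound comes from the distance of `Y φ` to `φ`, in which the parts at height `0` and above
it are estimated separately. -/
theorem norm_perp_stepOp_le {b : ℕ} {p t z μ lo hi : ℝ} {T : SeqSpace →L[ℝ] SeqSpace}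
    (ht : 1 ≤ t) (h0 : 0 ≤ z) (h1 : z < 1) (gap : SpectralGap T (groundState p z) μ lo hi)
    (hψ : 1 ≤ ‖boundState p z‖ ^ 2) :
    ‖perp (groundState p z) (stepOp b p t (groundState p z))‖ ^ 2 ≤
      2 * (‖stepVec b p t‖ ^ 2 - 1) + 8 * t ^ (2 * b) * (‖boundState p z‖ ^ 2 - 1) := by
  refine (gap.norm_perp_le_norm_sub _ 1).trans ?_
  set ψ := boundState p z with hψdef
  have hψ0 : ψ 0 = 1 := by rw [hψdef, boundState_apply h0 h1]; simp
  have e : stepOp b p t (groundState p z) - (1 : ℝ) • groundState p z =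
      ‖ψ‖⁻¹ • (stepOp b p t ψ - ψ) := by
    rw [groundState, map_smul]; module
  set k := adjoint shift ψ with hk
  have hk2 : ‖k‖ ^ 2 = ‖ψ‖ ^ 2 - 1 := by
    have := norm_sq_eq_add ψ
    rw [hψ0] at this; linarith
  have e2 : stepOp b p t ψ - ψ =
      (stepVec b p t - basisVec 0) + (t ^ b • (shift ^ (b + 1)) k - shift k) := by
    conv_lhs => enter [2]; rw [eq_basisVec_add_shift ψ]
    rw [stepOp_eq, hψ0]
    module
  have n1 : ‖stepVec b p t - basisVec 0‖ ^ 2 = ‖stepVec b p t‖ ^ 2 - 1 := by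
    rw [norm_sub_sq_real, inner_basisVec_right, orthonormal_basisVec.1, stepVec_apply]
    simp; ring
  have tb : 1 ≤ t ^ b := one_le_pow₀ ht
  have n2 : ‖t ^ b • (shift ^ (b + 1)) k - shift k‖ ≤ 2 * t ^ b * ‖k‖ := by
    refine (norm_sub_le _ _).trans ?_
    rw [norm_smul, norm_shift_pow, norm_shift, Real.norm_of_nonneg (by positivity)]
    nlinarith [norm_nonneg k]
  have n3 : ‖t ^ b • (shift ^ (b + 1)) k - shift k‖ ^ 2 ≤ 4 * t ^ (2 * b) * (‖ψ‖ ^ 2 - 1) := by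
    rw [← hk2]
    calc _ ≤ (2 * t ^ b * ‖k‖) ^ 2 := pow_le_pow_left₀ (norm_nonneg _) n2 2
      _ = _ := by ring
  have n4 : ‖stepOp b p t ψ - ψ‖ ^ 2 ≤ 2 * (‖stepVec b p t‖ ^ 2 - 1) +
      8 * t ^ (2 * b) * (‖ψ‖ ^ 2 - 1) := by
    rw [e2]
    have := norm_add_le (stepVec b p t - basisVec 0) (t ^ b • (shift ^ (b + 1)) k - shift k)
    calc _ ≤ (‖stepVec b p t - basisVec 0‖ + ‖t ^ b • (shift ^ (b + 1)) k - shift k‖) ^ 2 :=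
          pow_le_pow_left₀ (norm_nonneg _) this 2
      _ ≤ 2 * ‖stepVec b p t - basisVec 0‖ ^ 2 +
          2 * ‖t ^ b • (shift ^ (b + 1)) k - shift k‖ ^ 2 := by
        nlinarith [sq_nonneg (‖stepVec b p t - basisVec 0‖ -
          ‖t ^ b • (shift ^ (b + 1)) k - shift k‖)]
      _ ≤ _ := by rw [n1]; linarith
  rw [e, norm_smul, mul_pow, norm_inv, norm_norm, inv_pow]
  refine le_trans ?_ n4
  exact mul_le_of_le_one_left (sq_nonneg _) (inv_le_one_of_one_le₀ hψ)

/-- The lower bound comes from the component along a vector orthogonal to the bound state that is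
supported on the heights `0` and `b`. -/
theorem le_norm_perp_stepOp {b : ℕ} (hb : 1 ≤ b) {p t z : ℝ} (h0 : 0 ≤ z) (h1 : z < 1)
    (hψ : 0 < ‖boundState p z‖) :
    p ^ 2 * (t ^ b - z ^ b) ^ 2 ≤ (1 + p ^ 2 * z ^ (2 * b)) * ‖boundState p z‖ ^ 2 *
      ‖perp (groundState p z) (stepOp b p t (groundState p z))‖ ^ 2 := by
  set ψ := boundState p z with hψdef
  set φ := groundState p z with hφ
  have hb' : b ≠ 0 := by omega
  have hψ0 : ψ 0 = 1 := by rw [hψdef, boundState_apply h0 h1]; simp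
  have hψb : ψ b = p * z ^ b := by rw [hψdef, boundState_apply h0 h1, if_neg hb']
  have hφψ : φ = ‖ψ‖⁻¹ • ψ := rfl
  set ξ := basisVec b - (p * z ^ b) • basisVec 0 with hξ
  have i1 : ∀ f : SeqSpace, ⟪f, ξ⟫_ℝ = f b - p * z ^ b * f 0 := fun f => by
    rw [hξ, inner_sub_right, real_inner_smul_right, inner_basisVec_right, inner_basisVec_right]
  have i2 : ⟪φ, ξ⟫_ℝ = 0 := by
    rw [hφψ, real_inner_smul_left, i1, hψ0, hψb]; ring
  have i3 : ‖ξ‖ ^ 2 = 1 + p ^ 2 * z ^ (2 * b) := by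
    rw [← real_inner_self_eq_norm_sq, i1, ← inner_basisVec, ← inner_basisVec 0, i1, i1,
      basisVec_apply, basisVec_apply, basisVec_apply, basisVec_apply, if_pos rfl, if_neg hb'.symm,
      if_neg hb', if_pos rfl]
    ring
  have i4 : ⟪perp φ (stepOp b p t φ), ξ⟫_ℝ = ‖ψ‖⁻¹ * (p * (t ^ b - z ^ b)) := by
    rw [perp, inner_sub_left, real_inner_smul_left, i2, hφψ, map_smul, real_inner_smul_left, i1,
      stepOp_apply, stepOp_apply, if_neg hb', if_pos le_rfl, if_pos rfl, hψ0]
    ring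
  have cs := abs_real_inner_le_norm (perp φ (stepOp b p t φ)) ξ
  have cs2 : ⟪perp φ (stepOp b p t φ), ξ⟫_ℝ ^ 2 ≤
      ‖perp φ (stepOp b p t φ)‖ ^ 2 * ‖ξ‖ ^ 2 := by
    rw [← sq_abs, ← mul_pow]
    exact pow_le_pow_left₀ (abs_nonneg _) cs 2
  rw [i3, i4, mul_pow, inv_pow, inv_mul_le_iff₀ (by positivity)] at cs2
  calc _ = (p * (t ^ b - z ^ b)) ^ 2 := by ring
    _ ≤ _ := cs2
    _ = _ := by ring

/-! ### Low temperatures -/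

/-- The smallness conditions on `p = exp (-β (J - J') / 2)`, `u = exp (-β J')` and
`s = exp (-β J)`. -/
structure SmallWeights (p s u : ℝ) : Prop where
  p_pos : 0 < p
  u_pos : 0 < u
  s_eq : s = u * p ^ 2
  p_sq_le : p ^ 2 ≤ 1 / 100
  u_le : u ≤ 1 / 100

theorem sum_pow_le_two_mul {T : ℝ} (hT : 2 ≤ T) (b : ℕ) :
    ∑ n ∈ Finset.Icc 1 b, T ^ n ≤ 2 * T ^ b - 2 := by
  induction b with
  | zero => simp
  | succ b ih =>
    rw [Finset.sum_Icc_succ_top (by omega), pow_succ]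
    have : 0 ≤ T ^ b := by positivity
    nlinarith

theorem sum_pow_le_one {r : ℝ} (h0 : 0 ≤ r) (hr : r ≤ 1 / 2) (b : ℕ) :
    ∑ n ∈ Finset.Icc 1 b, r ^ n ≤ 1 - r ^ b := by
  induction b with
  | zero => simp
  | succ b ih =>
    rw [Finset.sum_Icc_succ_top (by omega), pow_succ]
    have : 0 ≤ r ^ b := by positivity
    nlinarith

namespace SmallWeights

variable {p s u : ℝ}

theorem p_sq_pos (h : SmallWeights p s u) : 0 < p ^ 2 := pow_pos h.p_pos 2

theorem s_pos (h : SmallWeights p s u) : 0 < s := by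
  rw [h.s_eq]; exact mul_pos h.u_pos h.p_sq_pos

theorem s_le (h : SmallWeights p s u) : s ≤ 1 / 10000 := by
  rw [h.s_eq]; nlinarith [h.p_sq_pos, h.u_pos, h.p_sq_le, h.u_le]

theorem p_le_one (h : SmallWeights p s u) : p ≤ 1 := by nlinarith [h.p_sq_le, h.p_pos]

/-- The equation that `z = s / (1 - p ^ 2)` has to satisfy as the ratio of the bound state. -/
theorem decay_mul (h : SmallWeights p s u) : s / (1 - p ^ 2) * (1 - p ^ 2) = s :=
  div_mul_cancel₀ _ (by linarith [h.p_sq_le])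

theorem le_decay (h : SmallWeights p s u) : s ≤ s / (1 - p ^ 2) :=
  le_div_self h.s_pos.le (by linarith [h.p_sq_le]) (by linarith [h.p_sq_pos])

theorem decay_le (h : SmallWeights p s u) : s / (1 - p ^ 2) ≤ 1.02 * s := by
  rw [div_le_iff₀ (by linarith [h.p_sq_le])]
  nlinarith [h.p_sq_le, h.s_pos]

theorem decay_lt_one (h : SmallWeights p s u) : s / (1 - p ^ 2) < 1 := by
  linarith [h.decay_le, h.s_le]

theorem gap_le_one (h : SmallWeights p s u) : p ^ 2 * ((1 + s) / (1 - s)) ≤ 1 := by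
  have := h.s_le
  rw [mul_div_assoc', div_le_iff₀ (by linarith)]
  nlinarith [h.p_sq_le, h.s_pos, h.p_sq_pos]

theorem spectralGap (h : SmallWeights p s u) :
    SpectralGap (flatTransfer p s) (groundState p (s / (1 - p ^ 2)))
      ((1 - s ^ 2) / (1 - s * (s / (1 - p ^ 2)))) (p ^ 2 * ((1 - s) / (1 + s)))
      (p ^ 2 * ((1 + s) / (1 - s))) :=
  flatTransfer_spectralGap h.p_pos.le h.p_le_one h.s_pos.le (by linarith [h.s_le])
    (h.s_pos.le.trans h.le_decay) h.decay_lt_one h.decay_mul h.gap_le_one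

theorem one_le_eigenvalue (h : SmallWeights p s u) :
    1 ≤ (1 - s ^ 2) / (1 - s * (s / (1 - p ^ 2))) := by
  have := h.s_le
  have := h.s_pos
  have h1 := h.decay_lt_one
  have h2 := h.le_decay
  rw [le_div_iff₀ (by nlinarith)]
  nlinarith

theorem eigenvalue_le (h : SmallWeights p s u) :
    (1 - s ^ 2) / (1 - s * (s / (1 - p ^ 2))) ≤ (1 + s) / (1 - s) := by
  have := h.s_le
  have := h.s_pos
  have h1 := h.decay_lt_one
  have h2 := h.le_decay
  rw [div_le_div_iff₀ (by nlinarith) (by linarith)]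
  have h3 : (1 - s) * (1 - s) ≤ 1 - s * (s / (1 - p ^ 2)) := by nlinarith
  nlinarith

theorem groundState_nonneg (h : SmallWeights p s u) (n : ℕ) :
    0 ≤ groundState p (s / (1 - p ^ 2)) n := by
  have hz := h.s_pos.le.trans h.le_decay
  rw [groundState, lp.coeFn_smul, Pi.smul_apply, boundState_apply hz h.decay_lt_one, smul_eq_mul]
  have := h.p_pos
  split_ifs <;> positivity

theorem norm_boundState_sub (h : SmallWeights p s u) :
    p ^ 2 * s ^ 2 ≤ ‖boundState p (s / (1 - p ^ 2))‖ ^ 2 - 1 ∧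
      ‖boundState p (s / (1 - p ^ 2))‖ ^ 2 - 1 ≤ 1.1 * (p ^ 2 * s ^ 2) := by
  have hz := h.s_pos.le.trans h.le_decay
  have h1 := h.le_decay
  have h2 := h.decay_le
  have h3 := h.s_le
  have h4 := h.s_pos
  rw [norm_boundState_sq hz h.decay_lt_one]
  set z := s / (1 - p ^ 2)
  have hz2 : z ^ 2 ≤ 1 / 10000 := by nlinarith
  have e1 : z ^ 2 ≤ z ^ 2 / (1 - z ^ 2) := le_div_self (sq_nonneg z) (by linarith) (by nlinarith)
  have e2 : z ^ 2 / (1 - z ^ 2) ≤ 1.1 * s ^ 2 := by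
    rw [div_le_iff₀ (by linarith)]
    nlinarith [sq_nonneg s]
  have e3 : s ^ 2 ≤ z ^ 2 := by nlinarith
  have := h.p_sq_pos
  constructor <;> nlinarith

theorem norm_boundState_le (h : SmallWeights p s u) :
    ‖boundState p (s / (1 - p ^ 2))‖ ^ 2 ≤ 1.01 := by
  have := h.norm_boundState_sub.2
  have h1 : s ^ 2 ≤ 1 / 10000 := by nlinarith [h.s_le, h.s_pos]
  nlinarith [h.p_sq_le, h.p_sq_pos, sq_nonneg s]

theorem one_le_norm_boundState (h : SmallWeights p s u) :
    1 ≤ ‖boundState p (s / (1 - p ^ 2))‖ ^ 2 := by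
  have := h.norm_boundState_sub.1
  have : 0 ≤ p ^ 2 * s ^ 2 := by positivity
  linarith

theorem norm_boundState_pos (h : SmallWeights p s u) : 0 < ‖boundState p (s / (1 - p ^ 2))‖ :=
  (sq_pos_iff.1 (zero_lt_one.trans_le h.one_le_norm_boundState)).lt_of_le' (norm_nonneg _)

theorem le_inv (h : SmallWeights p s u) : 100 ≤ u⁻¹ := by
  rw [le_inv_comm₀ (by norm_num) h.u_pos]; linarith [h.u_le]

theorem inv_mul_decay (h : SmallWeights p s u) :
    0 ≤ u⁻¹ * (s / (1 - p ^ 2)) ∧ u⁻¹ * (s / (1 - p ^ 2)) ≤ 1 / 50 := by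
  have hu := h.u_pos
  have hz := h.s_pos.le.trans h.le_decay
  refine ⟨by positivity, ?_⟩
  rw [inv_mul_le_iff₀ hu]
  have h1 := h.decay_le
  have : s ≤ u * (1 / 100) := by rw [h.s_eq]; exact mul_le_mul_of_nonneg_left h.p_sq_le hu.le
  linarith

theorem norm_stepVec_le (h : SmallWeights p s u) {b : ℕ} (hb : 1 ≤ b) :
    ‖stepVec b p u⁻¹‖ ^ 2 - 1 ≤ 2 * (p ^ 2 * u⁻¹ ^ (2 * b)) ∧
      ‖stepVec b p u⁻¹‖ ^ 2 ≤ u⁻¹ ^ (2 * b) := by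
  have ht := h.le_inv
  have hT : 10000 ≤ u⁻¹ ^ 2 := by nlinarith
  have h1 := sum_pow_le_two_mul (by linarith : 2 ≤ u⁻¹ ^ 2) b
  have h2 : 10000 ≤ (u⁻¹ ^ 2) ^ b := hT.trans (le_self_pow₀ (by linarith) (by omega))
  rw [norm_stepVec_sq]
  simp only [pow_mul]
  have := h.p_sq_pos
  have := h.p_sq_le
  constructor <;> nlinarith

/-- Up to constants the well excess is `p ^ 2 u ^ (-2 b)`, apart from the powers of the flat transfer
operator. -/
theorem well_bounds (h : SmallWeights p s u) {b : ℕ} (hb : 1 ≤ b) :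
    1 / 2 * (p ^ 2 * u⁻¹ ^ (2 * b)) ≤
      ‖perp (groundState p (s / (1 - p ^ 2)))
        (stepOp b p u⁻¹ (groundState p (s / (1 - p ^ 2))))‖ ^ 2 ∧
    ‖perp (groundState p (s / (1 - p ^ 2)))
        (stepOp b p u⁻¹ (groundState p (s / (1 - p ^ 2))))‖ ^ 2 ≤
      5 * (p ^ 2 * u⁻¹ ^ (2 * b)) := by
  have hz := h.s_pos.le.trans h.le_decay
  have hz1 := h.decay_lt_one
  have ht := h.le_inv
  have h1 := norm_perp_stepOp_le (b := b) (p := p) (t := u⁻¹) (by linarith) hz hz1 h.spectralGap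
    h.one_le_norm_boundState
  have h2 := le_norm_perp_stepOp hb (p := p) (t := u⁻¹) hz hz1 h.norm_boundState_pos
  have h3 := h.norm_boundState_sub.2
  have h4 := (h.norm_stepVec_le hb).1
  have h5 := h.norm_boundState_le
  have h6 := h.decay_le
  have h7 := h.s_le
  have hP := h.p_sq_pos
  have hP1 := h.p_sq_le
  set z := s / (1 - p ^ 2)
  have htb : 1 ≤ u⁻¹ ^ b := one_le_pow₀ (by linarith)
  have hsq : u⁻¹ ^ (2 * b) = (u⁻¹ ^ b) ^ 2 := by ring
  have hzb : z ^ b ≤ 1 / 100 := (pow_le_of_le_one hz hz1.le (by omega)).trans (by linarith)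
  have hzb0 : 0 ≤ z ^ b := by positivity
  have hzb2 : z ^ (2 * b) ≤ 1 := pow_le_one₀ hz hz1.le
  set f2 := ‖perp (groundState p z) (stepOp b p u⁻¹ (groundState p z))‖ ^ 2
  have hf2 : 0 ≤ f2 := sq_nonneg _
  set ν := ‖boundState p z‖ ^ 2
  have hν : 0 ≤ ν := sq_nonneg _
  rw [hsq] at h1 h4 ⊢
  set τ := u⁻¹ ^ b
  constructor
  · have e1 : (0.99 * τ) ^ 2 ≤ (τ - z ^ b) ^ 2 := pow_le_pow_left₀ (by positivity) (by nlinarith) 2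
    have e2 : (1 + p ^ 2 * z ^ (2 * b)) * ν * f2 ≤ 1.03 * f2 := by
      refine mul_le_mul_of_nonneg_right ?_ hf2
      have : 1 + p ^ 2 * z ^ (2 * b) ≤ 1.01 := by nlinarith
      have h0 : 0 ≤ 1 + p ^ 2 * z ^ (2 * b) := by positivity
      nlinarith
    have e3 := mul_le_mul_of_nonneg_left e1 hP.le
    nlinarith [mul_nonneg hP.le (sq_nonneg τ)]
  · have e1 : ν - 1 ≤ 1 / 100 * p ^ 2 := by
      have : s ^ 2 ≤ 1 / 10000 := by nlinarith [h.s_pos]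
      nlinarith
    have e2 := mul_le_mul_of_nonneg_left e1 (by positivity : 0 ≤ 8 * τ ^ 2)
    nlinarith [mul_nonneg hP.le (sq_nonneg τ)]

/-- Up to constants the plateau excess is `p ^ 2 s ^ 2`, apart from the powers of the flat transfer
operator. -/
theorem plateau_bounds (h : SmallWeights p s u) {b : ℕ} (hb : 1 ≤ b) :
    1 / 2 * (p ^ 2 * s ^ 2) ≤
      ‖perp (groundState p (s / (1 - p ^ 2)))
        (adjoint (stepOp b p u⁻¹) (groundState p (s / (1 - p ^ 2))))‖ ^ 2 ∧
    ‖perp (groundState p (s / (1 - p ^ 2)))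
        (adjoint (stepOp b p u⁻¹) (groundState p (s / (1 - p ^ 2))))‖ ^ 2 ≤
      2 * (p ^ 2 * s ^ 2) := by
  have hz := h.s_pos.le.trans h.le_decay
  have hz1 := h.decay_lt_one
  rw [norm_perp_adjoint_stepOp hz hz1 h.spectralGap.norm_eq h.norm_boundState_pos]
  have h1 := h.norm_boundState_sub
  have h2 := h.norm_boundState_le
  have h3 := h.one_le_norm_boundState
  have hr := h.inv_mul_decay
  have hP := h.p_sq_pos
  have hP1 := h.p_sq_le
  have hs := h.s_pos
  set z := s / (1 - p ^ 2)
  set r := u⁻¹ * z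
  set ν := ‖boundState p z‖ ^ 2
  have hsum := sum_pow_le_one hr.1 (by linarith [hr.2]) b
  have hsum0 : 0 ≤ ∑ n ∈ Finset.Icc 1 b, r ^ n := Finset.sum_nonneg fun n _ => pow_nonneg hr.1 n
  have hrb : r ^ b ≤ 1 / 50 := (pow_le_of_le_one hr.1 (by linarith [hr.2]) (by omega)).trans hr.2
  have hrb0 : 0 ≤ r ^ b := pow_nonneg hr.1 b
  set γ := 1 + p ^ 2 * ∑ n ∈ Finset.Icc 1 b, r ^ n - r ^ b with hγ
  have g1 : 0.98 ≤ γ := by nlinarith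
  have g2 : γ ≤ 1.01 := by nlinarith
  have g3 : 0.96 ≤ γ ^ 2 := by nlinarith
  have g4 : γ ^ 2 ≤ 1.03 := by nlinarith
  have hX : 0 < p ^ 2 * s ^ 2 := by positivity
  set X := p ^ 2 * s ^ 2
  have hν2 : 0 < ν ^ 2 := by positivity
  have n1 : 1 ≤ ν ^ 2 := by nlinarith
  have n2 : ν ^ 2 ≤ 1.03 := by nlinarith
  constructor
  · rw [le_div_iff₀ hν2]
    nlinarith [mul_le_mul g3 h1.1 hX.le (sq_nonneg γ)]
  · rw [div_le_iff₀ hν2]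
    nlinarith [mul_le_mul g4 h1.2 (hX.le.trans h1.1) (by norm_num)]

end SmallWeights

/-! ### The wall tension in terms of the growth rate -/

/-- Up to a constant that does not depend on `c`, the difference of wall tensions is `-L / (β a)`,
where `L` is the growth rate of the transfer operator of a period. -/
theorem exists_rate_deltaTau {a b c : ℕ} (hc : 1 ≤ c) (hca : c < a) {β JAB JAW JBW p s u : ℝ}
    (hβ : 0 < β) (hp : 0 < p) (hs : s = Real.exp (-β * JAB)) (hs1 : s < 1)
    (hu : u = Real.exp (-β * (JAW - JBW))) (hpu : s = u * p ^ 2) :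
    (∀ N, Summable (weight β JAB JAW JBW (stepWall a b c) N)) ∧
    ∃ L, HasRate (periodOperator a b c p s u⁻¹) L ∧
      Tendsto (finiteTension β JAB JAW JBW a (stepWall a b c)) atTop
        (𝓝 (tauAW β JAB JAW JBW a (stepWall a b c))) ∧
      deltaTau β JAB JAW JBW a b c =
        -((a + 2 * b : ℕ) * Real.log (Real.exp (-β * JBW) * u)) / (β * a) -
          (1 + 2 * (b : ℝ) / (a : ℝ)) * JBW - L / (β * a) := by
  set k := Real.exp (-β * JBW) with hk
  have hk0 : 0 < k := Real.exp_pos _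
  have hu0 : 0 < u := by rw [hu]; exact Real.exp_pos _
  have hs0 : 0 < s := by rw [hs]; exact Real.exp_pos _
  have ht : 0 < u⁻¹ := inv_pos.2 hu0
  set w := stepWall a b c with hw
  set κ : ℕ → ℝ := fun i => (k * u) ^ columnLength (w i) (w (i + 1)) with hκ
  have hsum := hasSum_weight (β := β) (JAB := JAB) (JAW := JAW) (JBW := JBW) (w := w)
    (wallOperator a b c p s u⁻¹) κ (pinWeight p) (fun i => by positivity)
    (fun x => (pinWeight_pos hp x).le) (if_pos rfl) (preserving_wallOperator hp hs0.le hs1 ht)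
    (fun i x y => by
      rw [← hs, ← hu]
      exact columnWeight_stepWall hc hca hpu hs0.le hs1 (mul_inv_cancel₀ hu0.ne') i x y)
  refine ⟨fun N => (hsum N).summable, ?_⟩
  obtain ⟨L, hL⟩ := exists_hasRate (preserving_periodOperator (a := a) (b := b) (c := c) hp hs0.le
    hs1 ht) (one_le_periodOperator hp hs0.le hs1 ht)
  have ha : (0 : ℝ) < a := by exact_mod_cast (by omega : 0 < a)
  have hper : ∀ i, κ (i + a) = κ i := fun i => by
    have e : ∀ j, w (j + a) = w j := fun j => by
      rw [hw]; simp only [stepWall, Nat.add_mod_right]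
    simp only [hκ, e, add_right_comm i a 1]
  have hpart : ∀ n, partition β JAB JAW JBW w (n * a) =
      ((k * u) ^ (a + 2 * b)) ^ n * ((periodOperator a b c p s u⁻¹ ^ n) (basisVec 0)) 0 :=
    fun n => by
      rw [partition, (hsum (n * a)).tsum_eq, operatorProd_wallOperator hc hca, prod_period hper,
        Finset.prod_pow_eq_pow_sum, sum_columnLength_stepWall hc hca]
  have hlim : Tendsto (finiteTension β JAB JAW JBW a w) atTop
      (𝓝 (-((a + 2 * b : ℕ) * Real.log (k * u)) / (β * a) - L / (β * a))) := by
    have h1 : Tendsto (fun n : ℕ => -((a + 2 * b : ℕ) * Real.log (k * u)) / (β * a) -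
        Real.log (((periodOperator a b c p s u⁻¹ ^ n) (basisVec 0)) 0) / n / (β * a)) atTop
        (𝓝 (-((a + 2 * b : ℕ) * Real.log (k * u)) / (β * a) - L / (β * a))) :=
      tendsto_const_nhds.sub (Tendsto.div_const hL _)
    refine h1.congr' ?_
    filter_upwards [eventually_gt_atTop 0] with n hn
    have hn' : (0 : ℝ) < n := by exact_mod_cast hn
    have hpos : 0 < ((periodOperator a b c p s u⁻¹ ^ n) (basisVec 0)) 0 :=
      zero_lt_one.trans_le (one_le_pow_coord (preserving_periodOperator hp hs0.le hs1 ht)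
        (one_le_periodOperator hp hs0.le hs1 ht) n)
    rw [finiteTension, hpart n, Real.log_mul (by positivity) hpos.ne', Real.log_pow, Real.log_pow]
    push_cast
    field_simp
    ring
  have htau : tauAW β JAB JAW JBW a w =
      -((a + 2 * b : ℕ) * Real.log (k * u)) / (β * a) - L / (β * a) := hlim.limUnder_eq
  refine ⟨L, hL, by rw [htau]; exact hlim, ?_⟩
  rw [deltaTau, ← hw, htau, tauBW, hw, roughness_stepWall hc hca]
  ring

/-! ### Comparison of the growth rates -/

theorem kernel_ratio_pow_le {s : ℝ} (h0 : 0 ≤ s) (h1 : s < 1) {a : ℕ} (ha : a * s ≤ 1 / 100) :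
    ((1 + s) / (1 - s)) ^ a * ((1 + s) / (1 - s)) ^ a ≤ 2 := by
  have h2 : 0 < 1 - s := by linarith
  have h3 : (1 + s) / (1 - s) ≤ ((1 - s) ^ 2)⁻¹ := by
    rw [div_le_iff₀ h2, inv_mul_eq_div, le_div_iff₀ (by positivity)]
    nlinarith [mul_nonneg h0 h0, mul_nonneg (mul_nonneg h0 h0) h0]
  have h4 : 1 - 4 * (a * s) ≤ (1 - s) ^ (4 * a) := by
    have := one_add_mul_le_pow (by linarith : -2 ≤ -s) (4 * a)
    push_cast at this
    calc _ = 1 + 4 * (a : ℝ) * -s := by ring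
      _ ≤ _ := this
      _ = _ := by rw [← sub_eq_add_neg]
  rw [← pow_add]
  calc _ ≤ (((1 - s) ^ 2)⁻¹) ^ (a + a) := pow_le_pow_left₀ (by positivity) h3 _
    _ = ((1 - s) ^ (4 * a))⁻¹ := by rw [inv_pow, ← pow_mul]; congr 2; ring
    _ ≤ 2 := by rw [inv_le_comm₀ (by positivity) (by norm_num)]; linarith

/-- With `i + j = a`, the products of `i` and `j` factors are compared with powers of `P`, up to the
common factor `d ^ a`. -/
theorem pow_mul_pow_bounds {Λ P d : ℝ} (hP : 0 < P) (h1 : 1 ≤ Λ) (h2 : Λ ≤ d) (i j : ℕ) :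
    Λ ^ i * (P * d) ^ j ≤ d ^ (i + j) * P ^ j ∧ P ^ j ≤ d ^ (i + j) * (Λ ^ i * (P * d⁻¹) ^ j) := by
  have hd : 1 ≤ d := h1.trans h2
  have hd0 : 0 < d := by linarith
  constructor
  · rw [mul_pow, pow_add]
    calc Λ ^ i * (P ^ j * d ^ j) ≤ d ^ i * (P ^ j * d ^ j) := by gcongr
      _ = _ := by ring
  · rw [mul_pow, pow_add, inv_pow]
    have e1 : d ^ i * d ^ j * (Λ ^ i * (P ^ j * (d ^ j)⁻¹)) = d ^ i * Λ ^ i * P ^ j := by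
      field_simp
    rw [e1]
    have e2 : 1 ≤ d ^ i * Λ ^ i := one_le_mul_of_one_le_of_one_le (one_le_pow₀ hd) (one_le_pow₀ h1)
    have := pow_pos hP j
    nlinarith

/-- The comparison of two growth rates: one of the excess terms for `c` exceeds twice the sum of all
excess terms for `c'`. The factor `2` absorbs the `a`-th powers of `(1 + s) / (1 - s)`. -/
theorem SmallWeights.rate_lt {a b c c' : ℕ} {p s u L L' R : ℝ} (h : SmallWeights p s u)
    (hb : 1 ≤ b) (hc : 1 ≤ c) (hca : c < a) (hc' : 1 ≤ c') (hca' : c' < a)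
    (ha : a * s ≤ 1 / 100) (hR : 0 < R)
    (hL : HasRate (periodOperator a b c p s u⁻¹) L)
    (hL' : HasRate (periodOperator a b c' p s u⁻¹) L')
    (hlow : R ≤ 1 / 2 * (p ^ 2) ^ (c - 1) * (p ^ 2 * u⁻¹ ^ (2 * b)) ∨
      R ≤ 1 / 2 * (p ^ 2) ^ (a - c + 1) * (p ^ 2 * s ^ 2))
    (hup : 2 * (2 * (p ^ 2) ^ (a - c' + 1) * (p ^ 2 * s ^ 2) +
      5 * (p ^ 2) ^ (c' - 1) * (p ^ 2 * u⁻¹ ^ (2 * b)) + (p ^ 2) ^ a * u⁻¹ ^ (2 * b)) < R) :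
    L' < L := by
  have hs0 := h.s_pos
  have hs1 : s < 1 := by linarith [h.s_le]
  have ht : 0 < u⁻¹ := inv_pos.2 h.u_pos
  have hP := h.p_sq_pos
  have gap := h.spectralGap
  have hΛ1 := h.one_le_eigenvalue
  have hΛ2 := h.eigenvalue_le
  have hD := kernel_ratio_pow_le hs0.le hs1 ha
  have hhi : 0 < p ^ 2 * ((1 + s) / (1 - s)) := by
    have : 0 < 1 - s := by linarith
    positivity
  have up := HasRate.le_log_period h.p_pos hs0 hs1 ht hL' gap hhi (h.norm_stepVec_le hb).2
  have lowF := fun σ => HasRate.log_le_of_lt_well (σ := σ) h.p_pos hs0 hs1 ht hL gap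
    (by linarith) h.groundState_nonneg
  have lowG := fun σ => HasRate.log_le_of_lt_plateau (σ := σ) h.p_pos hs0 hs1 ht hL gap
    (by linarith) h.groundState_nonneg
  have bF := h.well_bounds hb
  have bG := h.plateau_bounds hb
  have einv : (1 - s) / (1 + s) = ((1 + s) / (1 - s))⁻¹ := (inv_div _ _).symm
  rw [einv] at lowF lowG
  set Λ := (1 - s ^ 2) / (1 - s * (s / (1 - p ^ 2)))
  set d := (1 + s) / (1 - s)
  set f2 := ‖perp (groundState p (s / (1 - p ^ 2)))
        (stepOp b p u⁻¹ (groundState p (s / (1 - p ^ 2))))‖ ^ 2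
  set g2 := ‖perp (groundState p (s / (1 - p ^ 2)))
        (adjoint (stepOp b p u⁻¹) (groundState p (s / (1 - p ^ 2))))‖ ^ 2
  set y := inner ℝ (groundState p (s / (1 - p ^ 2)))
        (stepOp b p u⁻¹ (groundState p (s / (1 - p ^ 2))))
  set P := p ^ 2
  set W := P * u⁻¹ ^ (2 * b)
  set V := P * s ^ 2
  have hW : 0 < W := by positivity
  have hV : 0 < V := by positivity
  have hd1 : 1 ≤ d ^ a := one_le_pow₀ (hΛ1.trans hΛ2)
  have hΛ0 : 0 < Λ := by linarith
  have main : ∀ e, 1 ≤ e → e < a → Λ ^ (e - 1) * Λ ^ (a - e + 1) = Λ ^ a := fun e h1 h2 => by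
    rw [← pow_add]; congr 1; omega
  rw [main c' hc' hca'] at up
  rw [main c hc hca] at lowF lowG
  -- The upper bound for `c'`.
  have e1 : c' - 1 + (a - c' + 1) = a := by omega
  have u1 := (pow_mul_pow_bounds hP hΛ1 hΛ2 (c' - 1) (a - c' + 1)).1
  have u2 := (pow_mul_pow_bounds hP hΛ1 hΛ2 (a - c' + 1) (c' - 1)).1
  rw [e1] at u1
  rw [add_comm (a - c' + 1), e1] at u2
  have u3 : u⁻¹ ^ (2 * b) * (P * d) ^ (c' - 1) * (P * d) ^ (a - c' + 1) =
      d ^ a * (P ^ a * u⁻¹ ^ (2 * b)) := by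
    rw [mul_assoc, ← pow_add, e1, mul_pow]; ring
  rw [u3] at up
  have U : Λ ^ (c' - 1) * (P * d) ^ (a - c' + 1) * g2 + Λ ^ (a - c' + 1) * (P * d) ^ (c' - 1) * f2 +
      d ^ a * (P ^ a * u⁻¹ ^ (2 * b)) ≤ d ^ a * (2 * P ^ (a - c' + 1) * V +
      5 * P ^ (c' - 1) * W + P ^ a * u⁻¹ ^ (2 * b)) := by
    have k1 : Λ ^ (c' - 1) * (P * d) ^ (a - c' + 1) * g2 ≤
        d ^ a * P ^ (a - c' + 1) * (2 * V) :=
      mul_le_mul u1 bG.2 (sq_nonneg _) (by positivity)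
    have k2 : Λ ^ (a - c' + 1) * (P * d) ^ (c' - 1) * f2 ≤ d ^ a * P ^ (c' - 1) * (5 * W) :=
      mul_le_mul u2 bF.2 (sq_nonneg _) (by positivity)
    linarith
  -- The lower bound for `c`.
  have e2 : c - 1 + (a - c + 1) = a := by omega
  have low : ∀ σ, 0 < σ → d ^ a * σ < d ^ a * (Λ ^ a * y ^ 2) + R → Real.log σ ≤ L := by
    intro σ hσ hlt
    rcases hlow with hl | hl
    · refine lowF σ hσ ?_
      have l1 := (pow_mul_pow_bounds hP hΛ1 hΛ2 (a - c + 1) (c - 1)).2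
      rw [add_comm (a - c + 1), e2] at l1
      have l2 : P ^ (c - 1) * (1 / 2 * W) ≤
          d ^ a * (Λ ^ (a - c + 1) * (P * d⁻¹) ^ (c - 1)) * f2 :=
        mul_le_mul l1 bF.1 (by positivity) (by positivity)
      refine lt_of_mul_lt_mul_left ?_ (by positivity : 0 ≤ d ^ a)
      linarith
    · refine lowG σ hσ ?_
      have l1 := (pow_mul_pow_bounds hP hΛ1 hΛ2 (c - 1) (a - c + 1)).2
      rw [e2] at l1
      have l2 : P ^ (a - c + 1) * (1 / 2 * V) ≤
          d ^ a * (Λ ^ (c - 1) * (P * d⁻¹) ^ (a - c + 1)) * g2 :=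
        mul_le_mul l1 bG.1 (by positivity) (by positivity)
      refine lt_of_mul_lt_mul_left ?_ (by positivity : 0 ≤ d ^ a)
      linarith
  set E := 2 * P ^ (a - c' + 1) * V + 5 * P ^ (c' - 1) * W + P ^ a * u⁻¹ ^ (2 * b)
  have hE : 0 < E := by positivity
  have hY : 0 ≤ Λ ^ a * y ^ 2 := by positivity
  -- `d ^ a * (d ^ a * E) ≤ 2 * E < R` leaves room for a number strictly in between.
  have hDE : d ^ a * (d ^ a * E) < R := by
    calc _ = d ^ a * d ^ a * E := by ring
      _ ≤ 2 * E := by gcongr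
      _ < R := hup
  set σ := Λ ^ a * y ^ 2 + (d ^ a * E + (d ^ a)⁻¹ * R) / 2 with hσ
  have hd0 : 0 < d ^ a := by linarith
  have hmid : d ^ a * E < (d ^ a)⁻¹ * R := by
    rw [lt_inv_mul_iff₀ hd0]; exact hDE
  have hdE : 0 < d ^ a * E := by positivity
  have hσ0 : 0 < σ := by rw [hσ]; linarith
  have h8 : Real.log σ ≤ L := by
    refine low σ hσ0 ?_
    have : R = d ^ a * ((d ^ a)⁻¹ * R) := by field_simp
    rw [this, ← mul_add]
    refine mul_lt_mul_of_pos_left ?_ hd0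
    rw [hσ]; linarith
  have h9 : L' ≤ Real.log (Λ ^ a * y ^ 2 + d ^ a * E) := by
    have hg : 0 ≤ g2 := sq_nonneg _
    have hf : 0 ≤ f2 := sq_nonneg _
    have hd00 : 0 < d := by linarith [hΛ1.trans hΛ2]
    have hQ : 0 < Λ ^ a * y ^ 2 + Λ ^ (c' - 1) * (P * d) ^ (a - c' + 1) * g2 +
      Λ ^ (a - c' + 1) * (P * d) ^ (c' - 1) * f2 + d ^ a * (P ^ a * u⁻¹ ^ (2 * b)) := by positivity
    refine up.trans (Real.log_le_log hQ ?_)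
    linarith
  refine lt_of_le_of_lt h9 (lt_of_lt_of_le (Real.log_lt_log (by linarith) ?_) h8)
  rw [hσ]; linarith

theorem pow_mul_eq_pow_pred_mul (b a : ℕ) (ha : 1 ≤ a) (P t : ℝ) :
    P ^ a * t ^ (2 * b) = P ^ (a - 1) * (P * t ^ (2 * b)) := by
  obtain ⟨n, rfl⟩ := Nat.exists_eq_add_of_le' ha
  rw [Nat.add_sub_cancel, pow_succ]; ring

/-- A narrow well beats the wells of all other widths. -/
theorem SmallWeights.rate_lt_rate_one {a b c : ℕ} {p s u L L' : ℝ} (h : SmallWeights p s u)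
    (hb : 1 ≤ b) (hc : 2 ≤ c) (hca : c < a) (ha : a * s ≤ 1 / 100)
    (hL : HasRate (periodOperator a b 1 p s u⁻¹) L)
    (hL' : HasRate (periodOperator a b c p s u⁻¹) L') : L' < L := by
  have hP := h.p_sq_pos
  have hP1 := h.p_sq_le
  have ht : 1 ≤ u⁻¹ ^ (2 * b) := one_le_pow₀ (by linarith [h.le_inv])
  have hs2 : s ^ 2 ≤ 1 / 10000 := by nlinarith [h.s_le, h.s_pos]
  have hW : p ^ 2 ≤ p ^ 2 * u⁻¹ ^ (2 * b) := le_mul_of_one_le_right hP.le ht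
  have hV : p ^ 2 * s ^ 2 ≤ 1 / 10000 * (p ^ 2 * u⁻¹ ^ (2 * b)) := by nlinarith
  have pw : ∀ n, 1 ≤ n → (p ^ 2) ^ n ≤ 1 / 100 := fun n hn =>
    (pow_le_of_le_one hP.le (by linarith) (by omega)).trans hP1
  refine h.rate_lt hb le_rfl (by omega) (by omega) hca ha
    (R := 1 / 2 * (p ^ 2 * u⁻¹ ^ (2 * b))) (by linarith) hL hL'
    (Or.inl (by simp)) ?_
  rw [pow_mul_eq_pow_pred_mul b a (by omega)]
  have e1 := pw (a - c + 1) (by omega)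
  have e2 := pw (c - 1) (by omega)
  have e3 := pw (a - 1) (by omega)
  have hV0 : 0 ≤ p ^ 2 * s ^ 2 := by positivity
  set W := p ^ 2 * u⁻¹ ^ (2 * b)
  set V := p ^ 2 * s ^ 2
  have hW0 : 0 < W := by linarith
  have f1 := mul_le_mul_of_nonneg_right e1 hV0
  have f2 := mul_le_mul_of_nonneg_right e2 hW0.le
  have f3 := mul_le_mul_of_nonneg_right e3 hW0.le
  linarith

/-- Where the filling of the well dominates, the rate decreases with `c`. -/
theorem SmallWeights.rate_succ_lt {a b c : ℕ} {p s u L L' : ℝ} (h : SmallWeights p s u)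
    (hb : 1 ≤ b) (hc : 1 ≤ c) (hca : c + 1 < a) (ha : a * s ≤ 1 / 100)
    (hdom : (p ^ 2) ^ (a - c) * (p ^ 2 * s ^ 2) ≤
      1 / 100 * ((p ^ 2) ^ (c - 1) * (p ^ 2 * u⁻¹ ^ (2 * b))))
    (hL : HasRate (periodOperator a b c p s u⁻¹) L)
    (hL' : HasRate (periodOperator a b (c + 1) p s u⁻¹) L') : L' < L := by
  have hP := h.p_sq_pos
  have hP1 := h.p_sq_le
  have ht : 0 < u⁻¹ := inv_pos.2 h.u_pos
  refine h.rate_lt hb hc (by omega) (by omega) hca ha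
    (R := 1 / 2 * (p ^ 2) ^ (c - 1) * (p ^ 2 * u⁻¹ ^ (2 * b))) (by positivity) hL hL'
    (Or.inl le_rfl) ?_
  rw [pow_mul_eq_pow_pred_mul b a (by omega), show a - (c + 1) + 1 = a - c by omega,
    Nat.add_sub_cancel]
  have hW0 : 0 < p ^ 2 * u⁻¹ ^ (2 * b) := by positivity
  set W := p ^ 2 * u⁻¹ ^ (2 * b)
  have e2 : (p ^ 2) ^ c = p ^ 2 * (p ^ 2) ^ (c - 1) := by
    rw [← pow_succ', Nat.sub_add_cancel hc]
  have e3 : (p ^ 2) ^ (a - 1) ≤ (p ^ 2) ^ c := pow_le_pow_of_le_one hP.le (by linarith) (by omega)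
  have hX : 0 < (p ^ 2) ^ (c - 1) * W := by positivity
  have f2 : (p ^ 2) ^ c * W ≤ 1 / 100 * ((p ^ 2) ^ (c - 1) * W) := by
    rw [e2, mul_assoc]; exact mul_le_mul_of_nonneg_right hP1 hX.le
  have f3 := mul_le_mul_of_nonneg_right e3 hW0.le
  linarith

/-- Where the covering of the plateau dominates, the rate increases with `c`. -/
theorem SmallWeights.rate_lt_succ {a b c : ℕ} {p s u L L' : ℝ} (h : SmallWeights p s u)
    (hb : 1 ≤ b) (hc : 1 ≤ c) (hca : c + 1 < a) (ha : a * s ≤ 1 / 100)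
    (hdom : (p ^ 2) ^ (c - 1) * (p ^ 2 * u⁻¹ ^ (2 * b)) ≤
      1 / 100 * ((p ^ 2) ^ (a - c) * (p ^ 2 * s ^ 2)))
    (hL : HasRate (periodOperator a b (c + 1) p s u⁻¹) L)
    (hL' : HasRate (periodOperator a b c p s u⁻¹) L') : L' < L := by
  have hP := h.p_sq_pos
  have hP1 := h.p_sq_le
  have ht : 0 < u⁻¹ := inv_pos.2 h.u_pos
  have hs := h.s_pos
  refine h.rate_lt hb (by omega) hca hc (by omega) ha
    (R := 1 / 2 * (p ^ 2) ^ (a - c) * (p ^ 2 * s ^ 2)) (by positivity) hL hL'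
    (Or.inr (by rw [show a - (c + 1) + 1 = a - c by omega])) ?_
  rw [pow_mul_eq_pow_pred_mul b a (by omega)]
  have hW0 : 0 < p ^ 2 * u⁻¹ ^ (2 * b) := by positivity
  set W := p ^ 2 * u⁻¹ ^ (2 * b)
  set V := p ^ 2 * s ^ 2
  have e3 : (p ^ 2) ^ (a - 1) ≤ (p ^ 2) ^ (c - 1) :=
    pow_le_pow_of_le_one hP.le (by linarith) (by omega)
  have hX : 0 < (p ^ 2) ^ (a - c) * V := by positivity
  have f2 : (p ^ 2) ^ (a - c + 1) * V ≤ 1 / 100 * ((p ^ 2) ^ (a - c) * V) := by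
    rw [pow_succ', mul_assoc]; exact mul_le_mul_of_nonneg_right hP1 hX.le
  have f3 := mul_le_mul_of_nonneg_right e3 hW0.le
  linarith

/-! ### The low-temperature condition -/

theorem exp_neg_le_of_five_le {x : ℝ} (hx : 5 ≤ x) : Real.exp (-x) ≤ 1 / 100 := by
  have h1 : (2.7 : ℝ) ^ 5 ≤ Real.exp 1 ^ 5 :=
    pow_le_pow_left₀ (by norm_num) (by linarith [Real.exp_one_gt_d9]) 5
  rw [← Real.exp_nat_mul] at h1
  have h2 : Real.exp ((5 : ℕ) * 1) ≤ Real.exp x := Real.exp_le_exp.2 (by push_cast; linarith)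
  have h3 := h1.trans h2
  rw [Real.exp_neg, inv_le_comm₀ (Real.exp_pos _) (by norm_num)]
  norm_num at h3 ⊢
  linarith

theorem exp_neg_le_mul_exp_neg {x y : ℝ} (h : 5 ≤ x - y) :
    Real.exp (-x) ≤ 1 / 100 * Real.exp (-y) := by
  calc Real.exp (-x) = Real.exp (-(x - y)) * Real.exp (-y) := by rw [← Real.exp_add]; congr 1; ring
    _ ≤ _ := mul_le_mul_of_nonneg_right (exp_neg_le_of_five_le h) (Real.exp_pos _).le

/-- The low-temperature condition in terms of `x = β J'` and `k = 2 (b + 1) β K₁`. -/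
theorem LowTemp.bounds {β J' K₁ : ℝ} {a b c : ℕ} (hβ : 0 < β) (h : LowTemp β a b c J' K₁)
    (hb : 1 ≤ b) (hc : 1 ≤ c) (ha : 3 ≤ a) :
    1.9 * a + 2 ≤ β * J' ∧ 16 ≤ 2 * ((b : ℝ) + 1) * (β * K₁) ∧
      16 ≤ |β * J' - ((b : ℝ) + 1) * (β * K₁)| := by
  have hb' : (1 : ℝ) ≤ b := by exact_mod_cast hb
  have hc' : (1 : ℝ) ≤ c := by exact_mod_cast hc
  have ha' : (3 : ℝ) ≤ a := by exact_mod_cast ha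
  have g1 : β * gap b J' K₁ ≤ β * (((b : ℝ) + 1) * J') :=
    mul_le_mul_of_nonneg_left (min_le_left _ _) hβ.le
  have g2 : β * gap b J' K₁ ≤ β * (2 * ((b : ℝ) + 1) * K₁) :=
    mul_le_mul_of_nonneg_left ((min_le_right _ _).trans (min_le_left _ _)) hβ.le
  have g3 : β * gap b J' K₁ ≤ β * |J' - ((b : ℝ) + 1) * K₁| :=
    mul_le_mul_of_nonneg_left ((min_le_right _ _).trans (min_le_right _ _)) hβ.le
  have h' : ((b : ℝ) + 1) * (1.9 * ((a : ℝ) + c) + 0.56) < β * gap b J' K₁ := h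
  have h16 : (16 : ℝ) ≤ ((b : ℝ) + 1) * (1.9 * ((a : ℝ) + c) + 0.56) := by nlinarith
  refine ⟨?_, by linarith, ?_⟩
  · have h1 : ((b : ℝ) + 1) * (1.9 * ((a : ℝ) + c) + 0.56) ≤ ((b : ℝ) + 1) * (β * J') := by linarith
    have := le_of_mul_le_mul_left h1 (by linarith)
    linarith
  · have e : β * J' - ((b : ℝ) + 1) * (β * K₁) = β * (J' - ((b : ℝ) + 1) * K₁) := by ring
    rw [e, abs_mul, abs_of_pos hβ]
    linarith

/-- In the exponents `q = 2 b x + k` of `P = p ^ 2`, `k` of the filled well and `3 q + 2 x` of the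
covered plateau: below the turning point the filling of the well dominates. -/
theorem exponent_lt_turningPoint {a b c : ℕ} {β J' K₁ : ℝ} (hβ : 0 < β) (hb : 1 ≤ b)
    (hx : 6 ≤ β * J') (hk : 16 ≤ 2 * ((b : ℝ) + 1) * (β * K₁))
    (hxk : 16 ≤ |β * J' - ((b : ℝ) + 1) * (β * K₁)|) (hct : c < turningPoint a b J' K₁) :
    5 ≤ ((a : ℝ) + 4 - 2 * c) * (2 * b * (β * J') + 2 * ((b : ℝ) + 1) * (β * K₁)) +
      2 * (β * J') - 2 * ((b : ℝ) + 1) * (β * K₁) := by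
  have hb' : (1 : ℝ) ≤ b := by exact_mod_cast hb
  have hq : 0 ≤ 2 * b * (β * J') + 2 * ((b : ℝ) + 1) * (β * K₁) := by positivity
  have hbx : β * J' ≤ b * (β * J') := le_mul_of_one_le_left (by linarith) hb'
  rw [turningPoint] at hct
  split_ifs at hct with h1 h2
  · have h3 : 2 * c ≤ a + 3 := by obtain ⟨r, rfl⟩ := h1; omega
    have h4 : (2 * c : ℝ) ≤ a + 3 := by exact_mod_cast h3
    have := mul_le_mul_of_nonneg_right (by linarith : (1 : ℝ) ≤ (a : ℝ) + 4 - 2 * c) hq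
    linarith
  · have h3 : 2 * c ≤ a + 2 := by rw [Nat.not_odd_iff_even] at h1; obtain ⟨r, rfl⟩ := h1; omega
    have h4 : (2 * c : ℝ) ≤ a + 2 := by exact_mod_cast h3
    have := mul_le_mul_of_nonneg_right (by linarith : (1 : ℝ) ≤ (a : ℝ) + 4 - 2 * c) hq
    linarith
  · have h3 : 2 * c ≤ a + 4 := by rw [Nat.not_odd_iff_even] at h1; obtain ⟨r, rfl⟩ := h1; omega
    have h4 : (2 * c : ℝ) ≤ a + 4 := by exact_mod_cast h3
    have h5 := mul_nonneg (by linarith : (0 : ℝ) ≤ (a : ℝ) + 4 - 2 * c) hq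
    have h6 : 0 ≤ β * J' - ((b : ℝ) + 1) * (β * K₁) := by
      have := mul_le_mul_of_nonneg_left (not_lt.1 h2) hβ.le
      linarith
    rw [abs_of_nonneg h6] at hxk
    linarith

/-- From the turning point on the covering of the plateau dominates. -/
theorem exponent_turningPoint_le {a b c : ℕ} {β J' K₁ : ℝ} (hβ : 0 < β) (hb : 1 ≤ b)
    (hx : 6 ≤ β * J') (hk : 16 ≤ 2 * ((b : ℝ) + 1) * (β * K₁))
    (hxk : 16 ≤ |β * J' - ((b : ℝ) + 1) * (β * K₁)|) (hct : turningPoint a b J' K₁ ≤ c) :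
    5 ≤ (2 * (c : ℝ) - a - 4) * (2 * b * (β * J') + 2 * ((b : ℝ) + 1) * (β * K₁)) +
      2 * ((b : ℝ) + 1) * (β * K₁) - 2 * (β * J') := by
  have hb' : (1 : ℝ) ≤ b := by exact_mod_cast hb
  have hq : 0 ≤ 2 * b * (β * J') + 2 * ((b : ℝ) + 1) * (β * K₁) := by positivity
  have hbx : β * J' ≤ b * (β * J') := le_mul_of_one_le_left (by linarith) hb'
  rw [turningPoint] at hct
  split_ifs at hct with h1 h2
  · have h3 : a + 5 ≤ 2 * c := by obtain ⟨r, rfl⟩ := h1; omega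
    have h4 : (a + 5 : ℝ) ≤ 2 * c := by exact_mod_cast h3
    have := mul_le_mul_of_nonneg_right (by linarith : (1 : ℝ) ≤ 2 * (c : ℝ) - a - 4) hq
    linarith
  · have h3 : a + 4 ≤ 2 * c := by rw [Nat.not_odd_iff_even] at h1; obtain ⟨r, rfl⟩ := h1; omega
    have h4 : (a + 4 : ℝ) ≤ 2 * c := by exact_mod_cast h3
    have h5 := mul_nonneg (by linarith : (0 : ℝ) ≤ 2 * (c : ℝ) - a - 4) hq
    have h6 : β * J' - ((b : ℝ) + 1) * (β * K₁) ≤ 0 := by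
      have := mul_le_mul_of_nonneg_left h2.le hβ.le
      linarith
    rw [abs_of_nonpos h6] at hxk
    linarith
  · have h3 : a + 6 ≤ 2 * c := by rw [Nat.not_odd_iff_even] at h1; obtain ⟨r, rfl⟩ := h1; omega
    have h4 : (a + 6 : ℝ) ≤ 2 * c := by exact_mod_cast h3
    have := mul_le_mul_of_nonneg_right (by linarith : (1 : ℝ) ≤ 2 * (c : ℝ) - a - 4) hq
    linarith

end SOSWetting

open SOSWetting in
theorem theorem5p1 (a b : ℕ) (hb : 1 ≤ b) (β JAB JAW JBW J' K₁ : ℝ) (hβ : 0 < β)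
    (hJ : 0 < JAB) (hJ'_def : J' = JAW - JBW) (hJ' : 0 < J')
    (hK₁_def : JAB - (2 * (b : ℝ) + 1) * J' = 2 * ((b : ℝ) + 1) * K₁)
    (hK₁ : 0 < 2 * ((b : ℝ) + 1) * K₁) :
    -- the roughness is fixed, the partition functions converge, and the limit tauAW exists
    (∀ c : ℕ, 1 ≤ c → c < a →
      roughness a (stepWall a b c) = 1 + 2 * (b : ℝ) / (a : ℝ) ∧
      (∀ N : ℕ, Summable (weight β JAB JAW JBW (stepWall a b c) N)) ∧
      Filter.Tendsto (finiteTension β JAB JAW JBW a (stepWall a b c)) Filter.atTop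
        (nhds (tauAW β JAB JAW JBW a (stepWall a b c)))) ∧
    -- a)
    (∀ c : ℕ, 2 ≤ c → c < a → LowTemp β a b c J' K₁ →
      deltaTau β JAB JAW JBW a b 1 < deltaTau β JAB JAW JBW a b c) ∧
    -- b)
    (∀ c : ℕ, 1 ≤ c → c + 1 < a → c < turningPoint a b J' K₁ → LowTemp β a b c J' K₁ →
      deltaTau β JAB JAW JBW a b c < deltaTau β JAB JAW JBW a b (c + 1)) ∧
    -- c)
    (∀ c : ℕ, turningPoint a b J' K₁ ≤ c → c + 1 < a → LowTemp β a b c J' K₁ →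
      deltaTau β JAB JAW JBW a b (c + 1) < deltaTau β JAB JAW JBW a b c) := by
  set x := β * J' with hx
  set k := 2 * ((b : ℝ) + 1) * (β * K₁) with hk
  set q := 2 * b * x + k with hq
  set u := Real.exp (-x) with hu
  set s := Real.exp (-β * JAB) with hs
  set p := Real.exp (-(q / 2)) with hp
  have hJAB : β * JAB = x + q := by
    rw [hq, hx, hk]; linear_combination β * hK₁_def
  have hP : p ^ 2 = Real.exp (-q) := by
    rw [hp, ← Real.exp_nat_mul]; congr 1; push_cast; ring
  have hpu : s = u * p ^ 2 := by
    rw [hP, hu, ← Real.exp_add, hs]; congr 1; linear_combination -hJAB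
  have hs1 : s < 1 := by
    rw [hs, Real.exp_lt_one_iff]; nlinarith
  have hu' : u = Real.exp (-β * (JAW - JBW)) := by
    rw [hu, ← hJ'_def, hx]; congr 1; ring
  have main := fun c (hc : 1 ≤ c) (hca : c < a) =>
    exists_rate_deltaTau (b := b) (p := p) hc hca hβ (Real.exp_pos _) hs hs1 hu' hpu
  have cmp : ∀ c c', 1 ≤ c → c < a → 1 ≤ c' → c' < a →
      (∀ L L', HasRate (periodOperator a b c p s u⁻¹) L →
        HasRate (periodOperator a b c' p s u⁻¹) L' → L' < L) →
      deltaTau β JAB JAW JBW a b c < deltaTau β JAB JAW JBW a b c' := by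
    intro c c' hc hca hc' hca' hlt
    obtain ⟨-, L, hL, -, e⟩ := main c hc hca
    obtain ⟨-, L', hL', -, e'⟩ := main c' hc' hca'
    have ha : (0 : ℝ) < a := by exact_mod_cast (by omega : 0 < a)
    have h1 := div_lt_div_of_pos_right (hlt L L' hL hL') (mul_pos hβ ha)
    rw [e, e']
    linarith
  have hx0 : 0 < x := mul_pos hβ hJ'
  have small : 3 ≤ a → 1.9 * a + 2 ≤ x → 16 ≤ k → SmallWeights p s u ∧ a * s ≤ 1 / 100 := by
    intro ha h1 h2
    have ha' : (3 : ℝ) ≤ a := by exact_mod_cast ha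
    have hbx : 0 ≤ 2 * b * x := by positivity
    have hP1 : p ^ 2 ≤ 1 / 100 := by rw [hP]; exact exp_neg_le_of_five_le (by linarith)
    have hau : a * u ≤ 1 := by
      rw [hu, Real.exp_neg, ← div_eq_mul_inv, div_le_one (Real.exp_pos _)]
      linarith [Real.add_one_le_exp x]
    refine ⟨⟨Real.exp_pos _, Real.exp_pos _, hpu, hP1, exp_neg_le_of_five_le (by linarith)⟩, ?_⟩
    calc a * s = a * u * p ^ 2 := by rw [hpu]; ring
      _ ≤ 1 * p ^ 2 := mul_le_mul_of_nonneg_right hau (sq_nonneg p)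
      _ ≤ 1 / 100 := by rw [one_mul]; exact hP1
  have pow_P : ∀ n : ℕ, (p ^ 2) ^ n = Real.exp (-(n * q)) := fun n => by
    rw [hP, ← Real.exp_nat_mul]; congr 1; ring
  have hW : p ^ 2 * u⁻¹ ^ (2 * b) = Real.exp (-k) := by
    rw [hP, hu, ← Real.exp_neg, ← Real.exp_nat_mul, ← Real.exp_add]
    congr 1; push_cast; rw [hq]; ring
  have hV : p ^ 2 * s ^ 2 = Real.exp (-(3 * q + 2 * x)) := by
    rw [hpu, hP, hu, mul_pow, ← Real.exp_nat_mul, ← Real.exp_nat_mul, ← Real.exp_add,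
      ← Real.exp_add]
    congr 1; push_cast; ring
  have well : ∀ c : ℕ, 1 ≤ c →
      (p ^ 2) ^ (c - 1) * (p ^ 2 * u⁻¹ ^ (2 * b)) = Real.exp (-(((c : ℝ) - 1) * q + k)) :=
    fun c hc => by
      rw [pow_P, hW, ← Real.exp_add, Nat.cast_sub hc]; congr 1; push_cast; ring
  have plateau : ∀ c : ℕ, c ≤ a →
      (p ^ 2) ^ (a - c) * (p ^ 2 * s ^ 2) = Real.exp (-(((a : ℝ) - c + 3) * q + 2 * x)) :=
    fun c hc => by
      rw [pow_P, hV, ← Real.exp_add, Nat.cast_sub hc]; congr 1; ring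
  refine ⟨fun c hc hca => ?_, fun c hc hca hT => ?_, fun c hc hca hct hT => ?_,
    fun c hct hca hT => ?_⟩
  · obtain ⟨h1, _, _, h2, _⟩ := main c hc hca
    exact ⟨roughness_stepWall hc hca, h1, h2⟩
  · obtain ⟨h1, h2, -⟩ := hT.bounds hβ hb (by omega) (by omega)
    obtain ⟨h, hs⟩ := small (by omega) h1 h2
    exact cmp 1 c le_rfl (by omega) (by omega) hca fun L L' hL hL' =>
      h.rate_lt_rate_one hb hc hca hs hL hL'
  · obtain ⟨h1, h2, h3⟩ := hT.bounds hβ hb hc (by omega)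
    obtain ⟨h, hs⟩ := small (by omega) h1 h2
    refine cmp c (c + 1) hc (by omega) (by omega) hca fun L L' hL hL' =>
      h.rate_succ_lt hb hc hca hs ?_ hL hL'
    have ha0 : (3 : ℝ) ≤ a := by exact_mod_cast (by omega : 3 ≤ a)
    have key := exponent_lt_turningPoint hβ hb (by linarith) h2 h3 hct
    rw [well c hc, plateau c (by omega)]
    exact exp_neg_le_mul_exp_neg (key.trans (le_of_eq (by rw [hq, hk, hx]; ring)))
  · have hc : 1 ≤ c := by
      refine le_trans ?_ hct
      rw [turningPoint]; split_ifs <;> omega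
    obtain ⟨h1, h2, h3⟩ := hT.bounds hβ hb hc (by omega)
    obtain ⟨h, hs⟩ := small (by omega) h1 h2
    refine cmp (c + 1) c (by omega) hca hc (by omega) fun L L' hL hL' =>
      h.rate_lt_succ hb hc hca hs ?_ hL hL'
    have ha0 : (3 : ℝ) ≤ a := by exact_mod_cast (by omega : 3 ≤ a)
    have key := exponent_turningPoint_le hβ hb (by linarith) h2 h3 hct
    rw [well c hc, plateau c (by omega)]
    exact exp_neg_le_mul_exp_neg (key.trans (le_of_eq (by rw [hq, hk, hx]; ring)))
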